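/- Let $N\ge 2$, $0<\lambda\le\Lambda$, and for a real symmetric $N\times N$ matrix $X$ with eigenvalues $\lambda_1,\dots,\lambda_N$ let $$\mathcal M^-(X)=\Lambda\sum_{\lambda_i<0}\lambda_i+\lambda\sum_{\lambda_i>0}\lambda_i,\qquad \mathcal M^+(X)=\lambda\sum_{\lambda_i<0}\lambda_i+\Lambda\sum_{\lambda_i>0}\lambda_i$$ be Pucci's extremal operators. Let $\Omega\subset\mathbb R^N$ be an open set of class $C^2$, not necessarily bounded, with boundary $\Gamma$. Let $x\in\Omega$, $R>0$ and $z_x\in\Gamma$ be such that $\overline{B_R(x)}\cap(\mathbb R^N\setminus\Omega)=\{z_x\}$, and assume that the principal curvatures $\kappa_1,\dots,\kappa_{N-1}$ of $\Gamma$ with respect to the inner normal (positive for balls) satisfy $\kappa_j(z_x)<1/R$ for all $j$. Set $\Pi_0(z_x)=\prod_{j=1}^{N-1}\bigl(1-R\,\kappa_j(z_x)\bigr)$. Let $v^\pm$ be the bounded viscosity solution of $$v_t-\mathcal M^\pm(\nabla^2 v)=0\ \text{ in }\Omega\times(0,\infty),\qquad v=0\ \text{ on }\Omega\times\{0\},\qquad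 v=1\ \text{ on }\Gamma\times(0,\infty),$$ where $v$ is continuous on $\bigl(\overline\Omega\times[0,\infty)\bigr)\setminus\bigl(\Gamma\times\{0\}\bigr)$. For $1<q\le\infty$ and $t>0$ let $\mu_q^\pm(x,t)$ be the $q$-mean of $v^\pm(\cdot,t)$ on $B_R(x)$, i.e. the unique minimum point of $\mathbb R\ni\mu\mapsto\|v^\pm(\cdot,t)-\mu\|_{L^q(B_R(x))}$. Then, for every $1<q<\infty$, $$\lim_{t\to0^+}\Bigl(\frac{R^2}{t}\Bigr)^{\frac{N+1}{4(q-1)}}\mu_q^-(x,t)=C_{N,q}\Bigl\{\frac{\Pi_0(z_x)}{\lambda^{\frac{N+1}2}}\Bigr\}^{-\frac1{2(q-1)}},\qquad \lim_{t\to0^+}\Bigl(\frac{R^2}{t}\Bigr)^{\frac{N+1}{4(q-1)}}\mu_q^+(x,t)=C_{N,q}\Bigl\{\frac{\Pi_0(z_x)}{\Lambda^{\frac{N+1}2}}\Bigr\}^{-\frac1{2(q-1)}},$$ where $$C_{N,q}=\left[\frac{N!\,\int_0^\infty \mathrm{Erfc}(\sigma)^{q-1}\sigma^{\frac{N-1}2}\,d\sigma}{\Gamma\bigl(\frac{N+1}2\bigr)^2}\right]^{\frac1{q-1}},\qquad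 \mathrm{Erfc}(\sigma)=\frac2{\sqrt\pi}\int_\sigma^\infty e^{-s^2}\,ds,$$ and $\Gamma\bigl(\frac{N+1}2\bigr)$ is the value of Euler's gamma function. For $q=\infty$, $$\lim_{t\to0^+}\mu_\infty^\pm(x,t)=\frac12 .$$ -/

import Mathlib

open Set Filter Topology MeasureTheory

/-- `ℝ^N` with its Euclidean norm. -/
abbrev RN (N : ℕ) : Type := EuclideanSpace ℝ (Fin N)

/-! ### Pucci's extremal operators -/

/-- `M⁻(X) = Λ ∑_{λᵢ<0} λᵢ + λ ∑_{λᵢ>0} λᵢ`, where the `λᵢ` are the eigenvalues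
(with multiplicity) of the real symmetric matrix `X`. -/
noncomputable def pucciMinus {N : ℕ} (lam Lam : ℝ) (X : Matrix (Fin N) (Fin N) ℝ)
    (hX : X.IsHermitian) : ℝ :=
  Lam * ∑ i, min (hX.eigenvalues i) 0 + lam * ∑ i, max (hX.eigenvalues i) 0

/-- `M⁺(X) = λ ∑_{λᵢ<0} λᵢ + Λ ∑_{λᵢ>0} λᵢ`. -/
noncomputable def pucciPlus {N : ℕ} (lam Lam : ℝ) (X : Matrix (Fin N) (Fin N) ℝ)
    (hX : X.IsHermitian) : ℝ :=
  lam * ∑ i, min (hX.eigenvalues i) 0 + Lam * ∑ i, max (hX.eigenvalues i) 0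

/-! ### Viscosity solutions of `v_t - F(∇²v) = 0` -/

/-- The Hessian matrix `(∂²f/∂xᵢ∂xⱼ)(x)`. -/
noncomputable def hessian {N : ℕ} (f : RN N → ℝ) (x : RN N) : Matrix (Fin N) (Fin N) ℝ :=
  Matrix.of fun i j =>
    fderiv ℝ (fderiv ℝ f) x (EuclideanSpace.single i 1) (EuclideanSpace.single j 1)

theorem hessian_isHermitian {N : ℕ} {f : RN N → ℝ} {x : RN N} (hf : ContDiffAt ℝ 2 f x) :
    (hessian f x).IsHermitian := by
  ext i j
  exact hf.isSymmSndFDerivAt (by simp) _ _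

theorem spatial_hessian_isHermitian {N : ℕ} {φ : RN N × ℝ → ℝ} {p : RN N × ℝ}
    (hφ : ContDiffAt ℝ 2 φ p) : (hessian (fun y => φ (y, p.2)) p.1).IsHermitian :=
  hessian_isHermitian
    (ContDiffAt.comp p.1 (f := fun y : RN N => (y, p.2)) hφ (by fun_prop))

/-- `v` is a viscosity subsolution of `v_t - F(∇²v) = 0` in `Ω × (0,∞)`: whenever a `C²` test
function `φ` touches `v` from above at a point, up to a constant, one has
`φ_t - F(∇²φ) ≤ 0` there. -/
def IsViscositySubsolution {N : ℕ} (F : (X : Matrix (Fin N) (Fin N) ℝ) → X.IsHermitian → ℝ)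
    (Ω : Set (RN N)) (v : RN N × ℝ → ℝ) : Prop :=
  ∀ p ∈ Ω ×ˢ Ioi (0 : ℝ), ∀ (φ : RN N × ℝ → ℝ) (hφ : ContDiffAt ℝ 2 φ p),
    IsLocalMax (fun y => v y - φ y) p →
      deriv (fun s => φ (p.1, s)) p.2
        - F (hessian (fun y => φ (y, p.2)) p.1) (spatial_hessian_isHermitian hφ) ≤ 0

/-- `v` is a viscosity supersolution of `v_t - F(∇²v) = 0` in `Ω × (0,∞)`. -/
def IsViscositySupersolution {N : ℕ} (F : (X : Matrix (Fin N) (Fin N) ℝ) → X.IsHermitian → ℝ)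
    (Ω : Set (RN N)) (v : RN N × ℝ → ℝ) : Prop :=
  ∀ p ∈ Ω ×ˢ Ioi (0 : ℝ), ∀ (φ : RN N × ℝ → ℝ) (hφ : ContDiffAt ℝ 2 φ p),
    IsLocalMin (fun y => v y - φ y) p →
      0 ≤ deriv (fun s => φ (p.1, s)) p.2
        - F (hessian (fun y => φ (y, p.2)) p.1) (spatial_hessian_isHermitian hφ)

/-- `v` is a bounded (viscosity) solution of
`v_t - F(∇²v) = 0` in `Ω × (0,∞)`, `v = 0` on `Ω × {0}`, `v = 1` on `∂Ω × (0,∞)`.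
The boundary and initial values are attained continuously; they are incompatible on
`∂Ω × {0}`, so continuity is not required there. -/
structure IsBoundedSolution {N : ℕ} (F : (X : Matrix (Fin N) (Fin N) ℝ) → X.IsHermitian → ℝ)
    (Ω : Set (RN N)) (v : RN N × ℝ → ℝ) : Prop where
  continuousOn : ContinuousOn v ((closure Ω ×ˢ Ici (0 : ℝ)) \ (frontier Ω ×ˢ {0}))
  bounded : ∃ C : ℝ, ∀ p ∈ closure Ω ×ˢ Ioi (0 : ℝ), |v p| ≤ C
  sub : IsViscositySubsolution F Ω v
  super : IsViscositySupersolution F Ω v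
  initial : ∀ y ∈ Ω, v (y, 0) = 0
  boundary : ∀ y ∈ frontier Ω, ∀ t : ℝ, 0 < t → v (y, t) = 1

/-! ### Domains of class `C²` and principal curvatures -/

/-- Near `z`, and in the coordinates `y - z = y' + y_N ν` with `y' ∈ ν^⊥` (`ν` a unit vector),
the set `Ω` is the region `y_N > φ(y')` and its boundary is the graph `y_N = φ(y')` of a function
`φ` that is of class `C²` near `0`. -/
structure IsC2GraphAt {N : ℕ} (Ω : Set (RN N)) (z ν : RN N)
    (φ : (Submodule.span ℝ {ν})ᗮ → ℝ) : Prop where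
  norm_eq : ‖ν‖ = 1
  contDiffAt : ContDiffAt ℝ 2 φ 0
  map_zero : φ 0 = 0
  mem_iff : ∀ᶠ y in 𝓝 z, y ∈ Ω ↔
    φ ((Submodule.span ℝ {ν})ᗮ.orthogonalProjectionOnto (y - z)) < inner ℝ ν (y - z)
  mem_frontier_iff : ∀ᶠ y in 𝓝 z, y ∈ frontier Ω ↔
    φ ((Submodule.span ℝ {ν})ᗮ.orthogonalProjectionOnto (y - z)) = inner ℝ ν (y - z)

/-- The open set `Ω` is of class `C²`: its boundary is locally the graph of a `C²` function, with
`Ω` on one side of it. -/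
def IsC2Domain {N : ℕ} (Ω : Set (RN N)) : Prop :=
  IsOpen Ω ∧ ∀ z ∈ frontier Ω, ∃ (ν : RN N) (φ : (Submodule.span ℝ {ν})ᗮ → ℝ),
    IsC2GraphAt Ω z ν φ

/-- `κ₁, …, κ_{N-1}` are the principal curvatures, with multiplicity, of `∂Ω` at `z` with respect to
the inner normal (positive for balls): `∂Ω` is near `z` the graph of a function `φ` over its tangent
hyperplane at `z`, the axis being the inner normal `ν`, and the Hessian of `φ` at `0` is
diagonal with entries `κ_j` in some orthonormal basis of that hyperplane. -/
def ArePrincipalCurvatures {N : ℕ} (Ω : Set (RN N)) (z : RN N) (κ : Fin (N - 1) → ℝ) : Prop :=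
  ∃ (ν : RN N) (φ : (Submodule.span ℝ {ν})ᗮ → ℝ)
    (b : OrthonormalBasis (Fin (N - 1)) ℝ (Submodule.span ℝ {ν})ᗮ),
    IsC2GraphAt Ω z ν φ ∧ fderiv ℝ φ 0 = 0 ∧
      ∀ i j, fderiv ℝ (fderiv ℝ φ) 0 (b i) (b j) = if i = j then κ i else 0

/-! ### `q`-means and constants -/

/-- `m` is the `q`-mean of `u` on `B`: the unique minimum point of `μ ↦ ‖u - μ‖_{L^q(B)}`. -/
def IsQMean {N : ℕ} (q : ENNReal) (B : Set (RN N)) (u : RN N → ℝ) (m : ℝ) : Prop :=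
  ∀ μ : ℝ, μ ≠ m →
    eLpNorm (fun y => u y - m) q (volume.restrict B)
      < eLpNorm (fun y => u y - μ) q (volume.restrict B)

/-- The complementary error function. -/
noncomputable def Erfc (σ : ℝ) : ℝ :=
  2 / Real.sqrt Real.pi * ∫ s in Ioi σ, Real.exp (-s ^ 2)

/-- `C_{N,q} = [ N! ∫₀^∞ Erfc(σ)^{q-1} σ^{(N-1)/2} dσ / Γ((N+1)/2)² ]^{1/(q-1)}`. -/
noncomputable def qMeanConst (N : ℕ) (q : ℝ) : ℝ :=
  ((N.factorial : ℝ) * (∫ σ in Ioi (0 : ℝ), Erfc σ ^ (q - 1) * σ ^ (((N : ℝ) - 1) / 2))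
    / Real.Gamma (((N : ℝ) + 1) / 2) ^ 2) ^ (1 / (q - 1))

/-- The asymptotic formulas, as `t → 0⁺`, for the `q`-means of `v(·,t)` on `B_R(x)`, `1 < q ≤ ∞`,
where `P` stands for `Π₀(z_x)` and `ℓ` for the relevant ellipticity constant (`λ` or `Λ`).
The `q`-means exist (and are unique) for all `t > 0`. -/
def QMeanAsymptotics {N : ℕ} (v : RN N × ℝ → ℝ) (x : RN N) (R P ℓ : ℝ) : Prop :=
  (∀ q : ℝ, 1 < q → ∃ μ : ℝ → ℝ,
    (∀ t : ℝ, 0 < t →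
      IsQMean (ENNReal.ofReal q) (Metric.ball x R) (fun y => v (y, t)) (μ t)) ∧
    Tendsto (fun t : ℝ => (R ^ 2 / t) ^ (((N : ℝ) + 1) / (4 * (q - 1))) * μ t) (𝓝[>] 0)
      (𝓝 (qMeanConst N q * (P / ℓ ^ (((N : ℝ) + 1) / 2)) ^ (-(1 / (2 * (q - 1))))))) ∧
  ∃ μ : ℝ → ℝ,
    (∀ t : ℝ, 0 < t → IsQMean ⊤ (Metric.ball x R) (fun y => v (y, t)) (μ t)) ∧
    Tendsto μ (𝓝[>] 0) (𝓝 (1 / 2))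

/-!
Write `l` for the ellipticity constant on the positive eigenvalues and `m` for the one on the
negative eigenvalues; `M⁻` has `(l, m) = (λ, Λ)` and `M⁺` has `(l, m) = (Λ, λ)`, so that both cases
are instances of one theorem for arbitrary `l, m > 0`.

Everything about the viscosity solution is obtained by comparison with explicit smooth functions
whose Hessian is, up to a controlled error, a rank one matrix; on such matrices the Pucci operator
is explicit (`abs_pucciMinus_sub_le`). The comparison principle with strict barriers on unbounded
sets is `PucciSub.le_of_barrier`. It yields interior Gaussian decay (`PucciSub.le_exp`), bounds by
error function profiles near the boundary (`PucciSub.le_lower_barrier`,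
`PucciSub.le_upper_barrier`), and a maximum principle which tolerates the discontinuity at the
corner `∂Ω × {0}` (`PucciSub.le_of_le_on_boundary`), hence `0 ≤ v ≤ 1`. Squeezing `v` between the
two kinds of barriers gives the boundary layer `v(y(t), t) → Erfc (s / (2 √l))` whenever `y(t)` tends
to a boundary point and its height above the boundary is asymptotic to `s √t`
(`IsBoundedSolution.tendsto_Erfc`). Only `l` enters, as the profile is convex in the distance.

The touching ball is `B_R(z + R ν)` with `ν` the inner normal. In the coordinates
`y = z + √t s ν + t^(1/4) ∑ η_j b_j` the ball becomes `∑ η_j² < 2 R s` and the height above the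
boundary becomes `s - ½ ∑ κ_j η_j²`. Dominated convergence, with a Gaussian majorant coming from
interior decay and `κ_j < 1 / R`, gives the limit of `t^(-(N+1)/4) ∫ v^q` over the ball
(`IsBoundedSolution.tendsto_integral_pos_part`); integrating first over the ellipsoids
`∑ (1/R - κ_j) η_j² < 2 s` evaluates it (`integral_limitIntegrand`), and this is where the product
`∏ (1 - R κ_j)` comes from.

For `1 < e < ∞` the `e`-mean is the zero of the decreasing function
`c ↦ ∫ sign(v - c) |v - c|^(e-1)` (`exists_eLpNorm_sub_lt`). At `c = t^a d`, with
`a = (N+1) / (4(e-1))`, the part of this integral where `v > c` and the part where `v < c` are of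
the same order `t^((N+1)/4)`; their rescaled limits are `J`, the value of the limit integral, and
`d^(e-1) |B_R|`. Thus `t^(-a)` times the mean tends to the solution `d` of `J = d^(e-1) |B_R|`. For
`e = ∞` the mean is the midpoint of the range of `v` over the ball, whose supremum is `1`, attained
in the limit at `z`, and whose infimum tends to `0`.
-/

/-! ### The Pucci operator at nearly rank one matrices -/

/-- The action of the Pucci operator with constants `l` (on the positive part) and `m` (on the
negative part) on a single eigenvalue. -/
noncomputable def pucciScalar (l m α : ℝ) : ℝ := m * min α 0 + l * max α 0

theorem pucciMinus_eq_sum {N : ℕ} (l m : ℝ) (X : Matrix (Fin N) (Fin N) ℝ) (hX : X.IsHermitian) :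
    pucciMinus l m X hX = ∑ i, pucciScalar l m (hX.eigenvalues i) := by
  simp only [pucciMinus, pucciScalar, Finset.mul_sum, Finset.sum_add_distrib]

theorem pucciScalar_mul_of_nonneg {l m α c : ℝ} (hc : 0 ≤ c) :
    pucciScalar l m (α * c) = pucciScalar l m α * c := by
  have h1 : min (α * c) 0 = min α 0 * c := by rw [min_mul_of_nonneg _ _ hc, zero_mul]
  have h2 : max (α * c) 0 = max α 0 * c := by rw [max_mul_of_nonneg _ _ hc, zero_mul]
  simp only [pucciScalar, h1, h2]; ring

theorem pucciScalar_of_nonneg {l m α : ℝ} (h : 0 ≤ α) : pucciScalar l m α = l * α := by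
  simp [pucciScalar, h]

theorem pucciScalar_of_nonpos {l m α : ℝ} (h : α ≤ 0) : pucciScalar l m α = m * α := by
  simp [pucciScalar, h]

theorem pucciScalar_neg (l m α : ℝ) : pucciScalar l m (-α) = -pucciScalar m l α := by
  rcases le_total 0 α with h | h
  · rw [pucciScalar_of_nonpos (by linarith), pucciScalar_of_nonneg h]; ring
  · rw [pucciScalar_of_nonneg (by linarith), pucciScalar_of_nonpos h]; ring

theorem abs_pucciScalar_sub_le {l m : ℝ} (hl : 0 < l) (hm : 0 < m) (a b : ℝ) :
    |pucciScalar l m a - pucciScalar l m b| ≤ max l m * |a - b| := by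
  wlog h : b ≤ a generalizing a b
  · rw [abs_sub_comm, abs_sub_comm a b]; exact this b a (le_of_not_ge h)
  have hl' := le_max_left l m
  have hm' := le_max_right l m
  rw [abs_of_nonneg (sub_nonneg.2 h)]
  rcases le_total 0 a with ha | ha <;> rcases le_total 0 b with hb | hb <;>
    simp only [pucciScalar_of_nonneg, pucciScalar_of_nonpos, ha, hb] <;>
    rw [abs_le] <;> constructor <;> nlinarith

/-- The Pucci operator at a matrix which is `α ν ⊗ ν` up to a quadratic form bounded by `β`: each
eigenvalue is compared with the value of `α ⟨ν, ·⟩²` at the corresponding eigenvector. -/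
theorem abs_pucciMinus_sub_le {N : ℕ} {l m : ℝ} (hl : 0 < l) (hm : 0 < m)
    {X : Matrix (Fin N) (Fin N) ℝ} (hX : X.IsHermitian) {α β : ℝ} {ν : RN N}
    (h : ∀ ξ : RN N, |(ξ : Fin N → ℝ) ⬝ᵥ (X.mulVec ξ) - α * (inner ℝ ν ξ) ^ 2| ≤ β * ‖ξ‖ ^ 2) :
    |pucciMinus l m X hX - pucciScalar l m α * ‖ν‖ ^ 2| ≤ N * max l m * β := by
  set e := hX.eigenvectorBasis
  have hν : ‖ν‖ ^ 2 = ∑ i, (inner ℝ ν (e i)) ^ 2 := (e.sum_sq_inner_left ν).symm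
  rw [pucciMinus_eq_sum, hν, Finset.mul_sum, ← Finset.sum_sub_distrib]
  have hpos : 0 < max l m := lt_max_of_lt_left hl
  calc _ ≤ ∑ i, |pucciScalar l m (hX.eigenvalues i) - pucciScalar l m α * (inner ℝ ν (e i)) ^ 2| :=
        Finset.abs_sum_le_sum_abs _ _
    _ ≤ ∑ _i : Fin N, max l m * β := by
        refine Finset.sum_le_sum fun i _ => ?_
        rw [← pucciScalar_mul_of_nonneg (sq_nonneg _)]
        refine (abs_pucciScalar_sub_le hl hm _ _).trans
          (mul_le_mul_of_nonneg_left ?_ hpos.le)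
        have h1 := h (e i)
        rw [e.norm_eq_one] at h1
        rw [hX.eigenvalues_eq i]
        simpa using h1
    _ = _ := by simp; ring

theorem dotProduct_hessian_mulVec {N : ℕ} (f : RN N → ℝ) (x ξ : RN N) :
    (ξ : Fin N → ℝ) ⬝ᵥ ((hessian f x).mulVec ξ) = fderiv ℝ (fderiv ℝ f) x ξ ξ := by
  have hξ : ξ = ∑ i, ξ i • EuclideanSpace.single i (1 : ℝ) := by
    ext j; simp [Finset.sum_apply, Pi.single_apply]
  conv_rhs => rw [hξ]
  simp only [map_sum, map_smul, sum_apply, smul_apply,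
    dotProduct, Matrix.mulVec, hessian, Matrix.of_apply, smul_eq_mul, Finset.mul_sum]
  rw [Finset.sum_comm]
  refine Finset.sum_congr rfl fun i _ => Finset.sum_congr rfl fun j _ => ?_
  ring

/-- The second derivative `D²φ(y, t)(ξ, ξ)` in the space variable `y`. -/
noncomputable def spatialD2 {N : ℕ} (φ : RN N × ℝ → ℝ) (p : RN N × ℝ) (ξ : RN N) : ℝ :=
  fderiv ℝ (fderiv ℝ fun y => φ (y, p.2)) p.1 ξ ξ

/-- A weak form of the notion of viscosity subsolution of `u_t = F(∇²u)`, `F` the Pucci operator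
with constants `l` on positive and `m` on negative eigenvalues. It only refers to the value of `F`
at Hessians which are rank one up to an error `β`. Both a solution `v` and, with `l` and `m`
interchanged, `-v` satisfy it, so that the two bounds on a solution follow from one statement. -/
def PucciSub {N : ℕ} (l m : ℝ) (Ω : Set (RN N)) (u : RN N × ℝ → ℝ) : Prop :=
  ∀ p ∈ Ω ×ˢ Ioi (0 : ℝ), ∀ φ : RN N × ℝ → ℝ, ContDiffAt ℝ 2 φ p →
    IsLocalMax (fun y => u y - φ y) p → ∀ (α β : ℝ) (ν : RN N),
      (∀ ξ, |spatialD2 φ p ξ - α * (inner ℝ ν ξ) ^ 2| ≤ β * ‖ξ‖ ^ 2) →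
      deriv (fun s => φ (p.1, s)) p.2 ≤ pucciScalar l m α * ‖ν‖ ^ 2 + N * max l m * β

theorem IsViscositySubsolution.pucciSub {N : ℕ} {l m : ℝ} (hl : 0 < l) (hm : 0 < m)
    {Ω : Set (RN N)} {v : RN N × ℝ → ℝ} (hv : IsViscositySubsolution (pucciMinus l m) Ω v) :
    PucciSub l m Ω v := by
  intro p hp φ hφ hmax α β ν h
  have h1 := hv p hp φ hφ hmax
  have h2 := abs_pucciMinus_sub_le hl hm (spatial_hessian_isHermitian hφ) (α := α) (β := β) (ν := ν)
    (fun ξ => by rw [dotProduct_hessian_mulVec]; exact h ξ)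
  linarith [(abs_le.1 h2).2]

theorem spatialD2_neg {N : ℕ} (φ : RN N × ℝ → ℝ) (p : RN N × ℝ) (ξ : RN N) :
    spatialD2 (fun q => -φ q) p ξ = -spatialD2 φ p ξ := by
  have : (fderiv ℝ fun y => -φ (y, p.2)) = -(fderiv ℝ fun y => φ (y, p.2)) := by
    ext1 y; simp
  simp only [spatialD2]
  rw [this, fderiv_neg]; simp

theorem IsViscositySupersolution.pucciSub_neg {N : ℕ} {l m : ℝ} (hl : 0 < l) (hm : 0 < m)
    {Ω : Set (RN N)} {v : RN N × ℝ → ℝ} (hv : IsViscositySupersolution (pucciMinus l m) Ω v) :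
    PucciSub m l Ω (fun p => -v p) := by
  intro p hp φ hφ hmax α β ν h
  have hφ' : ContDiffAt ℝ 2 (fun q => -φ q) p := hφ.neg
  have hmin : IsLocalMin (fun y => v y - -φ y) p := by
    have := hmax.neg
    refine this.congr (Eventually.of_forall fun y => ?_)
    simp; ring
  have h1 := hv p hp _ hφ' hmin
  have h2 := abs_pucciMinus_sub_le hl hm (spatial_hessian_isHermitian hφ') (α := -α) (β := β)
    (ν := ν) (fun ξ => by
      rw [dotProduct_hessian_mulVec]
      change |spatialD2 (fun q => -φ q) p ξ - _| ≤ _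
      rw [spatialD2_neg, ← abs_neg]
      convert h ξ using 2; ring)
  rw [pucciScalar_neg] at h2
  have h3 : deriv (fun s => -φ (p.1, s)) p.2 = -deriv (fun s => φ (p.1, s)) p.2 := by simp
  rw [h3] at h1
  rw [max_comm m l]
  linarith [(abs_le.1 h2).1]

/-! ### Comparison with strict barriers -/

/-- `w` is near `p` a strict classical supersolution of the equation with constants `l`, `m`, as
witnessed by a rank one approximation of its Hessian. -/
def IsStrictBarrierAt {N : ℕ} (l m : ℝ) (w : RN N × ℝ → ℝ) (p : RN N × ℝ) : Prop :=
  ContDiffAt ℝ 2 w p ∧ ∃ (α β : ℝ) (ν : RN N),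
    (∀ ξ, |spatialD2 w p ξ - α * (inner ℝ ν ξ) ^ 2| ≤ β * ‖ξ‖ ^ 2) ∧
    pucciScalar l m α * ‖ν‖ ^ 2 + N * max l m * β < deriv (fun s => w (p.1, s)) p.2

theorem IsStrictBarrierAt.add_time {N : ℕ} {l m : ℝ} {w : RN N × ℝ → ℝ} {p : RN N × ℝ}
    (hw : IsStrictBarrierAt l m w p) {f : ℝ → ℝ} (hf : ContDiffAt ℝ 2 f p.2)
    (hf' : 0 ≤ deriv f p.2) : IsStrictBarrierAt l m (fun q => w q + f q.2) p := by
  obtain ⟨hw, α, β, ν, h1, h2⟩ := hw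
  refine ⟨hw.add (hf.comp p contDiffAt_snd), α, β, ν, fun ξ => ?_, ?_⟩
  · have : (fderiv ℝ fun y => w (y, p.2) + f p.2) = fderiv ℝ fun y => w (y, p.2) := by
      ext1 y; simp
    have h3 := h1 ξ
    simp only [spatialD2] at h3 ⊢
    rwa [this]
  · have h3 : DifferentiableAt ℝ (fun s => w (p.1, s)) p.2 := by
      have : ContDiffAt ℝ 2 (fun s : ℝ => w (p.1, s)) p.2 :=
        ContDiffAt.comp p.2 (f := fun s : ℝ => (p.1, s)) hw (by fun_prop)
      exact this.differentiableAt (by simp)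
    rw [deriv_fun_add h3 (hf.differentiableAt (by simp))]
    linarith

/-- Comparison principle between a subsolution `u` and a strict classical supersolution `w`,
on `U × (a, T)`: it suffices that `u ≤ w` at the boundary points with `a ≤ t < T`
and at infinity, up to any `ε > 0`. The boundary condition is a one-sided limit from the inside, so
that neither `u` nor `w` has to be continuous at the boundary. The penalty `η / (T - t)` removes the
final time, and `u - w - η / (T - t)` attains a positive maximum. -/
theorem PucciSub.le_of_barrier {N : ℕ} {l m : ℝ} {Ω U : Set (RN N)} {u w : RN N × ℝ → ℝ}
    (hu : PucciSub l m Ω u) (hU : IsOpen U) (hUΩ : U ⊆ Ω) {a T M : ℝ} (ha : 0 ≤ a)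
    (hcont : ContinuousOn u (U ×ˢ Ioo a T))
    (hM : ∀ p ∈ U ×ˢ Ioo a T, u p - w p ≤ M)
    (hw : ∀ p ∈ U ×ˢ Ioo a T, IsStrictBarrierAt l m w p)
    (hbd : ∀ p ∈ closure U ×ˢ Ico a T, p ∉ U ×ˢ Ioo a T → ∀ ε > 0,
      ∀ᶠ y in 𝓝[U ×ˢ Ioo a T] p, u y ≤ w y + ε)
    (hinf : ∀ ε > 0, ∃ ρ : ℝ, ∀ p ∈ U ×ˢ Ioo a T, ρ ≤ ‖p.1‖ → u p ≤ w p + ε) :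
    ∀ p ∈ U ×ˢ Ioo a T, u p ≤ w p := by
  intro p₀ hp₀
  by_contra hlt
  push Not at hlt
  have hp₀' : a < p₀.2 ∧ p₀.2 < T := hp₀.2
  set η : ℝ := (u p₀ - w p₀) / 2 * (T - p₀.2) with hη
  have hTp : 0 < T - p₀.2 := by linarith [hp₀'.2]
  have hηpos : 0 < η := by have : 0 < u p₀ - w p₀ := by linarith
                           positivity
  set f : ℝ → ℝ := fun t => η / (T - t) with hf
  set ε : ℝ := (u p₀ - w p₀) / 4 with hε
  have hεpos : 0 < ε := by simp only [hε]; linarith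
  set w' : RN N × ℝ → ℝ := fun q => w q + f q.2 with hw'
  have hval : u p₀ - w' p₀ = 2 * ε := by
    simp only [hw', hf, hη, hε]; field_simp; ring
  have hfpos : ∀ t < T, 0 < f t := fun t ht => div_pos hηpos (by linarith)
  -- beyond the time `T'` the penalty exceeds the bound `M`
  set T' : ℝ := T - η / (|M| + 1) with hT'
  have hT'T : T' < T := by
    have : 0 < η / (|M| + 1) := by positivity
    simp only [hT']; linarith
  have hlate : ∀ p ∈ U ×ˢ Ioo a T, T' < p.2 → u p - w' p < 0 := by
    intro p hp ht
    have h1 : |M| + 1 < f p.2 := by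
      have hp2 : p.2 < T := hp.2.2
      simp only [hf]
      rw [lt_div_iff₀ (by linarith)]
      have : T - p.2 < η / (|M| + 1) := by simp only [hT'] at ht; linarith
      rw [lt_div_iff₀ (by positivity)] at this
      linarith
    have h2 := hM p hp
    simp only [hw']; linarith [le_abs_self M]
  obtain ⟨ρ, hρ⟩ := hinf ε hεpos
  set C : Set (RN N × ℝ) := (closure U ∩ Metric.closedBall 0 ρ) ×ˢ Icc a T' with hC
  have hCcomp : IsCompact C :=
    ((isCompact_closedBall (0 : RN N) ρ).inter_left isClosed_closure).prod isCompact_Icc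
  set Bad : Set (RN N × ℝ) := {p | p ∈ C ∧ p ∉ U ×ˢ Ioo a T} with hBad
  have hch : ∀ p : RN N × ℝ, ∃ V : Set (RN N × ℝ), IsOpen V ∧ (p ∈ Bad → p ∈ V) ∧
      ∀ y ∈ V ∩ U ×ˢ Ioo a T, u y ≤ w y + ε := by
    intro p
    by_cases hp : p ∈ Bad
    · have := hbd p ⟨hp.1.1.1, hp.1.2.1, hp.1.2.2.trans_lt hT'T⟩ hp.2 ε hεpos
      rw [eventually_nhdsWithin_iff, eventually_nhds_iff] at this
      obtain ⟨V, h1, h2, h3⟩ := this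
      exact ⟨V, h2, fun _ => h3, fun y hy => h1 y hy.1 hy.2⟩
    · exact ⟨∅, isOpen_empty, fun h => absurd h hp, by simp⟩
  choose V hVo hVmem hV using hch
  -- `K` is a compact subset of the open cylinder outside which `u - w'` stays below `ε`.
  set K : Set (RN N × ℝ) := C \ ⋃ p, V p with hK
  have hKcomp : IsCompact K := hCcomp.diff (isOpen_iUnion hVo)
  have hKsub : K ⊆ U ×ˢ Ioo a T := by
    intro p hp
    by_contra h
    exact hp.2 (mem_iUnion.2 ⟨p, hVmem p ⟨hp.1, h⟩⟩)
  have hout : ∀ p ∈ U ×ˢ Ioo a T, p ∉ K → u p - w' p ≤ ε := by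
    intro p hp hpK
    have hfp := hfpos p.2 hp.2.2
    by_cases ht : T' < p.2
    · linarith [hlate p hp ht]
    push Not at ht
    by_cases hn : ρ ≤ ‖p.1‖
    · have := hρ p hp hn
      simp only [hw']; linarith
    push Not at hn
    have hpC : p ∈ C := ⟨⟨subset_closure hp.1, by simpa using hn.le⟩, hp.2.1.le, ht⟩
    have : p ∈ ⋃ p, V p := by
      by_contra h
      exact hpK ⟨hpC, h⟩
    obtain ⟨r, hr⟩ := mem_iUnion.1 this
    have := hV r p ⟨hr, hp⟩
    simp only [hw']; linarith
  have hp₀K : p₀ ∈ K := by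
    by_contra h
    linarith [hout p₀ hp₀ h]
  have hfsm : ∀ t < T, ContDiffAt ℝ 2 f t := fun t ht =>
    contDiffAt_const.div (contDiffAt_const.sub contDiffAt_id) (by simp; linarith)
  have hbar : ∀ p ∈ U ×ˢ Ioo a T, IsStrictBarrierAt l m w' p := by
    intro p hp
    have hp2 : p.2 < T := hp.2.2
    refine (hw p hp).add_time (hfsm _ hp2) ?_
    have : HasDerivAt f (η * (-(-1) / (T - p.2) ^ 2)) p.2 := by
      have h1 : HasDerivAt (fun t => T - t) (-1) p.2 := (hasDerivAt_id p.2).const_sub T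
      simpa only [hf, div_eq_mul_inv] using (h1.fun_inv (by linarith)).const_mul η
    rw [this.deriv]
    have : 0 < T - p.2 := by linarith
    positivity
  have hcw : ContinuousOn (fun p => u p - w' p) K :=
    (hcont.mono hKsub).sub fun p hp => (hbar p (hKsub hp)).1.continuousAt.continuousWithinAt
  obtain ⟨p, hpK, hpmax⟩ := hKcomp.exists_isMaxOn ⟨p₀, hp₀K⟩ hcw
  have hpU := hKsub hpK
  have hglob : ∀ y ∈ U ×ˢ Ioo a T, u y - w' y ≤ u p - w' p := by
    intro y hy
    by_cases hyK : y ∈ K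
    · exact hpmax hyK
    · have h1 := hout y hy hyK
      have h2 : u p₀ - w' p₀ ≤ u p - w' p := hpmax hp₀K
      linarith
  have hloc : IsLocalMax (fun y => u y - w' y) p :=
    Filter.mem_of_superset ((hU.prod isOpen_Ioo).mem_nhds hpU) hglob
  obtain ⟨hsm, α, β, ν, h1, h2⟩ := hbar p hpU
  have := hu p ⟨hUΩ hpU.1, ha.trans_lt hpU.2.1⟩ w' hsm hloc α β ν h1
  linarith

/-! ### The complementary error function -/

theorem integrable_exp_neg_sq : Integrable fun s : ℝ => Real.exp (-s ^ 2) := by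
  simpa using integrable_exp_neg_mul_sq (b := 1) one_pos

theorem Erfc_eq_sub (x : ℝ) :
    Erfc x = 1 - 2 / Real.sqrt Real.pi * ∫ s in (0 : ℝ)..x, Real.exp (-s ^ 2) := by
  have h0 : ∫ s in Ioi (0 : ℝ), Real.exp (-s ^ 2) = Real.sqrt Real.pi / 2 := by
    simpa using integral_gaussian_Ioi 1
  have h := intervalIntegral.integral_Ioi_sub_Ioi' (a := 0) (b := x) (μ := volume)
    (integrable_exp_neg_sq.integrableOn) (integrable_exp_neg_sq.integrableOn)
  have hpi : Real.sqrt Real.pi ≠ 0 := by positivity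
  rw [Erfc, ← h, h0]
  field_simp
  ring

theorem hasDerivAt_Erfc (x : ℝ) :
    HasDerivAt Erfc (-(2 / Real.sqrt Real.pi * Real.exp (-x ^ 2))) x := by
  have hc : Continuous fun s : ℝ => Real.exp (-s ^ 2) := by fun_prop
  have h := (intervalIntegral.integral_hasDerivAt_right (hc.intervalIntegrable 0 x)
    hc.stronglyMeasurable.stronglyMeasurableAtFilter hc.continuousAt)
  have h2 := (h.const_mul (2 / Real.sqrt Real.pi)).const_sub 1
  exact h2.congr_of_eventuallyEq (Eventually.of_forall Erfc_eq_sub)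

theorem deriv_Erfc : deriv Erfc = fun x => -(2 / Real.sqrt Real.pi * Real.exp (-x ^ 2)) :=
  funext fun x => (hasDerivAt_Erfc x).deriv

theorem differentiable_Erfc : Differentiable ℝ Erfc := fun x => (hasDerivAt_Erfc x).differentiableAt

theorem continuous_Erfc : Continuous Erfc := differentiable_Erfc.continuous

theorem contDiff_Erfc : ContDiff ℝ 2 Erfc := by
  have : (2 : WithTop ℕ∞) = 1 + 1 := by norm_num
  rw [this, contDiff_succ_iff_deriv]
  refine ⟨differentiable_Erfc, by simp, ?_⟩
  rw [deriv_Erfc]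
  fun_prop

theorem deriv_deriv_Erfc (x : ℝ) : deriv (deriv Erfc) x = -2 * x * deriv Erfc x := by
  rw [deriv_Erfc]
  have h : HasDerivAt (fun x : ℝ => -(2 / Real.sqrt Real.pi * Real.exp (-x ^ 2)))
      (-(2 / Real.sqrt Real.pi * (Real.exp (-x ^ 2) * -(2 * x)))) x := by
    have h1 : HasDerivAt (fun x : ℝ => -x ^ 2) (-(2 * x)) x := by
      simpa using (hasDerivAt_pow 2 x).fun_neg
    exact (h1.exp.const_mul _).fun_neg
  rw [h.deriv]; ring

theorem deriv_Erfc_neg (x : ℝ) : deriv Erfc x < 0 := by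
  rw [deriv_Erfc]
  have : 0 < 2 / Real.sqrt Real.pi * Real.exp (-x ^ 2) := by positivity
  linarith

theorem strictAnti_Erfc : StrictAnti Erfc := strictAnti_of_deriv_neg deriv_Erfc_neg

theorem Erfc_zero : Erfc 0 = 1 := by simp [Erfc_eq_sub]

theorem Erfc_pos (x : ℝ) : 0 < Erfc x := by
  have h : ∀ y, 0 ≤ Erfc y := fun y =>
    mul_nonneg (by positivity) (integral_nonneg fun s => (Real.exp_pos _).le)
  exact (h (x + 1)).trans_lt (strictAnti_Erfc (by linarith))

theorem Erfc_le_one {x : ℝ} (hx : 0 ≤ x) : Erfc x ≤ 1 := by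
  rw [← Erfc_zero]; exact strictAnti_Erfc.antitone hx

theorem tendsto_Erfc_atTop : Tendsto Erfc atTop (𝓝 0) := by
  have h := intervalIntegral_tendsto_integral_Ioi (μ := volume) (f := fun s => Real.exp (-s ^ 2)) 0
    integrable_exp_neg_sq.integrableOn tendsto_id
  have h0 : ∫ s in Ioi (0 : ℝ), Real.exp (-s ^ 2) = Real.sqrt Real.pi / 2 := by
    simpa using integral_gaussian_Ioi 1
  have h1 := (h.const_mul (2 / Real.sqrt Real.pi)).const_sub 1
  have hpi : Real.sqrt Real.pi ≠ 0 := by positivity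
  rw [h0, show 1 - 2 / Real.sqrt Real.pi * (Real.sqrt Real.pi / 2) = 0 by field_simp; ring] at h1
  exact h1.congr fun x => (Erfc_eq_sub x).symm

/-! ### Error function barriers -/

section SecondDerivative

variable {E : Type*} [NormedAddCommGroup E] [NormedSpace ℝ E]

theorem fderiv_fderiv_add {f g : E → ℝ} {x : E} (hf : ContDiffAt ℝ 2 f x)
    (hg : ContDiffAt ℝ 2 g x) (ξ ζ : E) :
    fderiv ℝ (fderiv ℝ fun y => f y + g y) x ξ ζ
      = fderiv ℝ (fderiv ℝ f) x ξ ζ + fderiv ℝ (fderiv ℝ g) x ξ ζ := by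
  have hev : (fderiv ℝ fun y => f y + g y) =ᶠ[𝓝 x] fun y => fderiv ℝ f y + fderiv ℝ g y := by
    filter_upwards [hf.eventually (by simp), hg.eventually (by simp)] with y h1 h2
    exact fderiv_fun_add (h1.differentiableAt (by simp)) (h2.differentiableAt (by simp))
  have hf' : DifferentiableAt ℝ (fderiv ℝ f) x :=
    (hf.fderiv_right (m := 1) (by norm_num)).differentiableAt (by simp)
  have hg' : DifferentiableAt ℝ (fderiv ℝ g) x :=
    (hg.fderiv_right (m := 1) (by norm_num)).differentiableAt (by simp)
  rw [hev.fderiv_eq, fderiv_fun_add hf' hg']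
  rfl

theorem fderiv_fderiv_comp {f : ℝ → ℝ} {h : E → ℝ} {x : E} (hf : ContDiff ℝ 2 f)
    (hh : ContDiffAt ℝ 2 h x) (ξ : E) :
    fderiv ℝ (fderiv ℝ fun y => f (h y)) x ξ ξ
      = deriv (deriv f) (h x) * (fderiv ℝ h x ξ) ^ 2
        + deriv f (h x) * fderiv ℝ (fderiv ℝ h) x ξ ξ := by
  have hev : (fderiv ℝ fun y => f (h y)) =ᶠ[𝓝 x] fun y => deriv f (h y) • fderiv ℝ h y := by
    filter_upwards [hh.eventually (by simp)] with y h1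
    have := ((hf.differentiable (by simp)) (h y)).hasDerivAt.comp_hasFDerivAt y
      (h1.differentiableAt (by simp)).hasFDerivAt
    exact this.fderiv
  have hh' : HasFDerivAt (fderiv ℝ h) (fderiv ℝ (fderiv ℝ h) x) x :=
    ((hh.fderiv_right (m := 1) (by norm_num)).differentiableAt (by simp)).hasFDerivAt
  have hf' : Differentiable ℝ (deriv f) := by
    have : (2 : WithTop ℕ∞) = 1 + 1 := by norm_num
    rw [this, contDiff_succ_iff_deriv] at hf
    exact hf.2.2.differentiable (by simp)
  have h2 := (hf' (h x)).hasDerivAt.comp_hasFDerivAt x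
      (hh.differentiableAt (by simp)).hasFDerivAt
  have h3 : HasFDerivAt (fun y => deriv f (h y) • fderiv ℝ h y) _ x := h2.fun_smul hh'
  rw [hev.fderiv_eq, h3.fderiv]
  simp [ContinuousLinearMap.smulRight_apply]
  ring

end SecondDerivative

section NormSq

variable {E : Type*} [NormedAddCommGroup E] [InnerProductSpace ℝ E]

theorem hasFDerivAt_norm_sub_sq (z y : E) :
    HasFDerivAt (fun y => ‖y - z‖ ^ 2) ((2 : ℝ) • innerSL ℝ (y - z)) y := by
  have := (hasStrictFDerivAt_norm_sq (y - z)).hasFDerivAt.comp y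
    ((hasFDerivAt_id y).sub_const z)
  refine this.congr_fderiv ?_
  ext ξ; simp

theorem fderiv_fderiv_norm_sub_sq (z y ξ : E) :
    fderiv ℝ (fderiv ℝ fun y => ‖y - z‖ ^ 2) y ξ ξ = 2 * ‖ξ‖ ^ 2 := by
  have h1 : (fderiv ℝ fun y : E => ‖y - z‖ ^ 2) = fun y => (2 : ℝ) • innerSL ℝ (y - z) :=
    funext fun y => (hasFDerivAt_norm_sub_sq z y).fderiv
  have h2 : HasFDerivAt (fun y : E => (2 : ℝ) • innerSL ℝ (y - z))
      ((2 : ℝ) • (innerSL ℝ : E →L[ℝ] _)) y :=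
    (((innerSL ℝ : E →L[ℝ] E →L[ℝ] ℝ).hasFDerivAt).comp y
      ((hasFDerivAt_id y).sub_const z)).const_smul (2 : ℝ)
  rw [h1, h2.fderiv, ← real_inner_self_eq_norm_sq]
  rfl

end NormSq

/-- The barrier built from a defining function `g`: up to curvature terms, controlled by the
drift `K`, it solves the one dimensional heat equation with diffusivity `1 / (4 a²)`, started at
time `t₀`, in the variable `g`. The quadratic term with coefficient `c` localizes to a ball around
`z`. -/
noncomputable def erfcBarrier {N : ℕ} (g : RN N → ℝ) (z : RN N) (B A a K c K' t₀ : ℝ)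
    (p : RN N × ℝ) : ℝ :=
  B + A * Erfc (a * ((g p.1 + K * (p.2 - t₀)) / Real.sqrt (p.2 - t₀)))
    + c * (‖p.1 - z‖ ^ 2 + K' * (p.2 - t₀))

theorem contDiffAt_erfcBarrier {N : ℕ} {g : RN N → ℝ} {z : RN N} {B A a K c K' t₀ : ℝ}
    {p : RN N × ℝ} (hg : ContDiffAt ℝ 2 g p.1) (ht : t₀ < p.2) :
    ContDiffAt ℝ 2 (erfcBarrier g z B A a K c K' t₀) p := by
  have hτ : 0 < p.2 - t₀ := by linarith
  have h1 : ContDiffAt ℝ 2 (fun q : RN N × ℝ => g q.1) p := hg.comp p contDiffAt_fst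
  have h2 : ContDiffAt ℝ 2 (fun q : RN N × ℝ => q.2 - t₀) p := contDiffAt_snd.sub contDiffAt_const
  have h3 : ContDiffAt ℝ 2 (fun q : RN N × ℝ => Real.sqrt (q.2 - t₀)) p := h2.sqrt hτ.ne'
  have h4 := ((h1.add (contDiffAt_const (c := K) |>.mul h2)).div h3 (Real.sqrt_pos.2 hτ).ne')
  have h5 := contDiff_Erfc.contDiffAt.comp p (contDiffAt_const (c := a) |>.mul h4)
  have h6 : ContDiffAt ℝ 2 (fun q : RN N × ℝ => ‖q.1 - z‖ ^ 2) p :=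
    (contDiffAt_fst.sub contDiffAt_const).norm_sq ℝ
  exact ((contDiffAt_const (c := B)).add ((contDiffAt_const (c := A)).mul h5)).add
    ((contDiffAt_const (c := c)).mul (h6.add ((contDiffAt_const (c := K')).mul h2)))

theorem deriv_erfcBarrier {N : ℕ} {g : RN N → ℝ} {z : RN N} {B A a K c K' t₀ : ℝ}
    {p : RN N × ℝ} {τ σ : ℝ} (hτ : τ = p.2 - t₀) (hpos : 0 < τ)
    (hσ : σ = (g p.1 + K * τ) / Real.sqrt τ) :
    deriv (fun s => erfcBarrier g z B A a K c K' t₀ (p.1, s)) p.2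
      = A * deriv Erfc (a * σ) * a * (K / Real.sqrt τ - σ / (2 * τ)) + c * K' := by
  subst hτ
  have hsq := Real.sqrt_pos.2 hpos
  have h0 : HasDerivAt (fun s => s - t₀) 1 p.2 := (hasDerivAt_id _).sub_const _
  have h1 := h0.sqrt hpos.ne'
  have h2 : HasDerivAt (fun s => (g p.1 + K * (s - t₀)) / Real.sqrt (s - t₀))
      (K / Real.sqrt (p.2 - t₀) - σ / (2 * (p.2 - t₀))) p.2 := by
    have := ((h0.const_mul K).const_add (g p.1)).div h1 hsq.ne'
    refine (this.congr_deriv ?_)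
    rw [hσ]
    have h3 := Real.sq_sqrt hpos.le
    set r := Real.sqrt (p.2 - t₀)
    rw [← h3]
    field_simp
  have h3 := (hasDerivAt_Erfc (a * σ))
  rw [← (hasDerivAt_Erfc (a * σ)).deriv, hσ] at h3
  have h4 := HasDerivAt.comp p.2 h3 (h2.const_mul a)
  have h5 := ((h4.const_mul A).const_add B).add
    (((h0.const_mul K').const_add (‖p.1 - z‖ ^ 2)).const_mul c)
  have h6 : HasDerivAt (fun s => erfcBarrier g z B A a K c K' t₀ (p.1, s)) _ p.2 := h5
  rw [h6.deriv, ← hσ]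
  ring

theorem spatialD2_erfcBarrier {N : ℕ} {g : RN N → ℝ} {z : RN N} {B A a K c K' t₀ : ℝ}
    {p : RN N × ℝ} (hg : ContDiffAt ℝ 2 g p.1) {τ σ : ℝ} (hτ : τ = p.2 - t₀) (hpos : 0 < τ)
    (hσ : σ = (g p.1 + K * τ) / Real.sqrt τ) (ξ : RN N) :
    spatialD2 (erfcBarrier g z B A a K c K' t₀) p ξ
      = A * (-2 * (a * σ) * deriv Erfc (a * σ)) * a ^ 2 / τ * (fderiv ℝ g p.1 ξ) ^ 2
        + A * deriv Erfc (a * σ) * a / Real.sqrt τ * fderiv ℝ (fderiv ℝ g) p.1 ξ ξ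
        + 2 * c * ‖ξ‖ ^ 2 := by
  have hsq := Real.sqrt_pos.2 hpos
  set r := Real.sqrt τ with hr
  set f : ℝ → ℝ := fun s => B + A * Erfc (a * ((s + K * τ) / r)) with hf
  set k : ℝ → ℝ := fun s => c * (s + K' * τ) with hk
  have hfs : ContDiff ℝ 2 f := by
    have := contDiff_Erfc
    simp only [hf]
    fun_prop
  have hks : ContDiff ℝ 2 k := by simp only [hk]; fun_prop
  have hin : ∀ s, HasDerivAt (fun s => a * ((s + K * τ) / r)) (a * (1 / r)) s := fun s =>
    (((hasDerivAt_id s).add_const _).div_const r).const_mul a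
  have hf1 : deriv f = fun s => A * (deriv Erfc (a * ((s + K * τ) / r)) * (a * (1 / r))) := by
    ext s
    exact (((HasDerivAt.comp s (differentiable_Erfc _).hasDerivAt (hin s)).const_mul A).const_add
      B).deriv
  have hdE : Differentiable ℝ (deriv Erfc) := by
    rw [deriv_Erfc]; fun_prop
  have hf2 : ∀ s, deriv (deriv f) s
      = A * (deriv (deriv Erfc) (a * ((s + K * τ) / r)) * (a * (1 / r))
      * (a * (1 / r))) := by
    intro s
    rw [hf1]
    exact (((HasDerivAt.comp s (hdE _).hasDerivAt (hin s)).mul_const _).const_mul A).deriv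
  have hk1 : deriv k = fun _ => c := by
    ext s
    have : HasDerivAt k (c * 1) s := ((hasDerivAt_id s).add_const (K' * τ)).const_mul c
    rw [this.deriv, mul_one]
  have hn : ContDiffAt ℝ 2 (fun y : RN N => ‖y - z‖ ^ 2) p.1 :=
    (contDiffAt_id.sub contDiffAt_const).norm_sq ℝ
  have heq : (fun y => erfcBarrier g z B A a K c K' t₀ (y, p.2))
      = fun y => f (g y) + k (‖y - z‖ ^ 2) := by
    ext y
    simp only [erfcBarrier, hf, hk, hr, hτ]
  have hfg : ContDiffAt ℝ 2 (fun y => f (g y)) p.1 := hfs.contDiffAt.comp p.1 hg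
  have hkn : ContDiffAt ℝ 2 (fun y => k (‖y - z‖ ^ 2)) p.1 := hks.contDiffAt.comp p.1 hn
  rw [spatialD2, heq, fderiv_fderiv_add hfg hkn,
    fderiv_fderiv_comp hfs hg, fderiv_fderiv_comp hks hn, fderiv_fderiv_norm_sub_sq, hf2, hf1, hk1,
    deriv_deriv_Erfc]
  beta_reduce
  rw [← hσ]
  have h3 : r ^ 2 = τ := Real.sq_sqrt hpos.le
  rw [← h3]
  simp
  field_simp

/-! ### Defining functions of `C²` domains -/

/-- On the ball `B_δ(z)` the function `g` is a `C²` defining function of `Ω` (positive inside,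
zero on the boundary) whose gradient has norm close to one, as measured by `ε`, and whose second
derivative is bounded by `C`. -/
structure IsC2DefiningOn {N : ℕ} (Ω : Set (RN N)) (z : RN N) (g : RN N → ℝ) (δ C ε : ℝ) : Prop where
  contDiffAt : ∀ y ∈ Metric.ball z δ, ContDiffAt ℝ 2 g y
  mem_iff : ∀ y ∈ Metric.ball z δ, (y ∈ Ω ↔ 0 < g y)
  frontier_iff : ∀ y ∈ Metric.ball z δ, (y ∈ frontier Ω ↔ g y = 0)
  one_le : ∀ y ∈ Metric.ball z δ, 1 ≤ (1 + ε) * ‖fderiv ℝ g y‖ ^ 2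
  le_one : ∀ y ∈ Metric.ball z δ, ‖fderiv ℝ g y‖ ^ 2 ≤ 1 + ε
  abs_fderiv2_le : ∀ y ∈ Metric.ball z δ, ∀ ξ, |fderiv ℝ (fderiv ℝ g) y ξ ξ| ≤ C * ‖ξ‖ ^ 2

theorem continuousAt_norm_fderiv_fderiv {E : Type*} [NormedAddCommGroup E] [NormedSpace ℝ E]
    {g : E → ℝ} {z : E} (hg : ContDiffAt ℝ 2 g z) :
    ContinuousAt (fun y => ‖fderiv ℝ (fderiv ℝ g) y‖) z := by
  have h1 : ContDiffAt ℝ 1 (fderiv ℝ g) z := hg.fderiv_right (by norm_num)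
  have h2 : ContDiffAt ℝ 0 (fderiv ℝ (fderiv ℝ g)) z := h1.fderiv_right (by norm_num)
  have h3 : ContinuousAt (fderiv ℝ (fderiv ℝ g)) z := h2.continuousAt
  exact (continuous_norm (E := E →L[ℝ] E →L[ℝ] ℝ)).continuousAt.comp h3

theorem exists_isC2DefiningOn {N : ℕ} {Ω : Set (RN N)} {z : RN N} {g : RN N → ℝ}
    (hg : ContDiffAt ℝ 2 g z) (hg1 : ‖fderiv ℝ g z‖ = 1)
    (hmem : ∀ᶠ y in 𝓝 z, y ∈ Ω ↔ 0 < g y) (hfr : ∀ᶠ y in 𝓝 z, y ∈ frontier Ω ↔ g y = 0)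
    {ε : ℝ} (hε : 0 < ε) :
    ∃ δ > 0, ∃ C ≥ 0, IsC2DefiningOn Ω z g δ C ε := by
  have h1 : ContDiffAt ℝ 1 (fderiv ℝ g) z := hg.fderiv_right (by norm_num)
  have hc : ContinuousAt (fun y => ‖fderiv ℝ (fderiv ℝ g) y‖) z :=
    continuousAt_norm_fderiv_fderiv hg
  have hn : ContinuousAt (fun y => ‖fderiv ℝ g y‖ ^ 2) z := h1.continuousAt.norm.pow 2
  have hn1 : ∀ᶠ y in 𝓝 z, ‖fderiv ℝ g y‖ ^ 2 < 1 + ε :=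
    hn.eventually_lt continuousAt_const (by simp [hg1, hε])
  have hn2 : ∀ᶠ y in 𝓝 z, 1 < (1 + ε) * ‖fderiv ℝ g y‖ ^ 2 :=
    continuousAt_const.eventually_lt (hn.const_mul _) (by simp [hg1, hε])
  have hn3 : ∀ᶠ y in 𝓝 z, ‖fderiv ℝ (fderiv ℝ g) y‖ < ‖fderiv ℝ (fderiv ℝ g) z‖ + 1 :=
    hc.eventually_lt_const (lt_add_one _)
  obtain ⟨δ, hδ, h⟩ := Metric.eventually_nhds_iff_ball.1
    ((hg.eventually (by simp)).and (hmem.and (hfr.and (hn1.and (hn2.and hn3)))))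
  refine ⟨δ, hδ, ‖fderiv ℝ (fderiv ℝ g) z‖ + 1, by positivity, fun y hy => (h y hy).1,
    fun y hy => (h y hy).2.1, fun y hy => (h y hy).2.2.1, fun y hy => (h y hy).2.2.2.2.1.le,
    fun y hy => (h y hy).2.2.2.1.le, fun y hy ξ => ?_⟩
  have h3 := (fderiv ℝ (fderiv ℝ g) y).le_opNorm₂ ξ ξ
  rw [Real.norm_eq_abs] at h3
  refine h3.trans ?_
  rw [mul_assoc, ← sq]
  exact mul_le_mul_of_nonneg_right (h y hy).2.2.2.2.2.le (by positivity)

/-- The defining function attached to a local graph representation. -/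
noncomputable def graphDefining {N : ℕ} (z ν : RN N) (φ : (Submodule.span ℝ {ν})ᗮ → ℝ) (y : RN N) :
    ℝ :=
  inner ℝ ν (y - z) - φ ((Submodule.span ℝ {ν})ᗮ.orthogonalProjectionOnto (y - z))

section Graph

variable {N : ℕ} {Ω : Set (RN N)} {z ν : RN N} {φ : (Submodule.span ℝ {ν})ᗮ → ℝ}

theorem IsC2GraphAt.mem_iff_graphDefining (h : IsC2GraphAt Ω z ν φ) :
    ∀ᶠ y in 𝓝 z, y ∈ Ω ↔ 0 < graphDefining z ν φ y := by
  filter_upwards [h.mem_iff] with y hy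
  rw [hy, graphDefining, sub_pos]

theorem IsC2GraphAt.mem_frontier_iff_graphDefining (h : IsC2GraphAt Ω z ν φ) :
    ∀ᶠ y in 𝓝 z, y ∈ frontier Ω ↔ graphDefining z ν φ y = 0 := by
  filter_upwards [h.mem_frontier_iff] with y hy
  rw [hy, graphDefining, sub_eq_zero, eq_comm]

theorem IsC2GraphAt.contDiffAt_graphDefining (h : IsC2GraphAt Ω z ν φ) :
    ContDiffAt ℝ 2 (graphDefining z ν φ) z := by
  have h1 : ContDiffAt ℝ 2 (fun y : RN N => y - z) z := contDiffAt_id.sub contDiffAt_const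
  have h2 : ContDiffAt ℝ 2
      (fun y => (Submodule.span ℝ {ν})ᗮ.orthogonalProjectionOnto (y - z)) z :=
    (Submodule.span ℝ {ν})ᗮ.orthogonalProjectionOnto.contDiff.contDiffAt.comp z h1
  have h3 : ContDiffAt ℝ 2 φ ((Submodule.span ℝ {ν})ᗮ.orthogonalProjectionOnto (z - z)) := by
    simpa using h.contDiffAt
  exact (contDiffAt_const.inner ℝ h1).sub
    (ContDiffAt.comp (f := fun y => (Submodule.span ℝ {ν})ᗮ.orthogonalProjectionOnto (y - z)) z
      h3 h2)

theorem IsC2GraphAt.fderiv_graphDefining (h : IsC2GraphAt Ω z ν φ) (ξ : RN N) :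
    fderiv ℝ (graphDefining z ν φ) z ξ
      = inner ℝ ν ξ - fderiv ℝ φ 0 ((Submodule.span ℝ {ν})ᗮ.orthogonalProjectionOnto ξ) := by
  have h1 : HasFDerivAt (fun y : RN N => y - z) (ContinuousLinearMap.id ℝ (RN N)) z :=
    (hasFDerivAt_id z).sub_const z
  have h2 := (Submodule.span ℝ {ν})ᗮ.orthogonalProjectionOnto.hasFDerivAt.comp z h1
  have h3 : HasFDerivAt φ (fderiv ℝ φ 0)
      ((Submodule.span ℝ {ν})ᗮ.orthogonalProjectionOnto (z - z)) := by
    simpa using (h.contDiffAt.differentiableAt (by simp)).hasFDerivAt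
  have h4 := h3.comp z h2
  have h5 := (innerSL ℝ ν).hasFDerivAt.comp z h1
  have h6 : HasFDerivAt (graphDefining z ν φ) _ z := h5.sub h4
  rw [h6.fderiv]
  simp

theorem IsC2GraphAt.fderiv_graphDefining_self (h : IsC2GraphAt Ω z ν φ) :
    fderiv ℝ (graphDefining z ν φ) z ν = 1 := by
  have h1 : (Submodule.span ℝ {ν})ᗮ.orthogonalProjectionOnto ν = 0 :=
    Submodule.orthogonalProjectionOnto_orthogonalComplement_singleton_eq_zero ν
  rw [h.fderiv_graphDefining, h1, ContinuousLinearMap.map_zero, sub_zero,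
    real_inner_self_eq_norm_sq, h.norm_eq]
  norm_num

theorem IsC2GraphAt.norm_fderiv_graphDefining (h : IsC2GraphAt Ω z ν φ) (hφ : fderiv ℝ φ 0 = 0) :
    ‖fderiv ℝ (graphDefining z ν φ) z‖ = 1 := by
  have : fderiv ℝ (graphDefining z ν φ) z = innerSL ℝ ν := by
    ext ξ; simp [h.fderiv_graphDefining, hφ]
  rw [this, innerSL_apply_norm, h.norm_eq]

end Graph

/-- Every boundary point of a `C²` domain has a defining function. -/
theorem IsC2Domain.exists_isC2DefiningOn {N : ℕ} {Ω : Set (RN N)} (hΩ : IsC2Domain Ω) {z : RN N}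
    (hz : z ∈ frontier Ω) {ε : ℝ} (hε : 0 < ε) :
    ∃ g, ∃ δ > 0, ∃ C ≥ 0, IsC2DefiningOn Ω z g δ C ε := by
  obtain ⟨ν, φ, h⟩ := hΩ.2 z hz
  set L := ‖fderiv ℝ (graphDefining z ν φ) z‖ with hL
  have hLpos : 0 < L := by
    rw [hL, norm_pos_iff]
    intro h0
    have := h.fderiv_graphDefining_self
    rw [h0] at this
    simp at this
  refine ⟨fun y => L⁻¹ * graphDefining z ν φ y, _root_.exists_isC2DefiningOn
    (contDiffAt_const.mul h.contDiffAt_graphDefining) ?_ ?_ ?_ hε⟩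
  · rw [fderiv_const_mul (h.contDiffAt_graphDefining.differentiableAt (by simp)), norm_smul, ← hL,
      Real.norm_of_nonneg (by positivity)]
    field_simp
  · filter_upwards [h.mem_iff_graphDefining] with y hy
    rw [hy, mul_pos_iff_of_pos_left (by positivity)]
  · filter_upwards [h.mem_frontier_iff_graphDefining] with y hy
    rw [hy, mul_eq_zero, or_iff_right (by positivity)]

/-- The ball of radius `g y / 2` around `y` stays in `Ω`, as `g` is `2`-Lipschitz. -/
theorem IsC2DefiningOn.ball_subset {N : ℕ} {Ω : Set (RN N)} {z : RN N} {g : RN N → ℝ} {δ C ε : ℝ}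
    (hg : IsC2DefiningOn Ω z g δ C ε) (hε : ε ≤ 1) (hgz : g z = 0) {y : RN N}
    (hy : y ∈ Metric.ball z (δ / 2)) : Metric.ball y (g y / 2) ⊆ Ω := by
  have hδ : 0 < δ := by
    have := dist_nonneg.trans_lt (Metric.mem_ball.1 hy); linarith
  have hlip : ∀ a ∈ Metric.ball z δ, ∀ b ∈ Metric.ball z δ, |g b - g a| ≤ 2 * ‖b - a‖ := by
    intro a ha b hb
    refine Convex.norm_image_sub_le_of_norm_fderiv_le (𝕜 := ℝ) (f := g)
      (fun w hw => (hg.contDiffAt w hw).differentiableAt (by simp)) (fun w hw => ?_)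
      (convex_ball z δ) ha hb
    have := hg.le_one w hw
    nlinarith [norm_nonneg (fderiv ℝ g w)]
  have hyδ : y ∈ Metric.ball z δ := Metric.ball_subset_ball (by linarith) hy
  have h1 := hlip z (Metric.mem_ball_self hδ) y hyδ
  rw [hgz, sub_zero, ← dist_eq_norm] at h1
  have h2 := Metric.mem_ball.1 hy
  intro b hb
  have h3 := Metric.mem_ball.1 hb
  have hbδ : b ∈ Metric.ball z δ := by
    rw [Metric.mem_ball]
    have := dist_triangle b y z
    linarith [le_abs_self (g y)]
  have h4 := hlip y hyδ b hbδ
  rw [← dist_eq_norm] at h4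
  rw [hg.mem_iff b hbδ]
  linarith [(abs_le.1 h4).1]

/-! ### Strictness of the error function barriers -/

theorem inner_toDual_symm_fderiv {N : ℕ} (g : RN N → ℝ) (y ξ : RN N) :
    inner ℝ ((InnerProductSpace.toDual ℝ (RN N)).symm (fderiv ℝ g y)) ξ = fderiv ℝ g y ξ :=
  InnerProductSpace.toDual_symm_apply

section StrictBarrier

variable {N : ℕ} {l m : ℝ} {Ω : Set (RN N)} {z : RN N} {g : RN N → ℝ} {δ C ε : ℝ}

/-- The Hessian of an `erfcBarrier` is rank one up to curvature terms. -/
theorem IsC2DefiningOn.abs_spatialD2_erfcBarrier_sub_le (hg : IsC2DefiningOn Ω z g δ C ε)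
    {B A a K c K' t₀ : ℝ} (ha : 0 < a) (hc : 0 < c)
    {p : RN N × ℝ} (hp : p.1 ∈ Metric.ball z δ) {τ σ : ℝ} (hτ : τ = p.2 - t₀) (hpos : 0 < τ)
    (hσ : σ = (g p.1 + K * τ) / Real.sqrt τ) (ξ : RN N) :
    |spatialD2 (erfcBarrier g z B A a K c K' t₀) p ξ
      - A * (-2 * (a * σ) * deriv Erfc (a * σ)) * a ^ 2 / τ *
        (inner ℝ ((InnerProductSpace.toDual ℝ (RN N)).symm (fderiv ℝ g p.1)) ξ) ^ 2|
      ≤ (|A| * |deriv Erfc (a * σ)| * a / Real.sqrt τ * C + 2 * c) * ‖ξ‖ ^ 2 := by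
  have hsq := Real.sqrt_pos.2 hpos
  rw [spatialD2_erfcBarrier (hg.contDiffAt _ hp) hτ hpos hσ, inner_toDual_symm_fderiv]
  have h1 := hg.abs_fderiv2_le _ hp ξ
  set D := deriv Erfc (a * σ)
  set X := fderiv ℝ (fderiv ℝ g) p.1 ξ ξ
  rw [show ∀ u w : ℝ, u + A * D * a / Real.sqrt τ * X + w - u = A * D * a / Real.sqrt τ * X + w by
    intros; ring]
  refine (abs_add_le _ _).trans ?_
  rw [abs_mul, abs_div, abs_mul, abs_mul, abs_of_pos ha, abs_of_pos hsq,
    abs_of_nonneg (by positivity : 0 ≤ 2 * c * ‖ξ‖ ^ 2), add_mul, mul_assoc _ C]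
  gcongr

/-- The barrier for subsolutions with small boundary values. It is concave in `g`, so that the
constant `m` on negative eigenvalues governs it. -/
theorem IsC2DefiningOn.isStrictBarrierAt_lower (hl : 0 < l) (hg : IsC2DefiningOn Ω z g δ C ε)
    (hm : 0 < m) (hC : 0 ≤ C) {B S a c t₀ : ℝ} (ha : 0 < a) (hc : 0 < c) (hS : 0 < S)
    (ham : 1 + ε ≤ 4 * a ^ 2 * m) {p : RN N × ℝ} (hp : p.1 ∈ Metric.ball z δ) (hpΩ : p.1 ∈ Ω)
    (ht : t₀ < p.2) :
    IsStrictBarrierAt l m (erfcBarrier g z B (-S) a (N * max l m * C) c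
      (2 * (N * max l m) + 1) t₀) p := by
  have hpos : 0 < p.2 - t₀ := by linarith
  set τ := p.2 - t₀ with hτ
  set K := N * max l m * C with hK
  set σ := (g p.1 + K * τ) / Real.sqrt τ with hσ
  have hsq := Real.sqrt_pos.2 hpos
  have hΛ : 0 < max l m := lt_max_of_lt_left hl
  have hK0 : 0 ≤ K := by positivity
  have hgp : 0 < g p.1 := (hg.mem_iff _ hp).1 hpΩ
  have hσpos : 0 < σ := by positivity
  refine ⟨contDiffAt_erfcBarrier (hg.contDiffAt _ hp) ht, _, _, _,
    hg.abs_spatialD2_erfcBarrier_sub_le ha hc hp hτ hpos hσ, ?_⟩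
  rw [deriv_erfcBarrier hτ hpos hσ]
  have hD := deriv_Erfc_neg (a * σ)
  obtain ⟨d, hd⟩ : ∃ d, d = -deriv Erfc (a * σ) := ⟨_, rfl⟩
  have hd0 : 0 < d := by linarith
  rw [show deriv Erfc (a * σ) = -d by linarith, abs_neg, abs_neg, abs_of_pos hS, abs_of_pos hd0,
    pucciScalar_of_nonpos, LinearIsometryEquiv.norm_map]
  · have h1 := hg.one_le _ hp
    set G := ‖fderiv ℝ g p.1‖ ^ 2
    have hG : 0 ≤ G := by positivity
    have h2 : 1 ≤ 4 * a ^ 2 * m * G := h1.trans (mul_le_mul_of_nonneg_right ham hG)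
    have h3 : S * d * a * σ / (2 * τ) * 1 ≤ S * d * a * σ / (2 * τ) * (4 * a ^ 2 * m * G) :=
      mul_le_mul_of_nonneg_left h2 (by positivity)
    have e1 : m * (-S * (-2 * (a * σ) * -d) * a ^ 2 / τ) * G
        = - (S * d * a * σ / (2 * τ) * (4 * a ^ 2 * m * G)) := by field_simp; ring
    have e2 : N * max l m * (S * d * a / Real.sqrt τ * C + 2 * c)
        = S * d * a * (K / Real.sqrt τ) + 2 * (N * max l m) * c := by rw [hK]; ring
    have e3 : -S * -d * a * (K / Real.sqrt τ - σ / (2 * τ))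
        = S * d * a * (K / Real.sqrt τ) - S * d * a * σ / (2 * τ) := by ring
    rw [e1, e2, e3]
    linarith
  · have : 0 ≤ S * (2 * (a * σ) * d) * a ^ 2 / τ := by positivity
    calc _ = -(S * (2 * (a * σ) * d) * a ^ 2 / τ) := by ring
      _ ≤ 0 := by linarith

/-- The barrier for subsolutions with small initial values. Where `σ ≥ 0` it is convex in `g`, so
that the constant `l` on positive eigenvalues governs it. The drift makes `σ` negative close to the
boundary, where the operator has the favourable sign; its factor `2`, twice what the curvature terms
need, absorbs the negative contribution of `σ` to the time derivative. -/
theorem IsC2DefiningOn.isStrictBarrierAt_upper (hl : 0 < l) (hg : IsC2DefiningOn Ω z g δ C ε)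
    (hm : 0 < m) (hC : 0 ≤ C) {a c t₀ : ℝ} (ha : 0 < a) (hc : 0 < c)
    (hal : 4 * a ^ 2 * l * (1 + ε) ≤ 1) {p : RN N × ℝ} (hp : p.1 ∈ Metric.ball z δ) (hpΩ : p.1 ∈ Ω)
    (ht : t₀ < p.2) :
    IsStrictBarrierAt l m (erfcBarrier g z 0 1 a (-(2 * (N * max l m * C))) c
      (2 * (N * max l m) + 1) t₀) p := by
  have hpos : 0 < p.2 - t₀ := by linarith
  set τ := p.2 - t₀ with hτ
  set K := 2 * (N * max l m * C) with hK
  set σ := (g p.1 + -K * τ) / Real.sqrt τ with hσ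
  have hsq := Real.sqrt_pos.2 hpos
  have hΛ : 0 < max l m := lt_max_of_lt_left hl
  have hK0 : 0 ≤ K := by positivity
  have hgp : 0 < g p.1 := (hg.mem_iff _ hp).1 hpΩ
  refine ⟨contDiffAt_erfcBarrier (hg.contDiffAt _ hp) ht, _, _, _,
    hg.abs_spatialD2_erfcBarrier_sub_le ha hc hp hτ hpos hσ, ?_⟩
  rw [deriv_erfcBarrier hτ hpos hσ]
  have hD := deriv_Erfc_neg (a * σ)
  obtain ⟨d, hd⟩ : ∃ d, d = -deriv Erfc (a * σ) := ⟨_, rfl⟩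
  have hd0 : 0 < d := by linarith
  rw [show deriv Erfc (a * σ) = -d by linarith, abs_neg, abs_one, abs_of_pos hd0,
    LinearIsometryEquiv.norm_map]
  have h1 := hg.le_one _ hp
  set G := ‖fderiv ℝ g p.1‖ ^ 2
  have hG : 0 ≤ G := by positivity
  have e2 : N * max l m * (1 * d * a / Real.sqrt τ * C + 2 * c)
      = d * a * (K / 2 / Real.sqrt τ) + 2 * (N * max l m) * c := by rw [hK]; ring
  have e3 : 1 * -d * a * (-K / Real.sqrt τ - σ / (2 * τ))
      = d * a * (K / 2 / Real.sqrt τ) + d * a * (K / 2 / Real.sqrt τ) + d * a * σ / (2 * τ) := by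
    ring
  rw [e2, e3]
  have e0 : 1 * (-2 * (a * σ) * -d) * a ^ 2 / τ = 2 * (a ^ 3 * d / τ) * σ := by ring
  rw [e0]
  have hKs : 0 ≤ d * a * (K / 2 / Real.sqrt τ) := by positivity
  rcases le_total 0 σ with hs | hs
  · rw [pucciScalar_of_nonneg (by positivity)]
    have h2 : 4 * a ^ 2 * l * G ≤ 1 :=
      (mul_le_mul_of_nonneg_left h1 (by positivity)).trans hal
    have h3 : d * a * σ / (2 * τ) * (4 * a ^ 2 * l * G) ≤ d * a * σ / (2 * τ) * 1 :=
      mul_le_mul_of_nonneg_left h2 (by positivity)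
    have e1 : l * (2 * (a ^ 3 * d / τ) * σ) * G = d * a * σ / (2 * τ) * (4 * a ^ 2 * l * G) := by
      field_simp; ring
    rw [e1]; linarith
  · rw [pucciScalar_of_nonpos (mul_nonpos_of_nonneg_of_nonpos (by positivity) hs)]
    have h4 : m * (2 * (a ^ 3 * d / τ) * σ) * G ≤ 0 := by
      have : 0 ≤ m * (2 * (a ^ 3 * d / τ)) * G := by positivity
      nlinarith
    have h5 : -(K / 2 / Real.sqrt τ) ≤ σ / (2 * τ) := by
      have h6 : τ = Real.sqrt τ ^ 2 := (Real.sq_sqrt hpos.le).symm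
      have h7 : σ / (2 * τ) = g p.1 / (Real.sqrt τ * (2 * τ)) - K / 2 / Real.sqrt τ := by
        rw [hσ]
        field_simp
        ring
      have : 0 ≤ g p.1 / (Real.sqrt τ * (2 * τ)) := by positivity
      linarith
    have h6 : d * a * -(K / 2 / Real.sqrt τ) ≤ d * a * (σ / (2 * τ)) :=
      mul_le_mul_of_nonneg_left h5 (by positivity)
    have e4 : d * a * σ / (2 * τ) = d * a * (σ / (2 * τ)) := by ring
    rw [e4]
    linarith

end StrictBarrier

/-! ### Interior decay and boundary estimates -/

section Bounds

variable {N : ℕ} {l m : ℝ} {Ω : Set (RN N)} {u : RN N × ℝ → ℝ}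

/-- The radial exponential barrier `B + S exp(k(|y - y₀|² - r²) + K t)`. -/
noncomputable def expBarrier (y₀ : RN N) (B S k r K : ℝ) (p : RN N × ℝ) : ℝ :=
  B + S * Real.exp ((‖p.1 - y₀‖ ^ 2 - r ^ 2) * k + K * p.2)

/-- The rate `K` in time dominates the largest possible value of the operator on the ball. -/
theorem isStrictBarrierAt_expBarrier (hl : 0 < l) {y₀ : RN N} {B S k r : ℝ}
    (hS : 0 < S) (hk : 0 < k) {p : RN N × ℝ} (hp : p.1 ∈ Metric.ball y₀ r) :
    IsStrictBarrierAt l m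
      (expBarrier y₀ B S k r (4 * max l m * k ^ 2 * r ^ 2 + 2 * N * max l m * k)) p := by
  set K := 4 * max l m * k ^ 2 * r ^ 2 + 2 * N * max l m * k with hK
  have hn : ∀ y : RN N, ContDiffAt ℝ 2 (fun y : RN N => ‖y - y₀‖ ^ 2) y := fun y =>
    (contDiffAt_id.sub contDiffAt_const).norm_sq ℝ
  set e := Real.exp ((‖p.1 - y₀‖ ^ 2 - r ^ 2) * k + K * p.2) with he
  have he0 : 0 < e := Real.exp_pos _
  refine ⟨?_, 4 * S * k ^ 2 * e, 2 * S * k * e, p.1 - y₀, fun ξ => ?_, ?_⟩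
  · have h1 : ContDiffAt ℝ 2 (fun q : RN N × ℝ => ‖q.1 - y₀‖ ^ 2) p :=
      (contDiffAt_fst.sub contDiffAt_const).norm_sq ℝ
    exact contDiffAt_const.add (contDiffAt_const.mul
      (((h1.sub contDiffAt_const).mul contDiffAt_const).add
        (contDiffAt_const.mul contDiffAt_snd)).exp)
  · set f : ℝ → ℝ := fun s => B + S * Real.exp ((s - r ^ 2) * k + K * p.2) with hf
    have hin : ∀ s, HasDerivAt (fun s => (s - r ^ 2) * k + K * p.2) k s := fun s => by
      simpa using (((hasDerivAt_id s).sub_const (r ^ 2)).mul_const k).add_const (K * p.2)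
    have hf1 : deriv f = fun s => S * (Real.exp ((s - r ^ 2) * k + K * p.2) * k) := by
      ext s
      exact (((hin s).exp.const_mul S).const_add B).deriv
    have hf2 : ∀ s, deriv (deriv f) s = S * (Real.exp ((s - r ^ 2) * k + K * p.2) * k * k) := by
      intro s
      rw [hf1]
      exact (((hin s).exp.mul_const k).const_mul S).deriv
    have hfs : ContDiff ℝ 2 f := by simp only [hf]; fun_prop
    have heq : (fun y => expBarrier y₀ B S k r K (y, p.2)) = fun y => f (‖y - y₀‖ ^ 2) := rfl
    rw [spatialD2, heq, fderiv_fderiv_comp hfs (hn _), hf2, hf1,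
      (hasFDerivAt_norm_sub_sq y₀ p.1).fderiv, fderiv_fderiv_norm_sub_sq]
    simp only [smul_apply, innerSL_apply_apply, smul_eq_mul]
    rw [← he]
    have : S * (e * k * k) * (2 * inner ℝ (p.1 - y₀) ξ) ^ 2 + S * (e * k) * (2 * ‖ξ‖ ^ 2)
        - 4 * S * k ^ 2 * e * inner ℝ (p.1 - y₀) ξ ^ 2 = 2 * S * k * e * ‖ξ‖ ^ 2 := by ring
    rw [this, abs_of_nonneg (by positivity)]
  · have hd : HasDerivAt (fun s => expBarrier y₀ B S k r K (p.1, s)) (S * (e * K)) p.2 := by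
      have h1 : HasDerivAt (fun s => (‖p.1 - y₀‖ ^ 2 - r ^ 2) * k + K * s) K p.2 := by
        simpa using ((hasDerivAt_id p.2).const_mul K).const_add ((‖p.1 - y₀‖ ^ 2 - r ^ 2) * k)
      exact (h1.exp.const_mul S).const_add B
    rw [hd.deriv, pucciScalar_of_nonneg (by positivity), hK]
    have h1 : ‖p.1 - y₀‖ ^ 2 < r ^ 2 := by
      have := mem_ball_iff_norm.1 hp
      gcongr
    have h2 : l * (4 * S * k ^ 2 * e) * ‖p.1 - y₀‖ ^ 2
        ≤ max l m * (4 * S * k ^ 2 * e) * ‖p.1 - y₀‖ ^ 2 := by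
      gcongr; exact le_max_left _ _
    have hΛ : 0 < max l m := lt_max_of_lt_left hl
    have h3 : max l m * (4 * S * k ^ 2 * e) * ‖p.1 - y₀‖ ^ 2
        < max l m * (4 * S * k ^ 2 * e) * r ^ 2 := by gcongr
    nlinarith

/-- Interior decay: if `B_r(y₀) ⊆ Ω` the boundary values influence `u(y₀, T)` only by a
Gaussian factor. -/
theorem PucciSub.le_exp (hu : PucciSub l m Ω u) (hl : 0 < l)
    (hcont : ContinuousOn u (Ω ×ˢ Ici 0)) {B S : ℝ} (hS : 0 < S)
    (hle : ∀ p ∈ Ω ×ˢ Ioi (0 : ℝ), u p ≤ B + S) (h0 : ∀ y ∈ Ω, u (y, 0) ≤ B)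
    {y₀ : RN N} {r T : ℝ} (hr : 0 < r) (hball : Metric.ball y₀ r ⊆ Ω) (hT : 0 < T) :
    u (y₀, T) ≤ B + S * Real.exp (N / 4 - r ^ 2 / (16 * max l m * T)) := by
  have hΛ : 0 < max l m := lt_max_of_lt_left hl
  -- This `k` minimizes the exponent at `(y₀, T)`, up to the term which does not involve `r`.
  set k := 1 / (8 * max l m * T) with hk
  have hkpos : 0 < k := by positivity
  set K := 4 * max l m * k ^ 2 * r ^ 2 + 2 * N * max l m * k with hK
  have hKpos : 0 ≤ K := by positivity
  set w := expBarrier y₀ B S k r K with hw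
  have hwB : ∀ p, B ≤ w p := fun p => by
    have : 0 < S * Real.exp ((‖p.1 - y₀‖ ^ 2 - r ^ 2) * k + K * p.2) := by positivity
    simp only [hw, expBarrier]; linarith
  have hsub : Metric.ball y₀ r ×ˢ Ioo (0 : ℝ) (2 * T) ⊆ Ω ×ˢ Ioi (0 : ℝ) := fun p hp =>
    ⟨hball hp.1, hp.2.1⟩
  have hsub' : Metric.ball y₀ r ×ˢ Ioo (0 : ℝ) (2 * T) ⊆ Ω ×ˢ Ici (0 : ℝ) := fun p hp =>
    ⟨hball hp.1, hp.2.1.le⟩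
  have key := hu.le_of_barrier (U := Metric.ball y₀ r) (w := w) (a := 0) (T := 2 * T) (M := S)
    Metric.isOpen_ball hball le_rfl (hcont.mono hsub')
    (fun p hp => by linarith [hle p (hsub hp), hwB p])
    (fun p hp => isStrictBarrierAt_expBarrier hl hS hkpos hp.1) ?_ ?_ (y₀, T)
    ⟨Metric.mem_ball_self hr, hT, by show T < 2 * T; linarith⟩
  · refine key.trans (le_of_eq ?_)
    simp only [hw, expBarrier, sub_self, norm_zero]
    congr 3
    simp only [hK, hk]
    field_simp
    ring
  · rintro p ⟨-, hp2⟩ hpn ε hε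
    by_cases hp1 : p.1 ∈ Metric.ball y₀ r
    · have hp0 : p.2 = 0 := by
        by_contra h
        exact hpn ⟨hp1, lt_of_le_of_ne hp2.1 (Ne.symm h), hp2.2⟩
      have hpΩ : p ∈ Ω ×ˢ Ici (0 : ℝ) := ⟨hball hp1, hp2.1⟩
      have h1 : u p < B + ε := by
        have := h0 p.1 (hball hp1)
        rw [← hp0] at this
        linarith
      filter_upwards [((hcont p hpΩ).mono hsub').eventually_lt_const h1] with q hq
      linarith [hwB q]
    · have hn : r ≤ ‖p.1 - y₀‖ := by rwa [mem_ball_iff_norm, not_lt] at hp1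
      have hc : ContinuousAt (fun q : RN N × ℝ =>
          B + S * Real.exp ((‖q.1 - y₀‖ ^ 2 - r ^ 2) * k)) p := by fun_prop
      have h1 : B + S - ε < B + S * Real.exp ((‖p.1 - y₀‖ ^ 2 - r ^ 2) * k) := by
        have h2 : 0 ≤ (‖p.1 - y₀‖ ^ 2 - r ^ 2) * k := by
          have : r ^ 2 ≤ ‖p.1 - y₀‖ ^ 2 := by gcongr
          exact mul_nonneg (by linarith) hkpos.le
        have := Real.one_le_exp h2
        nlinarith
      filter_upwards [nhdsWithin_le_nhds (hc.eventually_const_lt h1), self_mem_nhdsWithin]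
        with q hq hqm
      have h3 := hle q (hsub hqm)
      have h4 : B + S * Real.exp ((‖q.1 - y₀‖ ^ 2 - r ^ 2) * k) ≤ w q := by
        have h5 : 0 ≤ K * q.2 := mul_nonneg hKpos hqm.2.1.le
        simp only [hw, expBarrier]
        gcongr
        linarith
      linarith
  · intro ε _
    refine ⟨‖y₀‖ + r, fun p hp hn => ?_⟩
    have := mem_ball_iff_norm.1 hp.1
    have := norm_sub_norm_le p.1 y₀
    linarith

/-- Such cylinders avoid the corner, where a solution need not be continuous. -/
theorem prod_Ioo_subset_regular (U : Set (RN N)) (hUΩ : U ⊆ Ω) {a T : ℝ} (ha : 0 ≤ a) :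
    U ×ˢ Ioo a T ⊆ (closure Ω ×ˢ Ici (0 : ℝ)) \ (frontier Ω ×ˢ {0}) := fun _ hp =>
  ⟨⟨subset_closure (hUΩ hp.1), ha.trans hp.2.1.le⟩, fun h => (ha.trans_lt hp.2.1).ne' h.2⟩

theorem mem_frontier_or_mem (hΩ : IsOpen Ω) {y : RN N} (hy : y ∈ closure Ω) :
    y ∈ frontier Ω ∨ y ∈ Ω := by
  by_cases h : y ∈ Ω
  · exact Or.inr h
  · exact Or.inl ⟨hy, by rwa [hΩ.interior_eq]⟩

variable {z : RN N} {g : RN N → ℝ} {δ C ε : ℝ}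

/-- Near the boundary a subsolution which is at most `B` on the boundary, and at most `B + S`
otherwise, lies below an error function profile. -/
theorem PucciSub.le_lower_barrier (hu : PucciSub l m Ω u) (hl : 0 < l) (hm : 0 < m)
    (hΩ : IsOpen Ω)
    (hcont : ContinuousOn u ((closure Ω ×ˢ Ici (0 : ℝ)) \ (frontier Ω ×ˢ {0}))) {B S : ℝ}
    (hS : 0 < S) (hle : ∀ p ∈ Ω ×ˢ Ioi (0 : ℝ), u p ≤ B + S)
    (hfr : ∀ y ∈ frontier Ω, ∀ t : ℝ, 0 < t → u (y, t) ≤ B)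
    (hg : IsC2DefiningOn Ω z g δ C ε) (hC : 0 ≤ C) {a ρ : ℝ} (ha : 0 < a)
    (ham : 1 + ε ≤ 4 * a ^ 2 * m) (hρ : 0 < ρ) (hρδ : ρ < δ) {y : RN N} (hyΩ : y ∈ Ω)
    (hy : y ∈ Metric.ball z ρ) {t : ℝ} (ht : 0 < t) :
    u (y, t) ≤ erfcBarrier g z (B + S) (-S) a (N * max l m * C) (S / ρ ^ 2)
      (2 * (N * max l m) + 1) 0 (y, t) := by
  have hΛ : 0 < max l m := lt_max_of_lt_left hl
  set K := N * max l m * C with hK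
  set K' := 2 * (N * max l m) + 1 with hK'
  have hK0 : 0 ≤ K := by positivity
  have hK'0 : 0 ≤ K' := by positivity
  -- the barrier is started at a positive time `t₀`, when the boundary values are attained
  have step : ∀ t₀ : ℝ, 0 < t₀ → t₀ < t →
      u (y, t) ≤ erfcBarrier g z (B + S) (-S) a K (S / ρ ^ 2) K' t₀ (y, t) := by
    intro t₀ ht₀ ht₀t
    set w := erfcBarrier g z (B + S) (-S) a K (S / ρ ^ 2) K' t₀ with hw
    set U := Ω ∩ Metric.ball z ρ with hU
    set T := t + 1 with hT
    have hUΩ : U ⊆ Ω := inter_subset_left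
    have hδ : ∀ q ∈ U, q ∈ Metric.ball z δ := fun q hq => Metric.ball_subset_ball hρδ.le hq.2
    have hreg := prod_Ioo_subset_regular (T := T) U hUΩ ht₀.le
    have hleU : ∀ p ∈ U ×ˢ Ioo t₀ T, u p ≤ B + S := fun p hp =>
      hle p ⟨hp.1.1, ht₀.trans hp.2.1⟩
    have hw1 : ∀ p ∈ U ×ˢ Ioo t₀ T, B + S - S * Erfc (a * (g p.1 / Real.sqrt (p.2 - t₀)))
        + S / ρ ^ 2 * ‖p.1 - z‖ ^ 2 ≤ w p := by
      intro p hp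
      have hτ : 0 ≤ p.2 - t₀ := by have : t₀ < p.2 := hp.2.1; linarith
      have h1 : Erfc (a * ((g p.1 + K * (p.2 - t₀)) / Real.sqrt (p.2 - t₀)))
          ≤ Erfc (a * (g p.1 / Real.sqrt (p.2 - t₀))) := by
        apply strictAnti_Erfc.antitone
        gcongr
        have : 0 ≤ K * (p.2 - t₀) := by positivity
        linarith
      have h2 : S * Erfc (a * ((g p.1 + K * (p.2 - t₀)) / Real.sqrt (p.2 - t₀)))
          ≤ S * Erfc (a * (g p.1 / Real.sqrt (p.2 - t₀))) := by gcongr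
      have h3 : S / ρ ^ 2 * ‖p.1 - z‖ ^ 2
          ≤ S / ρ ^ 2 * (‖p.1 - z‖ ^ 2 + K' * (p.2 - t₀)) := by
        gcongr
        have : 0 ≤ K' * (p.2 - t₀) := by positivity
        linarith
      simp only [hw, erfcBarrier]
      linarith
    have hw2 : ∀ p ∈ U ×ˢ Ioo t₀ T, B + S / ρ ^ 2 * ‖p.1 - z‖ ^ 2 ≤ w p := by
      intro p hp
      have hgp : 0 < g p.1 := (hg.mem_iff _ (hδ _ hp.1)).1 hp.1.1
      have h1 : Erfc (a * (g p.1 / Real.sqrt (p.2 - t₀))) ≤ 1 := Erfc_le_one (by positivity)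
      have := hw1 p hp
      nlinarith
    refine hu.le_of_barrier (U := U) (w := w) (a := t₀) (T := T) (M := S)
      (hΩ.inter Metric.isOpen_ball) hUΩ ht₀.le (hcont.mono hreg) (fun p hp => ?_)
      (fun p hp => hg.isStrictBarrierAt_lower hl hm hC ha (by positivity) hS ham (hδ _ hp.1)
        hp.1.1 hp.2.1) ?_ ?_ (y, t) ⟨⟨hyΩ, hy⟩, ht₀t, by simp [hT]⟩
    · have h1 := hw2 p hp
      have h2 : 0 ≤ S / ρ ^ 2 * ‖p.1 - z‖ ^ 2 := by positivity
      linarith [hleU p hp]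
    · rintro p ⟨hp1, hp2⟩ hpn η hη
      have hcl : p.1 ∈ closure Ω := closure_mono hUΩ hp1
      have hpos : 0 < p.2 := ht₀.trans_le hp2.1
      rcases mem_frontier_or_mem hΩ hcl with hpf | hpΩ
      · have hpr : p ∈ (closure Ω ×ˢ Ici (0 : ℝ)) \ (frontier Ω ×ˢ {0}) :=
          ⟨⟨hcl, hpos.le⟩, fun h => hpos.ne' h.2⟩
        have h1 : u p < B + η := by linarith [hfr p.1 hpf p.2 hpos]
        filter_upwards [((hcont p hpr).mono hreg).eventually_lt_const h1, self_mem_nhdsWithin]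
          with q hq hqm
        have h2 : 0 ≤ S / ρ ^ 2 * ‖q.1 - z‖ ^ 2 := by positivity
        linarith [hw2 q hqm]
      · by_cases hpb : p.1 ∈ Metric.ball z ρ
        · have hp0 : p.2 = t₀ := by
            by_contra h
            exact hpn ⟨⟨hpΩ, hpb⟩, lt_of_le_of_ne hp2.1 (Ne.symm h), hp2.2⟩
          have hpδ := hδ p.1 ⟨hpΩ, hpb⟩
          have hgp : 0 < g p.1 := (hg.mem_iff _ hpδ).1 hpΩ
          have hgc : ContinuousAt (fun q : RN N × ℝ => g q.1) p :=
            (hg.contDiffAt _ hpδ).continuousAt.comp continuousAt_fst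
          have h1 : ∀ᶠ q : RN N × ℝ in 𝓝[U ×ˢ Ioo t₀ T] p, g p.1 / 2 < g q.1 :=
            nhdsWithin_le_nhds (hgc.eventually_const_lt (by linarith))
          have h2 : Tendsto (fun q : RN N × ℝ => Real.sqrt (q.2 - t₀)) (𝓝[U ×ˢ Ioo t₀ T] p)
              (𝓝[>] 0) := by
            rw [tendsto_nhdsWithin_iff]
            constructor
            · have : ContinuousAt (fun q : RN N × ℝ => Real.sqrt (q.2 - t₀)) p := by fun_prop
              have h3 := this.tendsto
              simp only [hp0, sub_self, Real.sqrt_zero] at h3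
              exact h3.mono_left nhdsWithin_le_nhds
            · filter_upwards [self_mem_nhdsWithin] with q hq
              exact Real.sqrt_pos.2 (sub_pos.2 hq.2.1)
          have h3 : Tendsto (fun q : RN N × ℝ => a * (g p.1 / 2 * (Real.sqrt (q.2 - t₀))⁻¹))
              (𝓝[U ×ˢ Ioo t₀ T] p) atTop :=
            ((tendsto_inv_nhdsGT_zero.comp h2).const_mul_atTop (by linarith)).const_mul_atTop ha
          have h4 : ∀ᶠ q : RN N × ℝ in 𝓝[U ×ˢ Ioo t₀ T] p,
              Erfc (a * (g p.1 / 2 * (Real.sqrt (q.2 - t₀))⁻¹)) < η / S :=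
            (tendsto_Erfc_atTop.comp h3).eventually_lt_const (by positivity)
          filter_upwards [h1, h4, self_mem_nhdsWithin] with q hq1 hq2 hqm
          have h5 : Erfc (a * (g q.1 / Real.sqrt (q.2 - t₀)))
              ≤ Erfc (a * (g p.1 / 2 * (Real.sqrt (q.2 - t₀))⁻¹)) := by
            apply strictAnti_Erfc.antitone
            rw [div_eq_mul_inv (g q.1)]
            gcongr
          have h6 : S * Erfc (a * (g q.1 / Real.sqrt (q.2 - t₀))) ≤ η := by
            rw [mul_comm, ← le_div_iff₀ hS]; linarith
          have h7 : 0 ≤ S / ρ ^ 2 * ‖q.1 - z‖ ^ 2 := by positivity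
          linarith [hw1 q hqm, hleU q hqm]
        · have hn : ρ ≤ ‖p.1 - z‖ := by rwa [mem_ball_iff_norm, not_lt] at hpb
          have hc : ContinuousAt (fun q : RN N × ℝ => B + S / ρ ^ 2 * ‖q.1 - z‖ ^ 2) p := by
            fun_prop
          have h1 : B + S - η < B + S / ρ ^ 2 * ‖p.1 - z‖ ^ 2 := by
            have : S / ρ ^ 2 * ρ ^ 2 ≤ S / ρ ^ 2 * ‖p.1 - z‖ ^ 2 := by gcongr
            rw [div_mul_cancel₀ _ (by positivity)] at this
            linarith
          filter_upwards [nhdsWithin_le_nhds (hc.eventually_const_lt h1), self_mem_nhdsWithin]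
            with q hq hqm
          linarith [hw2 q hqm, hleU q hqm]
    · intro η _
      refine ⟨‖z‖ + ρ, fun p hp hn => ?_⟩
      have := mem_ball_iff_norm.1 hp.1.2
      have := norm_sub_norm_le p.1 z
      linarith
  have hcont0 : ContinuousAt (fun t₀ : ℝ =>
      erfcBarrier g z (B + S) (-S) a K (S / ρ ^ 2) K' t₀ (y, t)) 0 := by
    have h1 : Real.sqrt (t - 0) ≠ 0 := by rw [sub_zero]; positivity
    have h2 := continuous_Erfc
    simp only [erfcBarrier]
    fun_prop (disch := assumption)
  refine ge_of_tendsto (hcont0.tendsto.mono_left (nhdsWithin_le_nhds (s := Ioi 0))) ?_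
  filter_upwards [Ioo_mem_nhdsGT ht] with t₀ h₀
  exact step t₀ h₀.1 h₀.2

/-- Near the boundary a subsolution with `u ≤ 1`, and `u ≤ 0` initially, lies below an error
function profile. -/
theorem PucciSub.le_upper_barrier (hu : PucciSub l m Ω u) (hl : 0 < l) (hm : 0 < m)
    (hΩ : IsOpen Ω)
    (hcont : ContinuousOn u ((closure Ω ×ˢ Ici (0 : ℝ)) \ (frontier Ω ×ˢ {0})))
    (hle : ∀ p ∈ Ω ×ˢ Ioi (0 : ℝ), u p ≤ 1) (h0 : ∀ y ∈ Ω, u (y, 0) ≤ 0)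
    (hg : IsC2DefiningOn Ω z g δ C ε) (hC : 0 ≤ C) {a ρ : ℝ} (ha : 0 < a)
    (hal : 4 * a ^ 2 * l * (1 + ε) ≤ 1) (hρ : 0 < ρ) (hρδ : ρ < δ) {y : RN N} (hyΩ : y ∈ Ω)
    (hy : y ∈ Metric.ball z ρ) {t : ℝ} (ht : 0 < t) :
    u (y, t) ≤ erfcBarrier g z 0 1 a (-(2 * (N * max l m * C))) (1 / ρ ^ 2)
      (2 * (N * max l m) + 1) 0 (y, t) := by
  have hΛ : 0 < max l m := lt_max_of_lt_left hl
  set K := 2 * (N * max l m * C) with hK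
  set K' := 2 * (N * max l m) + 1 with hK'
  have hK0 : 0 ≤ K := by positivity
  have hK'0 : 0 ≤ K' := by positivity
  -- the barrier is started before the time `0`, so that it is continuous up to time `0`
  have step : ∀ t₀ : ℝ, t₀ < 0 →
      u (y, t) ≤ erfcBarrier g z 0 1 a (-K) (1 / ρ ^ 2) K' t₀ (y, t) := by
    intro t₀ ht₀
    set w := erfcBarrier g z 0 1 a (-K) (1 / ρ ^ 2) K' t₀ with hw
    set U := Ω ∩ Metric.ball z ρ with hU
    set T := t + 1 with hT
    have hUΩ : U ⊆ Ω := inter_subset_left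
    have hδ : ∀ q ∈ U, q ∈ Metric.ball z δ := fun q hq => Metric.ball_subset_ball hρδ.le hq.2
    have hreg := prod_Ioo_subset_regular (T := T) U hUΩ le_rfl
    have hleU : ∀ p ∈ U ×ˢ Ioo 0 T, u p ≤ 1 := fun p hp => hle p ⟨hp.1.1, hp.2.1⟩
    have hw1 : ∀ p ∈ U ×ˢ Ioo 0 T, Erfc (a * (g p.1 / Real.sqrt (-t₀)))
        + 1 / ρ ^ 2 * ‖p.1 - z‖ ^ 2 ≤ w p := by
      intro p hp
      have hp2 : 0 < p.2 := hp.2.1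
      have hτ : 0 < p.2 - t₀ := by linarith
      have hgp : 0 < g p.1 := (hg.mem_iff _ (hδ _ hp.1)).1 hp.1.1
      have h1 : Erfc (a * (g p.1 / Real.sqrt (-t₀)))
          ≤ Erfc (a * ((g p.1 + -K * (p.2 - t₀)) / Real.sqrt (p.2 - t₀))) := by
        apply strictAnti_Erfc.antitone
        have : 0 ≤ K * (p.2 - t₀) := by positivity
        have h2 : (g p.1 + -K * (p.2 - t₀)) / Real.sqrt (p.2 - t₀)
            ≤ g p.1 / Real.sqrt (p.2 - t₀) := by gcongr; linarith
        have h3 : g p.1 / Real.sqrt (p.2 - t₀) ≤ g p.1 / Real.sqrt (-t₀) := by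
          have : 0 < Real.sqrt (-t₀) := Real.sqrt_pos.2 (by linarith)
          gcongr
          linarith
        exact mul_le_mul_of_nonneg_left (h2.trans h3) ha.le
      have h3 : 1 / ρ ^ 2 * ‖p.1 - z‖ ^ 2
          ≤ 1 / ρ ^ 2 * (‖p.1 - z‖ ^ 2 + K' * (p.2 - t₀)) := by
        gcongr
        have : 0 ≤ K' * (p.2 - t₀) := by positivity
        linarith
      simp only [hw, erfcBarrier]
      linarith
    have hw2 : ∀ p ∈ U ×ˢ Ioo 0 T, 1 / ρ ^ 2 * ‖p.1 - z‖ ^ 2 ≤ w p := fun p hp => by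
      linarith [hw1 p hp, Erfc_pos (a * (g p.1 / Real.sqrt (-t₀)))]
    have hw3 : ∀ p ∈ U ×ˢ Ioo 0 T, 0 ≤ w p := fun p hp =>
      (by positivity : 0 ≤ 1 / ρ ^ 2 * ‖p.1 - z‖ ^ 2).trans (hw2 p hp)
    refine hu.le_of_barrier (U := U) (w := w) (a := 0) (T := T) (M := 1)
      (hΩ.inter Metric.isOpen_ball) hUΩ le_rfl (hcont.mono hreg)
      (fun p hp => by linarith [hleU p hp, hw3 p hp])
      (fun p hp => hg.isStrictBarrierAt_upper hl hm hC ha (by positivity) hal (hδ _ hp.1)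
        hp.1.1 (ht₀.trans hp.2.1)) ?_ ?_ (y, t) ⟨⟨hyΩ, hy⟩, ht, by simp [hT]⟩
    · rintro p ⟨hp1, hp2⟩ hpn η hη
      have hcl : p.1 ∈ closure Ω := closure_mono hUΩ hp1
      rcases mem_frontier_or_mem hΩ hcl with hpf | hpΩ
      · have hpδ : p.1 ∈ Metric.ball z δ := by
          have : p.1 ∈ Metric.closedBall z ρ :=
            closure_minimal (inter_subset_right.trans Metric.ball_subset_closedBall)
              Metric.isClosed_closedBall hp1
          rw [Metric.mem_closedBall] at this
          rw [Metric.mem_ball]; linarith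
        have hgp : g p.1 = 0 := (hg.frontier_iff _ hpδ).1 hpf
        have hgc : ContinuousAt (fun q : RN N × ℝ => g q.1) p :=
          (hg.contDiffAt _ hpδ).continuousAt.comp continuousAt_fst
        have hE := continuous_Erfc
        have hc : ContinuousAt (fun q : RN N × ℝ => Erfc (a * (g q.1 / Real.sqrt (-t₀)))) p :=
          hE.continuousAt.comp ((hgc.div_const _).const_mul a)
        have h1 : 1 - η < Erfc (a * (g p.1 / Real.sqrt (-t₀))) := by
          rw [hgp, zero_div, mul_zero, Erfc_zero]; linarith
        filter_upwards [nhdsWithin_le_nhds (hc.eventually_const_lt h1), self_mem_nhdsWithin]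
          with q hq hqm
        have h2 : 0 ≤ 1 / ρ ^ 2 * ‖q.1 - z‖ ^ 2 := by positivity
        linarith [hw1 q hqm, hleU q hqm]
      · by_cases hpb : p.1 ∈ Metric.ball z ρ
        · have hp0 : p.2 = 0 := by
            by_contra h
            exact hpn ⟨⟨hpΩ, hpb⟩, lt_of_le_of_ne hp2.1 (Ne.symm h), hp2.2⟩
          have hpr : p ∈ (closure Ω ×ˢ Ici (0 : ℝ)) \ (frontier Ω ×ˢ {0}) :=
            ⟨⟨hcl, hp2.1⟩, fun h => h.1.2 (by rwa [hΩ.interior_eq])⟩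
          have h1 : u p < η := by
            have := h0 p.1 hpΩ
            rw [show (p.1, (0 : ℝ)) = p from Prod.ext rfl hp0.symm] at this
            linarith
          filter_upwards [((hcont p hpr).mono hreg).eventually_lt_const h1, self_mem_nhdsWithin]
            with q hq hqm
          linarith [hw3 q hqm]
        · have hn : ρ ≤ ‖p.1 - z‖ := by rwa [mem_ball_iff_norm, not_lt] at hpb
          have hc : ContinuousAt (fun q : RN N × ℝ => 1 / ρ ^ 2 * ‖q.1 - z‖ ^ 2) p := by
            fun_prop
          have h1 : 1 - η < 1 / ρ ^ 2 * ‖p.1 - z‖ ^ 2 := by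
            have : 1 / ρ ^ 2 * ρ ^ 2 ≤ 1 / ρ ^ 2 * ‖p.1 - z‖ ^ 2 := by gcongr
            rw [div_mul_cancel₀ _ (by positivity)] at this
            linarith
          filter_upwards [nhdsWithin_le_nhds (hc.eventually_const_lt h1), self_mem_nhdsWithin]
            with q hq hqm
          linarith [hw2 q hqm, hleU q hqm]
    · intro η _
      refine ⟨‖z‖ + ρ, fun p hp hn => ?_⟩
      have := mem_ball_iff_norm.1 hp.1.2
      have := norm_sub_norm_le p.1 z
      linarith
  have hcont0 : ContinuousAt (fun t₀ : ℝ =>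
      erfcBarrier g z 0 1 a (-K) (1 / ρ ^ 2) K' t₀ (y, t)) 0 := by
    have h1 : Real.sqrt (t - 0) ≠ 0 := by rw [sub_zero]; positivity
    have h2 := continuous_Erfc
    simp only [erfcBarrier]
    fun_prop (disch := assumption)
  refine ge_of_tendsto (hcont0.tendsto.mono_left (nhdsWithin_le_nhds (s := Iio 0))) ?_
  filter_upwards [self_mem_nhdsWithin] with t₀ h₀
  exact step t₀ h₀

end Bounds

/-! ### The maximum principle -/

section MaximumPrinciple

variable {N : ℕ} {l m : ℝ} {Ω : Set (RN N)} {u : RN N × ℝ → ℝ}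

/-- The quadratic function `B + c (|y|² + K' (t + 1))`, as a degenerate `erfcBarrier`. -/
theorem isStrictBarrierAt_quadratic (hl : 0 < l) {B c : ℝ} (hc : 0 < c) {p : RN N × ℝ}
    (hp : 0 < p.2) :
    IsStrictBarrierAt l m
      (erfcBarrier (fun _ => 0) 0 B 0 0 0 c (2 * (N * max l m) + 1) (-1)) p := by
  have hpos : 0 < p.2 - -1 := by linarith
  refine ⟨contDiffAt_erfcBarrier contDiffAt_const (by linarith), 0, 2 * c, 0, fun ξ => ?_, ?_⟩
  · rw [spatialD2_erfcBarrier contDiffAt_const rfl hpos rfl]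
    simp only [zero_mul, zero_div, zero_add, sub_zero]
    rw [abs_of_nonneg (by positivity)]
  · rw [deriv_erfcBarrier rfl hpos rfl, pucciScalar_of_nonneg le_rfl]
    have hΛ : 0 < max l m := lt_max_of_lt_left hl
    simp only [zero_mul, mul_zero, zero_add]
    nlinarith

/-- If `u ≤ B + S` throughout and `u ≤ B` on the parabolic boundary away from the corner, then
near the corner `∂Ω × {0}` the excess `S` is reduced by a factor which does not depend on the
corner point: either the boundary is far, in the parabolic scale, and the interior decay
applies, or it is near and the lower barrier applies. -/
theorem PucciSub.exists_lt_one_forall_eventually_le (hu : PucciSub l m Ω u) (hl : 0 < l)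
    (hm : 0 < m) (hΩ : IsC2Domain Ω)
    (hcont : ContinuousOn u ((closure Ω ×ˢ Ici (0 : ℝ)) \ (frontier Ω ×ˢ {0}))) {B S : ℝ}
    (hS : 0 < S) (hle : ∀ p ∈ Ω ×ˢ Ioi (0 : ℝ), u p ≤ B + S) (h0 : ∀ y ∈ Ω, u (y, 0) ≤ B)
    (hfr : ∀ y ∈ frontier Ω, ∀ t : ℝ, 0 < t → u (y, t) ≤ B) :
    ∃ θ < 1, 0 ≤ θ ∧ ∀ z ∈ frontier Ω, ∀ᶠ q in 𝓝[Ω ×ˢ Ioi 0] (z, 0), u q ≤ B + θ * S := by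
  have hΛ : 0 < max l m := lt_max_of_lt_left hl
  -- At distance `M √t` from the boundary the interior decay factor is `exp (-1)`.
  set M := Real.sqrt (16 * max l m * (N / 4 + 1)) with hM
  have hMpos : 0 < M := Real.sqrt_pos.2 (by positivity)
  have hM2 : M ^ 2 = 16 * max l m * (N / 4 + 1) := Real.sq_sqrt (by positivity)
  set a := 1 / Real.sqrt (2 * m) with ha
  have hapos : 0 < a := by positivity
  have ham : 1 + 1 ≤ 4 * a ^ 2 * m := by
    rw [ha, div_pow, Real.sq_sqrt (by positivity)]
    apply le_of_eq; field_simp; norm_num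
  -- Closer to the boundary `g ≤ 2 M √t`; the summand `1` leaves room for the drift.
  set e := Erfc (a * (2 * M + 1)) with he
  have he0 : 0 < e := Erfc_pos _
  refine ⟨max (1 / 2) (1 - e / 2), max_lt (by norm_num) (by linarith),
    le_max_of_le_left (by norm_num), fun z hz => ?_⟩
  obtain ⟨g, δ, hδ, C, hC, hg⟩ := hΩ.exists_isC2DefiningOn hz (ε := 1) one_pos
  have hgz : g z = 0 := (hg.frontier_iff z (Metric.mem_ball_self hδ)).1 hz
  set K := N * max l m * C with hK
  set K' := 2 * (N * max l m) + 1 with hK'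
  have e1 : ∀ᶠ q : RN N × ℝ in 𝓝 (z, 0), q.1 ∈ Metric.ball z (δ / 2) :=
    continuousAt_fst (Metric.ball_mem_nhds z (by positivity))
  have e2 : ∀ᶠ q : RN N × ℝ in 𝓝 (z, 0), K * Real.sqrt q.2 < 1 := by
    have : ContinuousAt (fun q : RN N × ℝ => K * Real.sqrt q.2) (z, 0) := by fun_prop
    exact this.eventually_lt_const (by simp)
  have e3 : ∀ᶠ q : RN N × ℝ in 𝓝 (z, 0),
      1 / (δ / 2) ^ 2 * (‖q.1 - z‖ ^ 2 + K' * (q.2 - 0)) < e / 2 := by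
    have : ContinuousAt (fun q : RN N × ℝ =>
      1 / (δ / 2) ^ 2 * (‖q.1 - z‖ ^ 2 + K' * (q.2 - 0))) (z, 0) := by fun_prop
    exact this.eventually_lt_const (by simpa using he0)
  filter_upwards [nhdsWithin_le_nhds e1, nhdsWithin_le_nhds e2, nhdsWithin_le_nhds e3,
    self_mem_nhdsWithin] with q hq1 hq2 hq3 hq
  have ht : 0 < q.2 := hq.2
  have hsq := Real.sqrt_pos.2 ht
  rcases le_or_gt (M * Real.sqrt q.2) (g q.1 / 2) with hfar | hnear
  · have hball : Metric.ball q.1 (M * Real.sqrt q.2) ⊆ Ω :=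
      (Metric.ball_subset_ball hfar).trans (hg.ball_subset le_rfl hgz hq1)
    have hsub : Ω ×ˢ Ici (0 : ℝ) ⊆ (closure Ω ×ˢ Ici (0 : ℝ)) \ (frontier Ω ×ˢ {0}) :=
      fun p hp => ⟨⟨subset_closure hp.1, hp.2⟩,
        fun h => h.1.2 (by rw [hΩ.1.interior_eq]; exact hp.1)⟩
    have h1 := hu.le_exp hl (hcont.mono hsub) hS hle h0 (by positivity) hball ht
    have h2 : (N : ℝ) / 4 - (M * Real.sqrt q.2) ^ 2 / (16 * max l m * q.2) = -1 := by
      rw [mul_pow, Real.sq_sqrt ht.le, hM2]; field_simp; ring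
    rw [h2] at h1
    have h3 : Real.exp (-1) < 1 / 2 := by
      have := Real.exp_neg_one_lt_d9
      linarith
    have h4 : S * Real.exp (-1) ≤ max (1 / 2) (1 - e / 2) * S := by
      rw [mul_comm]
      exact mul_le_mul_of_nonneg_right (h3.le.trans (le_max_left _ _)) hS.le
    linarith
  · have h1 := hu.le_lower_barrier hl hm hΩ.1 hcont hS hle hfr hg hC hapos ham
      (half_pos hδ) (half_lt_self hδ) hq.1 hq1 ht
    refine h1.trans ?_
    have h2 : e ≤ Erfc (a * ((g q.1 + K * (q.2 - 0)) / Real.sqrt (q.2 - 0))) := by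
      apply strictAnti_Erfc.antitone
      refine mul_le_mul_of_nonneg_left ?_ hapos.le
      rw [sub_zero, div_le_iff₀ hsq]
      have : K * q.2 = K * Real.sqrt q.2 * Real.sqrt q.2 := by
        rw [mul_assoc K, Real.mul_self_sqrt ht.le]
      nlinarith
    have h3 : S / (δ / 2) ^ 2 * (‖q.1 - z‖ ^ 2 + K' * (q.2 - 0)) ≤ S * (e / 2) := by
      rw [show S / (δ / 2) ^ 2 * (‖q.1 - z‖ ^ 2 + K' * (q.2 - 0))
        = S * (1 / (δ / 2) ^ 2 * (‖q.1 - z‖ ^ 2 + K' * (q.2 - 0))) by ring]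
      gcongr
    have h4 : (1 - e / 2) * S ≤ max (1 / 2) (1 - e / 2) * S :=
      mul_le_mul_of_nonneg_right (le_max_right _ _) hS.le
    have h5 : S * e ≤ S * Erfc (a * ((g q.1 + K * (q.2 - 0)) / Real.sqrt (q.2 - 0))) := by gcongr
    simp only [erfcBarrier]
    linarith

/-- The maximum principle for bounded subsolutions on a possibly unbounded `C²` domain, without
any continuity at the corner `∂Ω × {0}`. If `S > 0` is the excess of the supremum over `B`, then
`u ≤ B + θ S` near the corner with a fixed `θ < 1`, hence everywhere by comparison with
`B + θ S + c (|y|² + K' (t + 1))`, which contradicts the choice of `S`. -/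
theorem PucciSub.le_of_le_on_boundary (hu : PucciSub l m Ω u) (hl : 0 < l)
    (hm : 0 < m) (hΩ : IsC2Domain Ω)
    (hcont : ContinuousOn u ((closure Ω ×ˢ Ici (0 : ℝ)) \ (frontier Ω ×ˢ {0}))) {A₀ B : ℝ}
    (hbdd : ∀ p ∈ Ω ×ˢ Ioi (0 : ℝ), u p ≤ A₀) (h0 : ∀ y ∈ Ω, u (y, 0) ≤ B)
    (hfr : ∀ y ∈ frontier Ω, ∀ t : ℝ, 0 < t → u (y, t) ≤ B) :
    ∀ p ∈ Ω ×ˢ Ioi (0 : ℝ), u p ≤ B := by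
  intro p₀ hp₀
  by_contra hlt
  push Not at hlt
  have hΛ : 0 < max l m := lt_max_of_lt_left hl
  set A := sSup (u '' (Ω ×ˢ Ioi (0 : ℝ))) with hA
  have hba : BddAbove (u '' (Ω ×ˢ Ioi (0 : ℝ))) := ⟨A₀, by rintro _ ⟨p, hp, rfl⟩; exact hbdd p hp⟩
  have hAle : ∀ p ∈ Ω ×ˢ Ioi (0 : ℝ), u p ≤ A := fun p hp => le_csSup hba ⟨p, hp, rfl⟩
  set S := A - B with hS
  have hSpos : 0 < S := by have := hAle p₀ hp₀; linarith
  obtain ⟨θ, hθ1, hθ0, hθ⟩ := hu.exists_lt_one_forall_eventually_le hl hm hΩ hcont hSpos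
    (fun p hp => by linarith [hAle p hp]) h0 hfr
  suffices hsuff : ∀ p ∈ Ω ×ˢ Ioi (0 : ℝ), u p ≤ B + θ * S by
    have : A ≤ B + θ * S :=
      csSup_le ⟨_, p₀, hp₀, rfl⟩ (by rintro _ ⟨p, hp, rfl⟩; exact hsuff p hp)
    nlinarith
  set K' := 2 * (N * max l m) + 1 with hK'
  have hK'0 : 0 < K' := by positivity
  have step : ∀ p ∈ Ω ×ˢ Ioi (0 : ℝ), ∀ c > 0,
      u p ≤ B + θ * S + c * (‖p.1‖ ^ 2 + K' * (p.2 + 1)) := by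
    intro p hp c hc
    have hp2 : 0 < p.2 := hp.2
    set w := erfcBarrier (fun _ => 0) (0 : RN N) (B + θ * S) 0 0 0 c K' (-1) with hw
    have hwe : ∀ q, w q = B + θ * S + c * (‖q.1‖ ^ 2 + K' * (q.2 + 1)) := fun q => by
      simp [hw, erfcBarrier]
    have hreg := prod_Ioo_subset_regular (T := p.2 + 1) Ω subset_rfl le_rfl
    have hwge : ∀ q ∈ Ω ×ˢ Ioo (0 : ℝ) (p.2 + 1), B + θ * S + c * ‖q.1‖ ^ 2 ≤ w q := by
      intro q hq
      have : 0 < q.2 := hq.2.1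
      rw [hwe]
      gcongr
      have : 0 ≤ K' * (q.2 + 1) := by positivity
      linarith
    have hθS : 0 ≤ θ * S := by positivity
    have hwge' : ∀ q ∈ Ω ×ˢ Ioo (0 : ℝ) (p.2 + 1), B + θ * S ≤ w q := by
      intro q hq
      have : 0 ≤ c * ‖q.1‖ ^ 2 := by positivity
      linarith [hwge q hq]
    rw [← hwe]
    refine hu.le_of_barrier (U := Ω) (w := w) (a := 0) (T := p.2 + 1) (M := A - (B + θ * S))
      hΩ.1 subset_rfl le_rfl (hcont.mono hreg)
      (fun q hq => by linarith [hAle q ⟨hq.1, hq.2.1⟩, hwge' q hq])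
      (fun q hq => isStrictBarrierAt_quadratic hl hc hq.2.1) ?_ ?_ p ⟨hp.1, hp2, by linarith⟩
    · rintro q ⟨hq1, hq2⟩ hqn η hη
      have key : q ∈ (closure Ω ×ˢ Ici (0 : ℝ)) \ (frontier Ω ×ˢ {0}) → u q ≤ B →
          ∀ᶠ y in 𝓝[Ω ×ˢ Ioo 0 (p.2 + 1)] q, u y ≤ w y + η := by
        intro hqr hqB
        filter_upwards [((hcont q hqr).mono hreg).eventually_lt_const
          (show u q < B + η by linarith), self_mem_nhdsWithin] with y hy hym
        linarith [hwge' y hym]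
      rcases mem_frontier_or_mem hΩ.1 hq1 with hqf | hqΩ
      · rcases eq_or_lt_of_le hq2.1 with h | h
        · have hq : q = (q.1, 0) := Prod.ext rfl h.symm
          have h1 := hθ q.1 hqf
          rw [← hq] at h1
          have h2 : Ω ×ˢ Ioo (0 : ℝ) (p.2 + 1) ⊆ Ω ×ˢ Ioi (0 : ℝ) := fun y hy => ⟨hy.1, hy.2.1⟩
          filter_upwards [nhdsWithin_mono q h2 h1, self_mem_nhdsWithin] with y hy hym
          linarith [hwge' y hym]
        · exact key ⟨⟨hq1, h.le⟩, fun hh => h.ne' hh.2⟩ (hfr q.1 hqf q.2 h)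
      · have h : q.2 = 0 := by
          by_contra hh
          exact hqn ⟨hqΩ, lt_of_le_of_ne hq2.1 (Ne.symm hh), hq2.2⟩
        have hq : q = (q.1, 0) := Prod.ext rfl h
        refine key ⟨⟨hq1, hq2.1⟩, fun hh => hh.1.2 (by rwa [hΩ.1.interior_eq])⟩ ?_
        rw [hq]; exact h0 q.1 hqΩ
    · intro η hη
      refine ⟨S / c + 1, fun q hq hn => ?_⟩
      have h1 : 1 ≤ S / c + 1 := by have : 0 < S / c := by positivity
                                    linarith
      have h2 : S / c ≤ ‖q.1‖ ^ 2 := by nlinarith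
      rw [div_le_iff₀ hc] at h2
      linarith [hwge q hq, hAle q ⟨hq.1, hq.2.1⟩]
  intro p hp
  refine le_of_forall_pos_le_add fun η hη => ?_
  have hp2 : 0 < p.2 := hp.2
  have hpos : 0 < ‖p.1‖ ^ 2 + K' * (p.2 + 1) := by positivity
  have := step p hp (η / (‖p.1‖ ^ 2 + K' * (p.2 + 1))) (by positivity)
  rwa [div_mul_cancel₀ _ hpos.ne'] at this

end MaximumPrinciple

/-! ### Bounds and boundary layer of the solution -/

section Solution

variable {N : ℕ} {l m : ℝ} {Ω : Set (RN N)} {v : RN N × ℝ → ℝ}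

theorem IsBoundedSolution.pucciSub (hv : IsBoundedSolution (pucciMinus l m) Ω v) (hl : 0 < l)
    (hm : 0 < m) : PucciSub l m Ω v :=
  hv.sub.pucciSub hl hm

theorem IsBoundedSolution.pucciSub_neg (hv : IsBoundedSolution (pucciMinus l m) Ω v) (hl : 0 < l)
    (hm : 0 < m) : PucciSub m l Ω (fun p => -v p) :=
  hv.super.pucciSub_neg hl hm

theorem IsBoundedSolution.le_one (hv : IsBoundedSolution (pucciMinus l m) Ω v) (hl : 0 < l)
    (hm : 0 < m) (hΩ : IsC2Domain Ω) : ∀ p ∈ Ω ×ˢ Ioi (0 : ℝ), v p ≤ 1 := by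
  obtain ⟨C, hC⟩ := hv.bounded
  exact (hv.pucciSub hl hm).le_of_le_on_boundary hl hm hΩ hv.continuousOn
    (fun p hp => (le_abs_self _).trans (hC p ⟨subset_closure hp.1, hp.2⟩))
    (fun y hy => by rw [hv.initial y hy]; exact zero_le_one)
    (fun y hy t ht => (hv.boundary y hy t ht).le)

theorem IsBoundedSolution.nonneg (hv : IsBoundedSolution (pucciMinus l m) Ω v) (hl : 0 < l)
    (hm : 0 < m) (hΩ : IsC2Domain Ω) : ∀ p ∈ Ω ×ˢ Ioi (0 : ℝ), 0 ≤ v p := by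
  obtain ⟨C, hC⟩ := hv.bounded
  have := (hv.pucciSub_neg hl hm).le_of_le_on_boundary hm hl hΩ hv.continuousOn.neg (A₀ := C)
    (B := 0) (fun p hp => (neg_le_abs _).trans (hC p ⟨subset_closure hp.1, hp.2⟩))
    (fun y hy => by rw [hv.initial y hy, neg_zero])
    (fun y hy t ht => by rw [hv.boundary y hy t ht]; norm_num)
  intro p hp
  linarith [this p hp]

/-- A solution is exponentially small in `r² / t` at distance `r` from the boundary. -/
theorem IsBoundedSolution.le_exp (hv : IsBoundedSolution (pucciMinus l m) Ω v) (hl : 0 < l)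
    (hm : 0 < m) (hΩ : IsC2Domain Ω) {y : RN N} {r t : ℝ} (hr : 0 < r)
    (hball : Metric.ball y r ⊆ Ω) (ht : 0 < t) :
    v (y, t) ≤ Real.exp (N / 4 - r ^ 2 / (16 * max l m * t)) := by
  have hsub : Ω ×ˢ Ici (0 : ℝ) ⊆ (closure Ω ×ˢ Ici (0 : ℝ)) \ (frontier Ω ×ˢ {0}) :=
    fun p hp => ⟨⟨subset_closure hp.1, hp.2⟩,
        fun h => h.1.2 (by rw [hΩ.1.interior_eq]; exact hp.1)⟩
  have := (hv.pucciSub hl hm).le_exp hl (hv.continuousOn.mono hsub) (B := 0) one_pos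
    (by simpa using hv.le_one hl hm hΩ) (fun y hy => (hv.initial y hy).le) hr hball ht
  simpa using this

end Solution

section Profile

variable {N : ℕ} {l m : ℝ} {Ω : Set (RN N)} {v : RN N × ℝ → ℝ}

theorem tendsto_erfcBarrier {g : RN N → ℝ} {z : RN N} {y : ℝ → RN N} {s : ℝ}
    (hy : Tendsto y (𝓝[>] 0) (𝓝 z)) (hs : Tendsto (fun t => g (y t) / Real.sqrt t) (𝓝[>] 0) (𝓝 s))
    (B A a K c K' : ℝ) :
    Tendsto (fun t => erfcBarrier g z B A a K c K' 0 (y t, t)) (𝓝[>] 0)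
      (𝓝 (B + A * Erfc (a * s))) := by
  have h1 : Tendsto (fun t : ℝ => K * Real.sqrt t) (𝓝[>] 0) (𝓝 0) := by
    have : ContinuousAt (fun t : ℝ => K * Real.sqrt t) 0 := by fun_prop
    simpa using this.tendsto.mono_left nhdsWithin_le_nhds
  have h2 : Tendsto (fun t => Erfc (a * (g (y t) / Real.sqrt t + K * Real.sqrt t))) (𝓝[>] 0)
      (𝓝 (Erfc (a * (s + 0)))) :=
    (continuous_Erfc.tendsto _).comp ((hs.add h1).const_mul a)
  have h3 : Tendsto (fun t => c * (‖y t - z‖ ^ 2 + K' * t)) (𝓝[>] 0)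
      (𝓝 (c * (‖z - z‖ ^ 2 + K' * 0))) :=
    ((((hy.sub_const z).norm).pow 2).add
      ((tendsto_id.mono_left nhdsWithin_le_nhds).const_mul K')).const_mul c
  have h4 := ((h2.const_mul A).const_add B).add h3
  simp only [add_zero, sub_self, norm_zero, mul_zero, ne_eq, OfNat.ofNat_ne_zero,
    not_false_eq_true, zero_pow] at h4
  refine h4.congr' ?_
  filter_upwards [self_mem_nhdsWithin] with t ht
  have ht' : (0 : ℝ) < t := ht
  have hsq := Real.sqrt_pos.2 ht'
  have h5 : g (y t) / Real.sqrt t + K * Real.sqrt t = (g (y t) + K * t) / Real.sqrt t := by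
    rw [add_div]
    congr 1
    rw [eq_div_iff hsq.ne', mul_assoc, Real.mul_self_sqrt ht'.le]
  simp only [erfcBarrier, sub_zero, h5]

/-- The boundary layer: in the parabolic scaling the solution converges to the one dimensional
profile `Erfc (s / (2 √l))`, where `s` is the limit of the rescaled distance to the boundary. -/
theorem IsBoundedSolution.tendsto_Erfc (hv : IsBoundedSolution (pucciMinus l m) Ω v) (hl : 0 < l)
    (hm : 0 < m) (hΩ : IsC2Domain Ω) {g : RN N → ℝ} {z : RN N}
    (hg : ∀ ε > 0, ∃ δ > 0, ∃ C ≥ 0, IsC2DefiningOn Ω z g δ C ε)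
    {y : ℝ → RN N} {s : ℝ} (hyΩ : ∀ᶠ t in 𝓝[>] 0, y t ∈ Ω)
    (hy : Tendsto y (𝓝[>] 0) (𝓝 z)) (hs : Tendsto (fun t => g (y t) / Real.sqrt t) (𝓝[>] 0) (𝓝 s)) :
    Tendsto (fun t => v (y t, t)) (𝓝[>] 0) (𝓝 (Erfc (s / (2 * Real.sqrt l)))) := by
  have hsl := Real.sqrt_pos.2 hl
  have hsq : Real.sqrt l ^ 2 = l := Real.sq_sqrt hl.le
  have hE := continuous_Erfc
  rw [tendsto_order]
  constructor
  · intro b hb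
    have hc : ContinuousAt (fun ε : ℝ => Erfc (Real.sqrt (1 + ε) / (2 * Real.sqrt l) * s)) 0 := by
      fun_prop
    have hb' : b < Erfc (Real.sqrt (1 + 0) / (2 * Real.sqrt l) * s) := by
      rw [add_zero, Real.sqrt_one, one_div_mul_eq_div]; exact hb
    obtain ⟨ε, h1, hε⟩ := (((hc.tendsto.mono_left (nhdsWithin_le_nhds
      (s := Ioi 0))).eventually_const_lt hb').and self_mem_nhdsWithin).exists
    replace hε : 0 < ε := hε
    obtain ⟨δ, hδ, C, hC, hgε⟩ := hg ε hε
    set a := Real.sqrt (1 + ε) / (2 * Real.sqrt l) with ha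
    have hapos : 0 < a := by positivity
    have ham : 1 + ε ≤ 4 * a ^ 2 * l := by
      rw [ha, div_pow, Real.sq_sqrt (by positivity), mul_pow, hsq]
      apply le_of_eq; field_simp; norm_num
    have hlim := tendsto_erfcBarrier hy hs (-1 + 1) (-1) a (N * max m l * C) (1 / (δ / 2) ^ 2)
      (2 * (N * max m l) + 1)
    have hlt : -1 + 1 + -1 * Erfc (a * s) < -b := by linarith
    filter_upwards [hlim.eventually_lt_const hlt, hyΩ, hy (Metric.ball_mem_nhds z (half_pos hδ)),
      self_mem_nhdsWithin] with t h2 h3 h4 ht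
    have h5 := (hv.pucciSub_neg hl hm).le_lower_barrier hm hl hΩ.1 hv.continuousOn.neg
      (B := -1) one_pos (fun p hp => by linarith [hv.nonneg hl hm hΩ p hp])
      (fun y hy t ht => by rw [hv.boundary y hy t ht]) hgε hC hapos ham
      (half_pos hδ) (half_lt_self hδ) h3 h4 ht
    linarith
  · intro b hb
    have hc : ContinuousAt
        (fun ε : ℝ => Erfc (1 / (2 * Real.sqrt l * Real.sqrt (1 + ε)) * s)) 0 := by
      have : 2 * Real.sqrt l * Real.sqrt (1 + 0) ≠ 0 := by
        rw [add_zero, Real.sqrt_one]; positivity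
      fun_prop (disch := assumption)
    have hb' : Erfc (1 / (2 * Real.sqrt l * Real.sqrt (1 + 0)) * s) < b := by
      rw [add_zero, Real.sqrt_one, mul_one, one_div_mul_eq_div]; exact hb
    obtain ⟨ε, h1, hε⟩ := (((hc.tendsto.mono_left (nhdsWithin_le_nhds
      (s := Ioi 0))).eventually_lt_const hb').and self_mem_nhdsWithin).exists
    replace hε : 0 < ε := hε
    obtain ⟨δ, hδ, C, hC, hgε⟩ := hg ε hε
    set a := 1 / (2 * Real.sqrt l * Real.sqrt (1 + ε)) with ha
    have hapos : 0 < a := by positivity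
    have hal : 4 * a ^ 2 * l * (1 + ε) ≤ 1 := by
      rw [ha, div_pow, mul_pow, mul_pow, hsq, Real.sq_sqrt (by positivity)]
      apply le_of_eq; field_simp; norm_num
    have hlim := tendsto_erfcBarrier hy hs 0 1 a (-(2 * (N * max l m * C))) (1 / (δ / 2) ^ 2)
      (2 * (N * max l m) + 1)
    have hlt : 0 + 1 * Erfc (a * s) < b := by linarith
    filter_upwards [hlim.eventually_lt_const hlt, hyΩ, hy (Metric.ball_mem_nhds z (half_pos hδ)),
      self_mem_nhdsWithin] with t h2 h3 h4 ht
    have h5 := (hv.pucciSub hl hm).le_upper_barrier hl hm hΩ.1 hv.continuousOn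
      (hv.le_one hl hm hΩ) (fun y hy => (hv.initial y hy).le) hgε hC hapos hal
      (half_pos hδ) (half_lt_self hδ) h3 h4 ht
    linarith

end Profile

/-! ### Geometry of the touching ball -/

/-- Second order Taylor expansion at a critical point, by the mean value inequality for the
difference between the function and its Taylor polynomial. -/
theorem abs_sub_half_fderiv_fderiv_le {E : Type*} [NormedAddCommGroup E] [NormedSpace ℝ E]
    {φ : E → ℝ} (hφ : ContDiffAt ℝ 2 φ 0) (h0 : φ 0 = 0) (h1 : fderiv ℝ φ 0 = 0) {ε : ℝ}
    (hε : 0 < ε) :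
    ∀ᶠ η in 𝓝 (0 : E), |φ η - 1 / 2 * fderiv ℝ (fderiv ℝ φ) 0 η η| ≤ ε * ‖η‖ ^ 2 := by
  set A := fderiv ℝ (fderiv ℝ φ) 0 with hA
  have hsymm : ∀ a b, A a b = A b a := hφ.isSymmSndFDerivAt (by simp)
  have hd : HasFDerivAt (fderiv ℝ φ) A 0 :=
    ((hφ.fderiv_right (m := 1) (by norm_num)).differentiableAt (by simp)).hasFDerivAt
  have hlo : ∀ᶠ η in 𝓝 (0 : E), ‖fderiv ℝ φ η - A η‖ ≤ ε * ‖η‖ := by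
    have := hd.isLittleO.def hε
    simpa [h1] using this
  obtain ⟨r, hr, h⟩ := Metric.eventually_nhds_iff_ball.1 (hlo.and (hφ.eventually (by simp)))
  filter_upwards [Metric.ball_mem_nhds 0 hr] with η hη
  set q : E → ℝ := fun ζ => φ ζ - 1 / 2 * A ζ ζ with hq
  have hder : ∀ ζ ∈ Metric.ball (0 : E) r, HasFDerivAt q (fderiv ℝ φ ζ - A ζ) ζ := by
    intro ζ hζ
    have e1 := ((h ζ hζ).2.differentiableAt (by simp)).hasFDerivAt
    have e2 : HasFDerivAt (fun ζ => A ζ ζ) _ ζ := A.hasFDerivAt.clm_apply (hasFDerivAt_id ζ)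
    refine (e1.sub (e2.const_mul (1 / 2))).congr_fderiv ?_
    ext w
    simp [hsymm w ζ]
    ring
  set s := ‖η‖ with hs
  have hconv : Convex ℝ (Metric.closedBall (0 : E) s) := convex_closedBall 0 s
  have hsub : Metric.closedBall (0 : E) s ⊆ Metric.ball 0 r :=
    Metric.closedBall_subset_ball (by simpa using hη)
  have hmv := hconv.norm_image_sub_le_of_norm_hasFDerivWithin_le (𝕜 := ℝ) (f := q)
    (f' := fun ζ => fderiv ℝ φ ζ - A ζ) (C := ε * s)
    (fun ζ hζ => (hder ζ (hsub hζ)).hasFDerivWithinAt)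
    (fun ζ hζ => ((h ζ (hsub hζ)).1).trans (by
      have : ‖ζ‖ ≤ s := by simpa using hζ
      gcongr)) (x := 0) (y := η) (by simp [hs]) (by simp [hs])
  have hq0 : q 0 = 0 := by simp [hq, h0]
  rw [hq0, sub_zero, sub_zero, Real.norm_eq_abs] at hmv
  refine hmv.trans (le_of_eq ?_)
  rw [← hs]; ring

section Geometry

variable {N : ℕ} {Ω : Set (RN N)} {x z ν : RN N} {R : ℝ} {φ : (Submodule.span ℝ {ν})ᗮ → ℝ}

/-- The centre of the touching ball lies on the inner normal. -/
theorem IsC2GraphAt.eq_add_smul (h : IsC2GraphAt Ω z ν φ) (hφ : fderiv ℝ φ 0 = 0) (hx : x ∈ Ω)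
    (htouch : Metric.closedBall x R ∩ Ωᶜ = {z}) : x = z + R • ν := by
  have hzmem : z ∈ Metric.closedBall x R ∩ Ωᶜ := by rw [htouch]; rfl
  set e := x - z with he
  have heR : ‖e‖ ≤ R := by
    have := mem_closedBall_iff_norm.1 hzmem.1
    rwa [norm_sub_rev] at this
  have he0 : e ≠ 0 := fun h0 => hzmem.2 (by rwa [← sub_eq_zero.1 h0])
  have hepos : 0 < ‖e‖ := norm_pos_iff.2 he0
  have hΩ : ∀ y ∈ Metric.closedBall x R, y ≠ z → y ∈ Ω := by
    intro y hy hyz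
    by_contra hn
    have : y ∈ Metric.closedBall x R ∩ Ωᶜ := ⟨hy, hn⟩
    rw [htouch] at this
    exact hyz this
  have hνν : inner ℝ ν ν = (1 : ℝ) := by rw [real_inner_self_eq_norm_sq, h.norm_eq]; norm_num
  have hν0 : ν ≠ 0 := fun h0 => by simp [h0] at hνν
  have hline : ∀ w : RN N, Tendsto (fun s : ℝ => z + s • w) (𝓝[>] 0) (𝓝 z) := by
    intro w
    have : ContinuousAt (fun s : ℝ => z + s • w) 0 := by fun_prop
    simpa using this.tendsto.mono_left nhdsWithin_le_nhds
  -- directions pointing into the ball point into the half space `⟨w, ν⟩ ≥ 0`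
  have key : ∀ w : RN N, 0 < inner ℝ w e → 0 ≤ inner ℝ ν w := by
    intro w hw
    have hw0 : w ≠ 0 := fun h0 => by simp [h0] at hw
    have e1 : ∀ᶠ s : ℝ in 𝓝[>] 0, z + s • w ∈ Ω := by
      have hc : ∀ᶠ s : ℝ in 𝓝[>] 0, s * ‖w‖ ^ 2 < 2 * inner ℝ w e := by
        have : ContinuousAt (fun s : ℝ => s * ‖w‖ ^ 2) 0 := by fun_prop
        exact nhdsWithin_le_nhds (this.eventually_lt_const (by simpa using hw))
      filter_upwards [hc, self_mem_nhdsWithin] with s hs hspos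
      have hspos' : (0 : ℝ) < s := hspos
      refine hΩ _ ?_ ?_
      · rw [mem_closedBall_iff_norm, show z + s • w - x = s • w - e by rw [he]; abel]
        have hn : ‖s • w - e‖ ^ 2 = s * (s * ‖w‖ ^ 2 - 2 * inner ℝ w e) + ‖e‖ ^ 2 := by
          rw [norm_sub_sq_real, norm_smul, real_inner_smul_left, Real.norm_of_nonneg hspos'.le]
          ring
        have : ‖s • w - e‖ ^ 2 ≤ ‖e‖ ^ 2 := by rw [hn]; nlinarith
        exact (abs_le_of_sq_le_sq' this hepos.le).2.trans heR
      · simp [hspos'.ne', hw0]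
    have e2 : ∀ᶠ s : ℝ in 𝓝[>] 0, 0 < graphDefining z ν φ (z + s • w) := by
      filter_upwards [e1, (hline w).eventually h.mem_iff_graphDefining] with s h1 h2
      exact h2.1 h1
    have hd : HasDerivAt (fun s : ℝ => graphDefining z ν φ (z + s • w)) (inner ℝ ν w) 0 := by
      have h1 : HasDerivAt (fun s : ℝ => z + s • w) w 0 := by
        simpa using ((hasDerivAt_id (0 : ℝ)).smul_const w).const_add z
      have h2 : HasFDerivAt (graphDefining z ν φ) (fderiv ℝ (graphDefining z ν φ) z)
          (z + (0 : ℝ) • w) := by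
        rw [zero_smul, add_zero]
        exact (h.contDiffAt_graphDefining.differentiableAt (by simp)).hasFDerivAt
      have h3 := h2.comp_hasDerivAt 0 h1
      change HasDerivAt (fun s : ℝ => graphDefining z ν φ (z + s • w)) _ 0 at h3
      refine h3.congr_deriv ?_
      rw [h.fderiv_graphDefining, hφ]
      simp
    have hz0 : graphDefining z ν φ z = 0 := by simp [graphDefining, h.map_zero]
    have hslope := hd.tendsto_slope_zero_right
    refine ge_of_tendsto hslope ?_
    filter_upwards [e2, self_mem_nhdsWithin] with s hs hspos
    have hspos' : (0 : ℝ) < s := hspos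
    simp only [zero_add, zero_smul, add_zero, hz0, sub_zero, smul_eq_mul]
    positivity
  -- hence the two half spaces coincide, and `e` is a positive multiple of `ν`
  have key' : ∀ w : RN N, 0 ≤ inner ℝ w e → 0 ≤ inner ℝ ν w := by
    intro w hw
    have hc : Tendsto (fun s : ℝ => inner ℝ ν (w + s • e)) (𝓝[>] 0) (𝓝 (inner ℝ ν w)) := by
      have : ContinuousAt (fun s : ℝ => inner ℝ ν (w + s • e)) 0 := by fun_prop
      simpa using this.tendsto.mono_left nhdsWithin_le_nhds
    refine ge_of_tendsto hc ?_
    filter_upwards [self_mem_nhdsWithin] with s hs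
    refine key _ ?_
    have hs' : (0 : ℝ) < s := hs
    rw [inner_add_left, real_inner_smul_left, real_inner_self_eq_norm_sq]
    positivity
  have h1 : 0 ≤ inner ℝ ν e := key' e (by rw [real_inner_self_eq_norm_sq]; positivity)
  have h2 := key' (-ν + (inner ℝ ν e / ‖e‖ ^ 2) • e) (by
    rw [inner_add_left, real_inner_smul_left, real_inner_self_eq_norm_sq, inner_neg_left,
      div_mul_cancel₀ _ (by positivity)]
    simp)
  rw [inner_add_right, inner_neg_right, real_inner_smul_right, hνν, div_mul_eq_mul_div,
    le_neg_add_iff_add_le, add_zero, le_div_iff₀ (by positivity), one_mul, ← sq] at h2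
  have h3 : inner ℝ ν e = ‖ν‖ * ‖e‖ := by
    refine le_antisymm (real_inner_le_norm _ _) ?_
    rw [h.norm_eq, one_mul]
    exact (abs_le_of_sq_le_sq' h2 h1).2
  rw [inner_eq_norm_mul_iff_real, h.norm_eq, one_smul] at h3
  -- `z` is not an interior point of the ball, as points below the graph are outside `Ω`
  have heqR : ‖e‖ = R := by
    by_contra hne
    have hlt : ‖e‖ < R := lt_of_le_of_ne heR hne
    have e1 : ∀ᶠ s : ℝ in 𝓝[>] 0, z + s • (-ν) ∈ Metric.ball x R :=
      (hline (-ν)).eventually (Metric.isOpen_ball.mem_nhds (by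
        rwa [mem_ball_iff_norm, norm_sub_rev]))
    obtain ⟨s, h1, h2, hs⟩ := (e1.and (((hline (-ν)).eventually h.mem_iff_graphDefining).and
      self_mem_nhdsWithin)).exists
    have hs' : (0 : ℝ) < s := hs
    have h4 := h2.1 (hΩ _ (Metric.ball_subset_closedBall h1) (by simp [hs'.ne', hν0]))
    simp only [graphDefining, add_sub_cancel_left, inner_smul_right, inner_neg_right, hνν,
      map_smul, map_neg, Submodule.orthogonalProjectionOnto_orthogonalComplement_singleton_eq_zero,
      neg_zero, smul_zero, h.map_zero] at h4
    linarith
  rw [← heqR, h3, he]; abel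

theorem norm_sq_lt_of_mem_ball (hν : ‖ν‖ = 1) {y : RN N} (hy : y ∈ Metric.ball (z + R • ν) R) :
    ‖y - z‖ ^ 2 < 2 * R * inner ℝ ν (y - z) := by
  have h1 := mem_ball_iff_norm.1 hy
  have hR : 0 < R := (norm_nonneg _).trans_lt h1
  have h2 : ‖y - (z + R • ν)‖ ^ 2 < R ^ 2 := by gcongr
  rw [show y - (z + R • ν) = (y - z) - R • ν by abel, norm_sub_sq_real, norm_smul, hν,
    real_inner_smul_right, Real.norm_of_nonneg hR.le, mul_one, real_inner_comm] at h2
  linarith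

/-- Strict inequality of the curvatures makes the distance to the complement of `Ω` at points of
the touching ball comparable with the natural parabolic distance to the touching point. -/
theorem IsC2GraphAt.exists_ball_subset (h : IsC2GraphAt Ω z ν φ) (hφ : fderiv ℝ φ 0 = 0)
    (hΩo : IsOpen Ω) (hz : z ∈ frontier Ω) (hR : 0 < R)
    (htouch : Metric.closedBall (z + R • ν) R ∩ Ωᶜ = {z}) {k : ℝ} (hk : k < 1 / R)
    (hφk : ∀ η, fderiv ℝ (fderiv ℝ φ) 0 η η ≤ k * ‖η‖ ^ 2) :
    ∃ c > 0, ∀ y ∈ Metric.ball (z + R • ν) R, Metric.ball y (c * (inner ℝ ν (y - z) +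
      ‖(Submodule.span ℝ {ν})ᗮ.orthogonalProjectionOnto (y - z)‖ ^ 2)) ⊆ Ω := by
  wlog hk0 : 0 ≤ k generalizing k
  · exact this (k := 0) (by positivity)
      (fun η => (hφk η).trans (by
        have : 0 ≤ ‖η‖ ^ 2 := by positivity
        nlinarith)) le_rfl
  set ε := (1 / R - k) / 2 with hε
  have hεpos : 0 < ε := by simp only [hε]; linarith
  obtain ⟨δ, hδ, C, hC, hg⟩ := exists_isC2DefiningOn h.contDiffAt_graphDefining
    (h.norm_fderiv_graphDefining hφ) h.mem_iff_graphDefining h.mem_frontier_iff_graphDefining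
    (ε := 1) one_pos
  have hgz : graphDefining z ν φ z = 0 := (hg.frontier_iff z (Metric.mem_ball_self hδ)).1 hz
  set P := (Submodule.span ℝ {ν})ᗮ.orthogonalProjectionOnto with hP
  have hPle : ∀ w, ‖P w‖ ≤ ‖w‖ := fun w =>
    (P.le_opNorm w).trans (by
      have := Submodule.orthogonalProjectionOnto_norm_le (Submodule.span ℝ {ν})ᗮ
      nlinarith [norm_nonneg w])
  have hPc : Tendsto (fun y => P (y - z)) (𝓝 z) (𝓝 0) := by
    have : ContinuousAt (fun y => P (y - z)) z := by fun_prop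
    simpa using this.tendsto
  obtain ⟨δ', hδ', hsm⟩ := Metric.eventually_nhds_iff_ball.1
    ((hPc.eventually
      (abs_sub_half_fderiv_fderiv_le h.contDiffAt h.map_zero hφ (half_pos hεpos))).and
      (Metric.ball_mem_nhds z (half_pos hδ)))
  -- elementary bounds in the ball
  have hb : ∀ y ∈ Metric.ball (z + R • ν) R, 0 < inner ℝ ν (y - z) ∧
      ‖P (y - z)‖ ^ 2 ≤ 2 * R * inner ℝ ν (y - z) ∧ inner ℝ ν (y - z) ≤ 2 * R := by
    intro y hy
    have h1 := norm_sq_lt_of_mem_ball h.norm_eq hy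
    have h2 : inner ℝ ν (y - z) ≤ ‖y - z‖ := by
      simpa [h.norm_eq] using real_inner_le_norm ν (y - z)
    have h3 : 0 < inner ℝ ν (y - z) := by
      have : 0 < 2 * R * inner ℝ ν (y - z) := (sq_nonneg _).trans_lt h1
      exact (mul_pos_iff_of_pos_left (by positivity)).1 this
    refine ⟨h3, ?_, ?_⟩
    · have : ‖P (y - z)‖ ^ 2 ≤ ‖y - z‖ ^ 2 := by gcongr; exact hPle _
      linarith
    · nlinarith
  set K := Metric.closedBall (z + R • ν) R \ Metric.ball z δ' with hK
  have hKc : IsCompact K := (isCompact_closedBall _ _).diff Metric.isOpen_ball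
  have hKΩ : K ⊆ Ω := by
    intro y hy
    by_contra hn
    have : y ∈ Metric.closedBall (z + R • ν) R ∩ Ωᶜ := ⟨hy.1, hn⟩
    rw [htouch] at this
    exact hy.2 (by rw [mem_singleton_iff.1 this]; exact Metric.mem_ball_self hδ')
  obtain ⟨r₀, hr₀, hthick⟩ := hKc.exists_thickening_subset_open hΩo hKΩ
  refine ⟨min (R * ε / (2 * (1 + 2 * R))) (r₀ / (2 * R + 4 * R ^ 2)), by positivity,
    fun y hy => ?_⟩
  obtain ⟨h1, h2, h3⟩ := hb y hy
  set τ := inner ℝ ν (y - z) with hτ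
  have hsum : 0 ≤ τ + ‖P (y - z)‖ ^ 2 := by positivity
  by_cases hyδ : y ∈ Metric.ball z δ'
  · obtain ⟨h4, h5⟩ := hsm y hyδ
    refine (Metric.ball_subset_ball ?_).trans (hg.ball_subset le_rfl hgz h5)
    have h6 : φ (P (y - z)) ≤ (k + ε) / 2 * ‖P (y - z)‖ ^ 2 := by
      have := (abs_le.1 h4).2
      linarith [hφk (P (y - z))]
    have h7 : (k + ε) / 2 * ‖P (y - z)‖ ^ 2 ≤ (k + ε) / 2 * (2 * R * τ) := by gcongr
    have h8 : (k + ε) / 2 * (2 * R * τ) = τ - R * ε * τ := by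
      simp only [hε]; field_simp; ring
    have h9 : R * ε * τ ≤ graphDefining z ν φ y := by
      simp only [graphDefining]; linarith
    calc min (R * ε / (2 * (1 + 2 * R))) (r₀ / (2 * R + 4 * R ^ 2)) * (τ + ‖P (y - z)‖ ^ 2)
        ≤ R * ε / (2 * (1 + 2 * R)) * (τ + 2 * R * τ) := by
          gcongr; exact min_le_left _ _
      _ = R * ε * τ / 2 := by field_simp
      _ ≤ _ := by linarith
  · have hyK : y ∈ K := ⟨Metric.ball_subset_closedBall hy, hyδ⟩
    refine Subset.trans ?_ hthick
    intro w hw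
    rw [Metric.mem_thickening_iff]
    refine ⟨y, hyK, (Metric.mem_ball.1 hw).trans_le ?_⟩
    calc min (R * ε / (2 * (1 + 2 * R))) (r₀ / (2 * R + 4 * R ^ 2)) * (τ + ‖P (y - z)‖ ^ 2)
        ≤ r₀ / (2 * R + 4 * R ^ 2) * (2 * R + 2 * R * (2 * R)) := by
          gcongr
          · exact min_le_right _ _
          · exact h2.trans (by gcongr)
      _ = r₀ := by field_simp; ring

end Geometry

/-! ### Normal coordinates and parabolic scaling -/

section Chart

variable {n : ℕ} {ν : RN (n + 1)} (b : OrthonormalBasis (Fin n) ℝ (Submodule.span ℝ {ν})ᗮ)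

/-- Orthonormal coordinates adapted to the normal `ν` and a basis of the tangent space. -/
noncomputable def normalChart (p : ℝ × (Fin n → ℝ)) : RN (n + 1) :=
  p.1 • ν + ((∑ j, p.2 j • b j : (Submodule.span ℝ {ν})ᗮ) : RN (n + 1))

theorem inner_coe_orthogonal (w : (Submodule.span ℝ {ν})ᗮ) : inner ℝ ν (w : RN (n + 1)) = (0 : ℝ) :=
  Submodule.mem_orthogonal_singleton_iff_inner_right.1 w.2

theorem inner_normalChart (hν : ‖ν‖ = 1) (p : ℝ × (Fin n → ℝ)) :
    inner ℝ ν (normalChart b p) = p.1 := by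
  rw [normalChart, inner_add_right, inner_coe_orthogonal, real_inner_smul_right,
    real_inner_self_eq_norm_sq, hν]
  norm_num

theorem orthogonalProjectionOnto_normalChart (p : ℝ × (Fin n → ℝ)) :
    (Submodule.span ℝ {ν})ᗮ.orthogonalProjectionOnto (normalChart b p) = ∑ j, p.2 j • b j := by
  rw [normalChart, map_add, map_smul,
    Submodule.orthogonalProjectionOnto_orthogonalComplement_singleton_eq_zero, smul_zero, zero_add,
    Submodule.orthogonalProjectionOnto_mem_subspace_eq_self]

theorem norm_sum_smul_sq (η : Fin n → ℝ) : ‖∑ j, η j • b j‖ ^ 2 = ∑ j, η j ^ 2 := by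
  rw [← real_inner_self_eq_norm_sq, b.orthonormal.inner_sum]
  simp [sq]

theorem norm_normalChart_sq (hν : ‖ν‖ = 1) (p : ℝ × (Fin n → ℝ)) :
    ‖normalChart b p‖ ^ 2 = p.1 ^ 2 + ∑ j, p.2 j ^ 2 := by
  rw [normalChart, norm_add_sq_real, real_inner_smul_left, inner_coe_orthogonal, norm_smul, hν,
    ← Submodule.coe_norm, norm_sum_smul_sq]
  simp

theorem measurePreserving_normalChart (hν : ‖ν‖ = 1) :
    MeasurePreserving (normalChart b) ∧ MeasurableEmbedding (normalChart b) := by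
  have hcoe : ∀ i j, inner ℝ ((b i : RN (n + 1))) (b j : RN (n + 1))
      = if i = j then (1 : ℝ) else 0 :=
    fun i j => by
      have := orthonormal_iff_ite.1 b.orthonormal i j
      simpa using this
  have hon : Orthonormal ℝ
      (Fin.cons ν (fun j => (b j : RN (n + 1))) : Fin (n + 1) → RN (n + 1)) := by
    rw [orthonormal_iff_ite]
    intro i j
    refine Fin.cases ?_ (fun i => ?_) i <;> refine Fin.cases ?_ (fun j => ?_) j
    · simp [hν]
    · simpa [(Fin.succ_ne_zero j).symm] using inner_coe_orthogonal (b j)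
    · rw [real_inner_comm]
      simpa [(Fin.succ_ne_zero i)] using inner_coe_orthogonal (b i)
    · simpa using hcoe i j
  have hsp := hon.linearIndependent.span_eq_top_of_card_eq_finrank' (by simp)
  set B := OrthonormalBasis.mk hon hsp.ge with hB
  have hpi : MeasurePreserving (MeasurableEquiv.piFinSuccAbove (fun _ : Fin (n + 1) => ℝ) 0).symm :=
    (volume_preserving_piFinSuccAbove (fun _ : Fin (n + 1) => ℝ) 0).symm
  have hlp : MeasurePreserving (WithLp.toLp 2 : (Fin (n + 1) → ℝ) → RN (n + 1)) :=
    PiLp.volume_preserving_toLp (Fin (n + 1))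
  have heq : normalChart b = (B.repr.symm ∘ (WithLp.toLp 2 : (Fin (n + 1) → ℝ) → RN (n + 1))) ∘
      (MeasurableEquiv.piFinSuccAbove (fun _ : Fin (n + 1) => ℝ) 0).symm := by
    funext p
    rw [Function.comp_apply, Function.comp_apply, ← B.sum_repr_symm]
    simp only [hB, OrthonormalBasis.coe_mk, Fin.sum_univ_succ, normalChart]
    simp [MeasurableEquiv.piFinSuccAbove]
  rw [heq]
  exact ⟨(B.measurePreserving_repr_symm.comp hlp).comp hpi,
    (B.repr.symm.toHomeomorph.measurableEmbedding.comp
      (MeasurableEquiv.toLp 2 (Fin (n + 1) → ℝ)).measurableEmbedding).comp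
      (MeasurableEquiv.measurableEmbedding _)⟩

end Chart

section Scaling

theorem map_volume_parabolic_scaling {n : ℕ} {r : ℝ} (hr : 0 < r) :
    Measure.map (fun p : ℝ × (Fin n → ℝ) => (r ^ 2 * p.1, r • p.2)) volume
      = ENNReal.ofReal (r ^ (n + 2))⁻¹ • (volume : Measure (ℝ × (Fin n → ℝ))) := by
  have h1 : Measure.map (fun s : ℝ => r ^ 2 * s) volume
      = ENNReal.ofReal |((r ^ 2) ^ Module.finrank ℝ ℝ)⁻¹| • volume :=
    Measure.map_addHaar_smul (volume : Measure ℝ) (by positivity : r ^ 2 ≠ 0)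
  have h2 : Measure.map (fun η : Fin n → ℝ => r • η) volume
      = ENNReal.ofReal |(r ^ Module.finrank ℝ (Fin n → ℝ))⁻¹| • volume :=
    Measure.map_addHaar_smul (volume : Measure (Fin n → ℝ)) hr.ne'
  have h3 := Measure.map_prod_map (volume : Measure ℝ) (volume : Measure (Fin n → ℝ))
    (f := fun s : ℝ => r ^ 2 * s) (g := fun η : Fin n → ℝ => r • η) (by fun_prop) (by fun_prop)
  rw [h1, h2, Measure.prod_smul_left, Measure.prod_smul_right, smul_smul,
    ← ENNReal.ofReal_mul (by positivity)] at h3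
  have h4 : |((r ^ 2) ^ Module.finrank ℝ ℝ)⁻¹| * |(r ^ Module.finrank ℝ (Fin n → ℝ))⁻¹|
      = (r ^ (n + 2))⁻¹ := by
    rw [abs_of_nonneg (by positivity), abs_of_nonneg (by positivity), Module.finrank_self,
      Module.finrank_fin_fun, pow_one, ← mul_inv, pow_add, mul_comm]
  rw [h4] at h3
  exact h3.symm

/-- Change of variables to the parabolically scaled normal coordinates at `z`. -/
theorem integral_eq_integral_normalChart {n : ℕ} {ν z : RN (n + 1)}
    (b : OrthonormalBasis (Fin n) ℝ (Submodule.span ℝ {ν})ᗮ) (hν : ‖ν‖ = 1) {r : ℝ} (hr : 0 < r)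
    (G : RN (n + 1) → ℝ) :
    (r ^ (n + 2))⁻¹ * ∫ y, G y
      = ∫ p : ℝ × (Fin n → ℝ), G (z + normalChart b (r ^ 2 * p.1, r • p.2)) := by
  obtain ⟨hmp, hme⟩ := measurePreserving_normalChart b hν
  have hemb : MeasurableEmbedding (fun p : ℝ × (Fin n → ℝ) => (r ^ 2 * p.1, r • p.2)) := by
    have h1 : MeasurableEmbedding (fun s : ℝ => r ^ 2 * s) :=
      (Homeomorph.mulLeft₀ (r ^ 2) (by positivity)).measurableEmbedding
    have h2 : MeasurableEmbedding (fun η : Fin n → ℝ => r • η) :=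
      (Homeomorph.smulOfNeZero r hr.ne').measurableEmbedding
    exact h1.prodMap h2
  rw [← integral_add_left_eq_self G z, ← hmp.integral_comp hme (fun y => G (z + y)),
    ← hemb.integral_map (fun p => G (z + normalChart b p)), map_volume_parabolic_scaling hr,
    integral_smul_measure, ENNReal.toReal_ofReal (by positivity), smul_eq_mul]

end Scaling

theorem add_normalChart_mem_ball_iff {n : ℕ} {ν z : RN (n + 1)}
    (b : OrthonormalBasis (Fin n) ℝ (Submodule.span ℝ {ν})ᗮ) (hν : ‖ν‖ = 1) {R : ℝ} (hR : 0 < R)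
    (p : ℝ × (Fin n → ℝ)) :
    z + normalChart b p ∈ Metric.ball (z + R • ν) R ↔ p.1 ^ 2 + ∑ j, p.2 j ^ 2 < 2 * R * p.1 := by
  rw [mem_ball_iff_norm, ← sq_lt_sq₀ (norm_nonneg _) hR.le,
    show z + normalChart b p - (z + R • ν) = normalChart b p - R • ν by abel, norm_sub_sq_real,
    norm_normalChart_sq b hν, real_inner_smul_right, real_inner_comm, inner_normalChart b hν,
    norm_smul, hν, Real.norm_of_nonneg hR.le]
  constructor <;> intro h <;> linarith

section QuadraticForm

variable {n : ℕ} {ν : RN (n + 1)} {φ : (Submodule.span ℝ {ν})ᗮ → ℝ}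
  {b : OrthonormalBasis (Fin n) ℝ (Submodule.span ℝ {ν})ᗮ} {κ : Fin n → ℝ}

theorem fderiv_fderiv_sum_smul
    (hκ : ∀ i j, fderiv ℝ (fderiv ℝ φ) 0 (b i) (b j) = if i = j then κ i else 0) (η : Fin n → ℝ) :
    fderiv ℝ (fderiv ℝ φ) 0 (∑ j, η j • b j) (∑ j, η j • b j) = ∑ j, κ j * η j ^ 2 := by
  simp only [map_sum, map_smul, sum_apply, smul_apply, hκ, smul_eq_mul]
  refine Finset.sum_congr rfl fun i _ => ?_
  simp
  ring

theorem exists_lt_forall_fderiv_fderiv_le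
    (hκ : ∀ i j, fderiv ℝ (fderiv ℝ φ) 0 (b i) (b j) = if i = j then κ i else 0) {R : ℝ}
    (hκR : ∀ j, κ j < 1 / R) :
    ∃ k < 1 / R, ∀ η, fderiv ℝ (fderiv ℝ φ) 0 η η ≤ k * ‖η‖ ^ 2 := by
  have h1 : ∀ᶠ k in 𝓝[<] (1 / R), ∀ j, κ j < k := eventually_all.2 fun j =>
    nhdsWithin_le_nhds (lt_mem_nhds (hκR j))
  obtain ⟨k, hk, hkR⟩ := (h1.and self_mem_nhdsWithin).exists
  refine ⟨k, hkR, fun η => ?_⟩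
  rw [← b.sum_repr η, fderiv_fderiv_sum_smul hκ, norm_sum_smul_sq, Finset.mul_sum]
  exact Finset.sum_le_sum fun j _ => mul_le_mul_of_nonneg_right (hk j).le (sq_nonneg _)

/-- The height above the boundary in the parabolic scaling. -/
theorem tendsto_graphDefining_normalChart {Ω : Set (RN (n + 1))} {z : RN (n + 1)}
    (h : IsC2GraphAt Ω z ν φ) (hφ : fderiv ℝ φ 0 = 0)
    (hκ : ∀ i j, fderiv ℝ (fderiv ℝ φ) 0 (b i) (b j) = if i = j then κ i else 0)
    (p : ℝ × (Fin n → ℝ)) :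
    Tendsto (fun r : ℝ => graphDefining z ν φ (z + normalChart b (r ^ 2 * p.1, r • p.2)) / r ^ 2)
      (𝓝[>] 0) (𝓝 (p.1 - 1 / 2 * ∑ j, κ j * p.2 j ^ 2)) := by
  set w := ∑ j, p.2 j • b j with hw
  have hval : ∀ r : ℝ, graphDefining z ν φ (z + normalChart b (r ^ 2 * p.1, r • p.2))
      = r ^ 2 * p.1 - φ (r • w) := by
    intro r
    rw [graphDefining, add_sub_cancel_left, inner_normalChart b h.norm_eq,
      orthogonalProjectionOnto_normalChart]
    simp only [hw, Finset.smul_sum, smul_smul, Pi.smul_apply, smul_eq_mul]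
  have hlim : Tendsto (fun r : ℝ => r • w) (𝓝[>] 0) (𝓝 0) := by
    have : ContinuousAt (fun r : ℝ => r • w) 0 := by fun_prop
    simpa using this.tendsto.mono_left nhdsWithin_le_nhds
  rw [Metric.tendsto_nhds]
  intro ε hε
  have hε' : 0 < ε / (‖w‖ ^ 2 + 1) := by positivity
  filter_upwards [hlim.eventually (abs_sub_half_fderiv_fderiv_le h.contDiffAt h.map_zero hφ hε'),
    self_mem_nhdsWithin] with r hr hpos
  have hpos' : (0 : ℝ) < r := hpos
  rw [map_smul, map_smul, smul_apply, hw, fderiv_fderiv_sum_smul hκ, ← hw, norm_smul, mul_pow,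
    Real.norm_eq_abs, sq_abs, smul_eq_mul, smul_eq_mul] at hr
  rw [hval, Real.dist_eq]
  have e1 : (r ^ 2 * p.1 - φ (r • w)) / r ^ 2 - (p.1 - 1 / 2 * ∑ j, κ j * p.2 j ^ 2)
      = -(φ (r • w) - 1 / 2 * (r * (r * ∑ j, κ j * p.2 j ^ 2))) / r ^ 2 := by
    field_simp; ring
  rw [e1, abs_div, abs_neg, abs_of_nonneg (sq_nonneg r), div_lt_iff₀ (by positivity)]
  refine hr.trans_lt ?_
  have e2 : ‖w‖ ^ 2 < ‖w‖ ^ 2 + 1 := by linarith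
  calc ε / (‖w‖ ^ 2 + 1) * (r ^ 2 * ‖w‖ ^ 2) = ε * r ^ 2 * (‖w‖ ^ 2 / (‖w‖ ^ 2 + 1)) := by ring
    _ < ε * r ^ 2 * 1 := by
      gcongr
      rw [div_lt_one (by positivity)]; exact e2
    _ = ε * r ^ 2 := mul_one _

end QuadraticForm

/-- The majorant in the dominated convergence argument. -/
theorem integrable_exp_parabolic {n : ℕ} {c : ℝ} (hc : 0 < c) :
    Integrable fun p : ℝ × (Fin n → ℝ) =>
      Real.exp (-c * p.1 ^ 2) * Real.exp (-(2 * c) * ∑ j, p.2 j ^ 2) := by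
  have h1 := integrable_exp_neg_mul_sq hc
  have h2 : Integrable fun η : Fin n → ℝ => Real.exp (-(2 * c) * ∑ j, η j ^ 2) := by
    have hi : ∀ _ : Fin n, Integrable fun x : ℝ => Real.exp (-(2 * c) * x ^ 2) := fun _ =>
      integrable_exp_neg_mul_sq (by positivity)
    have h := Integrable.fintype_prod hi
    refine h.congr (Eventually.of_forall fun η => ?_)
    simp only [Finset.mul_sum, Real.exp_sum]
  exact h1.mul_prod h2

/-! ### Limits of the rescaled integrals -/

section Asymptotics

variable {n : ℕ} {l m : ℝ} {Ω : Set (RN (n + 1))} {v : RN (n + 1) × ℝ → ℝ} {z ν : RN (n + 1)}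
  {φ : (Submodule.span ℝ {ν})ᗮ → ℝ} {b : OrthonormalBasis (Fin n) ℝ (Submodule.span ℝ {ν})ᗮ}
  {κ : Fin n → ℝ} {R : ℝ}

/-- The limit of the rescaled integrands in the parabolic coordinates `(s, η)` at the touching
point: the profile, restricted to the limit of the rescaled balls. -/
noncomputable def limitIntegrand (l R q : ℝ) (κ : Fin n → ℝ) (p : ℝ × (Fin n → ℝ)) : ℝ :=
  {p : ℝ × (Fin n → ℝ) | ∑ j, p.2 j ^ 2 < 2 * R * p.1}.indicator
    (fun p => Erfc ((p.1 - 1 / 2 * ∑ j, κ j * p.2 j ^ 2) / (2 * Real.sqrt l)) ^ q) p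

theorem ball_subset_of_touch (hR : 0 < R) (htouch : Metric.closedBall (z + R • ν) R ∩ Ωᶜ = {z})
    (hν : ‖ν‖ = 1) : Metric.ball (z + R • ν) R ⊆ Ω := by
  intro y hy
  by_contra hn
  have h1 : y ∈ Metric.closedBall (z + R • ν) R ∩ Ωᶜ := ⟨Metric.ball_subset_closedBall hy, hn⟩
  rw [htouch, mem_singleton_iff] at h1
  rw [h1, mem_ball_iff_norm] at hy
  simp [norm_smul, hν, abs_of_pos hR] at hy

theorem IsBoundedSolution.continuousOn_slice (hv : IsBoundedSolution (pucciMinus l m) Ω v) {t : ℝ}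
    (ht : 0 < t) : ContinuousOn (fun y => v (y, t)) (closure Ω) :=
  hv.continuousOn.comp (by fun_prop) fun _ hy => ⟨⟨hy, ht.le⟩, fun h => ht.ne' h.2⟩

/-- The part of the defining integral of the mean where `v` exceeds a level `μ(t) → 0`
concentrates at the touching point. With `r = t^(1/4)` the volume element contributes `r^(n+2)`; the
integrand converges by the boundary layer, and is dominated because points of the ball have distance
at least `c (s + |η|²) √t` to the boundary, where `v` is Gaussian small. -/
theorem IsBoundedSolution.tendsto_integral_pos_part
    (hv : IsBoundedSolution (pucciMinus l m) Ω v) (hl : 0 < l)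
    (hm : 0 < m) (hΩ : IsC2Domain Ω) (h : IsC2GraphAt Ω z ν φ) (hφ : fderiv ℝ φ 0 = 0)
    (hκ : ∀ i j, fderiv ℝ (fderiv ℝ φ) 0 (b i) (b j) = if i = j then κ i else 0)
    (hz : z ∈ frontier Ω) (hR : 0 < R)
    (htouch : Metric.closedBall (z + R • ν) R ∩ Ωᶜ = {z}) (hκR : ∀ j, κ j < 1 / R) {q : ℝ}
    (hq : 0 < q) {μ : ℝ → ℝ} (hμ0 : ∀ t > 0, 0 ≤ μ t) (hμ : Tendsto μ (𝓝[>] 0) (𝓝 0)) :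
    Tendsto (fun t : ℝ => (Real.sqrt (Real.sqrt t) ^ (n + 2))⁻¹ *
        ∫ y in Metric.ball (z + R • ν) R, max (v (y, t) - μ t) 0 ^ q) (𝓝[>] 0)
      (𝓝 (∫ p, limitIntegrand l R q κ p)) := by
  have hΛ : 0 < max l m := lt_max_of_lt_left hl
  obtain ⟨k, hk, hφk⟩ := exists_lt_forall_fderiv_fderiv_le hκ hκR
  obtain ⟨c, hc, hball⟩ := h.exists_ball_subset hφ hΩ.1 hz hR htouch hk hφk
  have hBΩ := ball_subset_of_touch hR htouch h.norm_eq
  set Bl := Metric.ball (z + R • ν) R with hBl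
  set Y : ℝ → ℝ × (Fin n → ℝ) → RN (n + 1) := fun r p =>
    z + normalChart b (r ^ 2 * p.1, r • p.2) with hY
  have hmem : ∀ r p, 0 < r → (Y r p ∈ Bl ↔ r ^ 2 * p.1 ^ 2 + ∑ j, p.2 j ^ 2 < 2 * R * p.1) := by
    intro r p hr
    rw [hY, hBl, add_normalChart_mem_ball_iff b h.norm_eq hR]
    have : (r ^ 2 * p.1) ^ 2 + ∑ j, (r • p.2) j ^ 2
        = r ^ 2 * (r ^ 2 * p.1 ^ 2 + ∑ j, p.2 j ^ 2) := by
      simp only [Pi.smul_apply, smul_eq_mul, mul_pow, ← Finset.mul_sum]; ring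
    rw [this, show 2 * R * (r ^ 2 * p.1) = r ^ 2 * (2 * R * p.1) by ring,
      mul_lt_mul_iff_right₀ (by positivity)]
  set F : ℝ → RN (n + 1) → ℝ := fun t => Bl.indicator fun y => max (v (y, t) - μ t) 0 ^ q with hF
  set ρ : ℝ → ℝ := fun t => Real.sqrt (Real.sqrt t) with hρ
  have hρ0 : ∀ t > 0, 0 < ρ t := fun t ht => Real.sqrt_pos.2 (Real.sqrt_pos.2 ht)
  have hρ2 : ∀ t, ρ t ^ 2 = Real.sqrt t := fun t => Real.sq_sqrt (Real.sqrt_nonneg t)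
  have hρ4 : ∀ t > 0, ρ t ^ 4 = t := fun t ht => by
    rw [show ρ t ^ 4 = (ρ t ^ 2) ^ 2 by ring, hρ2, Real.sq_sqrt (le_of_lt ht)]
  have hρlim : Tendsto ρ (𝓝[>] 0) (𝓝[>] 0) := by
    rw [tendsto_nhdsWithin_iff]
    refine ⟨?_, eventually_nhdsWithin_of_forall fun t ht => hρ0 t ht⟩
    have : Continuous ρ := by simp only [hρ]; fun_prop
    simpa [hρ] using (this.tendsto 0).mono_left nhdsWithin_le_nhds
  have heq : ∀ t > 0, (ρ t ^ (n + 2))⁻¹ * ∫ y in Bl, max (v (y, t) - μ t) 0 ^ q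
      = ∫ p, F t (Y (ρ t) p) := by
    intro t ht
    rw [← integral_indicator Metric.isOpen_ball.measurableSet]
    exact integral_eq_integral_normalChart b h.norm_eq (hρ0 t ht) (F t)
  suffices hlim : Tendsto (fun t => ∫ p, F t (Y (ρ t) p)) (𝓝[>] 0)
      (𝓝 (∫ p, limitIntegrand l R q κ p)) by
    refine hlim.congr' ?_
    filter_upwards [self_mem_nhdsWithin] with t ht
    exact (heq t ht).symm
  set c' := q * (c ^ 2 / (16 * max l m)) with hc'
  have hc'0 : 0 < c' := by positivity
  refine tendsto_integral_filter_of_dominated_convergence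
    (fun p => Real.exp (q * ((n + 1 : ℕ) / 4) + c') *
      (Real.exp (-c' * p.1 ^ 2) * Real.exp (-(2 * c') * ∑ j, p.2 j ^ 2)))
    ?_ ?_ ((integrable_exp_parabolic hc'0).const_mul _) ?_
  · filter_upwards [self_mem_nhdsWithin] with t ht
    have hmF : Measurable (F t) := by
      have h1 : ContinuousOn (fun y => max (v (y, t) - μ t) 0 ^ q) Bl :=
        (((continuous_id.sub continuous_const).max continuous_const).rpow_const
          fun _ => Or.inr hq.le).comp_continuousOn
          ((hv.continuousOn_slice ht).mono (hBΩ.trans subset_closure))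
      classical
      simp only [hF]
      rw [← piecewise_eq_indicator]
      exact h1.measurable_piecewise continuousOn_const Metric.isOpen_ball.measurableSet
    have hYc : Continuous (Y (ρ t)) := by
      simp only [hY, normalChart]; fun_prop
    exact (hmF.comp hYc.measurable).aestronglyMeasurable
  · filter_upwards [self_mem_nhdsWithin] with t ht
    have ht' : (0 : ℝ) < t := ht
    refine Eventually.of_forall fun p => ?_
    by_cases hp : Y (ρ t) p ∈ Bl
    · simp only [hF, indicator_of_mem hp]
      have h2 := (hmem _ p (hρ0 t ht)).1 hp
      have hsum : 0 ≤ ∑ j, p.2 j ^ 2 := Finset.sum_nonneg fun j _ => sq_nonneg _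
      have hp1 : 0 < p.1 := by
        have : 0 < 2 * R * p.1 := lt_of_le_of_lt (by positivity) h2
        exact (mul_pos_iff_of_pos_left (by positivity)).1 this
      have h3 := hball _ hp
      have e1 : Y (ρ t) p - z = normalChart b (ρ t ^ 2 * p.1, ρ t • p.2) := by
        simp only [hY]; abel
      rw [e1, inner_normalChart b h.norm_eq, orthogonalProjectionOnto_normalChart,
        norm_sum_smul_sq] at h3
      simp only [Pi.smul_apply, smul_eq_mul, mul_pow, ← Finset.mul_sum, ← mul_add] at h3
      have hpos : 0 < p.1 + ∑ j, p.2 j ^ 2 := by positivity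
      have hr0 := hρ0 t ht
      have h4 := hv.le_exp hl hm hΩ (by positivity) h3 ht'
      have h5 : (c * (ρ t ^ 2 * (p.1 + ∑ j, p.2 j ^ 2))) ^ 2 / (16 * max l m * t)
          = c ^ 2 / (16 * max l m) * (p.1 + ∑ j, p.2 j ^ 2) ^ 2 := by
        have : t = (ρ t ^ 2) ^ 2 := by rw [← pow_mul]; exact (hρ4 t ht).symm
        rw [mul_pow, mul_pow, ← this]
        field_simp
      rw [h5] at h4
      have hΩm : (Y (ρ t) p, t) ∈ Ω ×ˢ Ioi (0 : ℝ) := ⟨hBΩ hp, ht⟩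
      have h6 : max (v (Y (ρ t) p, t) - μ t) 0 ≤ Real.exp (((n + 1 : ℕ) : ℝ) / 4
          - c ^ 2 / (16 * max l m) * (p.1 + ∑ j, p.2 j ^ 2) ^ 2) :=
        max_le (by linarith [hμ0 t ht]) (Real.exp_pos _).le
      rw [Real.norm_of_nonneg (by positivity)]
      refine (Real.rpow_le_rpow (le_max_right _ _) h6 hq.le).trans ?_
      rw [← Real.exp_mul, ← Real.exp_add, ← Real.exp_add, Real.exp_le_exp]
      have h7 : p.1 ^ 2 + (2 * ∑ j, p.2 j ^ 2 - 1) ≤ (p.1 + ∑ j, p.2 j ^ 2) ^ 2 := by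
        nlinarith [sq_nonneg (∑ j, p.2 j ^ 2 - 1), mul_nonneg hp1.le hsum]
      have h8 : c' * (p.1 ^ 2 + (2 * ∑ j, p.2 j ^ 2 - 1)) ≤ c' * (p.1 + ∑ j, p.2 j ^ 2) ^ 2 :=
        mul_le_mul_of_nonneg_left h7 hc'0.le
      have h9 : (((n + 1 : ℕ) : ℝ) / 4 - c ^ 2 / (16 * max l m) * (p.1 + ∑ j, p.2 j ^ 2) ^ 2) * q
          = q * (((n + 1 : ℕ) : ℝ) / 4) - c' * (p.1 + ∑ j, p.2 j ^ 2) ^ 2 := by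
        rw [hc']; ring
      rw [h9]
      linarith
    · simp only [hF, indicator_of_notMem hp, norm_zero]
      positivity
  · refine Eventually.of_forall fun p => ?_
    by_cases hp : ∑ j, p.2 j ^ 2 < 2 * R * p.1
    · have hev : ∀ᶠ t in 𝓝[>] 0, Y (ρ t) p ∈ Bl := by
        have h1 : ContinuousAt (fun r : ℝ => r ^ 2 * p.1 ^ 2 + ∑ j, p.2 j ^ 2) 0 := by fun_prop
        have h2 : ∀ᶠ r : ℝ in 𝓝[>] 0, r ^ 2 * p.1 ^ 2 + ∑ j, p.2 j ^ 2 < 2 * R * p.1 :=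
          nhdsWithin_le_nhds (h1.eventually_lt_const (by simpa using hp))
        filter_upwards [hρlim.eventually h2, self_mem_nhdsWithin] with t h3 ht
        exact (hmem _ p (hρ0 t ht)).2 h3
      have hYlim : Tendsto (fun t => Y (ρ t) p) (𝓝[>] 0) (𝓝 z) := by
        have h1 : ContinuousAt (fun r => Y r p) 0 := by
          simp only [hY, normalChart]; fun_prop
        have h2 : Y 0 p = z := by simp [hY, normalChart]
        have h3 := h1.tendsto
        rw [h2] at h3
        exact h3.comp (hρlim.mono_right nhdsWithin_le_nhds)
      have hglim := (tendsto_graphDefining_normalChart h hφ hκ p).comp hρlim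
      have hE := hv.tendsto_Erfc hl hm hΩ
        (fun ε hε => exists_isC2DefiningOn h.contDiffAt_graphDefining
          (h.norm_fderiv_graphDefining hφ) h.mem_iff_graphDefining
          h.mem_frontier_iff_graphDefining hε)
        (hev.mono fun t ht => hBΩ ht) hYlim
        (s := p.1 - 1 / 2 * ∑ j, κ j * p.2 j ^ 2) (hglim.congr fun t => by
          simp only [Function.comp_apply, hY, hρ2])
      have hpw := ((hE.sub hμ).max (tendsto_const_nhds (x := (0 : ℝ)))).rpow_const
        (p := q) (Or.inr hq.le)
      rw [sub_zero, max_eq_left (Erfc_pos _).le] at hpw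
      rw [limitIntegrand, indicator_of_mem (by exact hp)]
      refine hpw.congr' ?_
      filter_upwards [hev] with t ht
      simp only [hF, indicator_of_mem ht]
    · rw [limitIntegrand, indicator_of_notMem (by exact hp)]
      refine tendsto_const_nhds.congr' ?_
      filter_upwards [self_mem_nhdsWithin] with t ht
      have hn : Y (ρ t) p ∉ Bl := by
        rw [hmem _ p (hρ0 t ht)]
        push Not at hp ⊢
        have : 0 ≤ ρ t ^ 2 * p.1 ^ 2 := by positivity
        linarith
      simp only [hF, indicator_of_notMem hn]

/-- The part of the defining integral of the mean where `v` is below the level: in the interior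
`v` is smaller than any power of `t`, so that the whole ball contributes. -/
theorem IsBoundedSolution.tendsto_integral_neg_part
    (hv : IsBoundedSolution (pucciMinus l m) Ω v) (hl : 0 < l)
    (hm : 0 < m) (hΩ : IsC2Domain Ω) {x : RN (n + 1)} (hball : Metric.ball x R ⊆ Ω) {q a d : ℝ}
    (hq : 0 < q) (hd : 0 ≤ d) :
    Tendsto (fun t : ℝ => ∫ y in Metric.ball x R, max (d - t ^ (-a) * v (y, t)) 0 ^ q) (𝓝[>] 0)
      (𝓝 (d ^ q * (volume (Metric.ball x R)).toReal)) := by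
  have hΛ : 0 < max l m := lt_max_of_lt_left hl
  have hconst : ∫ _y in Metric.ball x R, d ^ q = d ^ q * (volume (Metric.ball x R)).toReal := by
    rw [setIntegral_const, smul_eq_mul, mul_comm]; rfl
  have hfin : IsFiniteMeasure (volume.restrict (Metric.ball x R)) :=
    ⟨by rw [Measure.restrict_apply_univ]; exact measure_ball_lt_top⟩
  rw [← hconst]
  refine tendsto_integral_filter_of_dominated_convergence (fun _ => d ^ q) ?_ ?_
    (integrable_const _) ?_
  · filter_upwards [self_mem_nhdsWithin] with t ht
    have h1 : ContinuousOn (fun y => max (d - t ^ (-a) * v (y, t)) 0 ^ q) (Metric.ball x R) :=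
      (((continuous_const.sub (continuous_const.mul continuous_id)).max
        continuous_const).rpow_const fun _ => Or.inr hq.le).comp_continuousOn
        ((hv.continuousOn_slice ht).mono (hball.trans subset_closure))
    exact h1.aestronglyMeasurable Metric.isOpen_ball.measurableSet
  · filter_upwards [self_mem_nhdsWithin] with t ht
    filter_upwards [ae_restrict_mem Metric.isOpen_ball.measurableSet] with y hy
    have ht' : (0 : ℝ) < t := ht
    have h1 : 0 ≤ t ^ (-a) * v (y, t) :=
      mul_nonneg (by positivity) (hv.nonneg hl hm hΩ (y, t) ⟨hball hy, ht⟩)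
    rw [Real.norm_of_nonneg (by positivity)]
    exact Real.rpow_le_rpow (le_max_right _ _) (max_le (by linarith) hd) hq.le
  · filter_upwards [ae_restrict_mem Metric.isOpen_ball.measurableSet] with y hy
    obtain ⟨r, hr, hry⟩ := Metric.isOpen_iff.1 Metric.isOpen_ball y hy
    have h0 : Tendsto (fun t : ℝ => t ^ (-a) * v (y, t)) (𝓝[>] 0) (𝓝 0) := by
      have h1 : Tendsto (fun t : ℝ => Real.exp ((n + 1 : ℕ) / 4) *
          ((t⁻¹) ^ a * Real.exp (-(r ^ 2 / (16 * max l m)) * t⁻¹))) (𝓝[>] 0) (𝓝 0) := by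
        have := ((tendsto_rpow_mul_exp_neg_mul_atTop_nhds_zero a (r ^ 2 / (16 * max l m))
          (by positivity)).comp tendsto_inv_nhdsGT_zero).const_mul (Real.exp ((n + 1 : ℕ) / 4))
        simpa using this
      refine tendsto_of_tendsto_of_tendsto_of_le_of_le' tendsto_const_nhds h1 ?_ ?_
      · filter_upwards [self_mem_nhdsWithin] with t ht
        have ht' : (0 : ℝ) < t := ht
        exact mul_nonneg (by positivity) (hv.nonneg hl hm hΩ (y, t) ⟨hball hy, ht⟩)
      · filter_upwards [self_mem_nhdsWithin] with t ht
        have ht' : (0 : ℝ) < t := ht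
        have h2 := hv.le_exp hl hm hΩ hr (hry.trans hball) ht'
        have h3 : t ^ (-a) = (t⁻¹) ^ a := by rw [Real.rpow_neg ht'.le, Real.inv_rpow ht'.le]
        have h4 : Real.exp ((n + 1 : ℕ) / 4) * Real.exp (-(r ^ 2 / (16 * max l m)) * t⁻¹)
            = Real.exp ((n + 1 : ℕ) / 4 - r ^ 2 / (16 * max l m * t)) := by
          rw [← Real.exp_add]; congr 1; field_simp; ring
        rw [h3, mul_left_comm, h4]
        exact mul_le_mul_of_nonneg_left h2 (by positivity)
    have h5 := ((h0.const_sub d).max (tendsto_const_nhds (x := (0 : ℝ)))).rpow_const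
      (p := q) (Or.inr hq.le)
    rwa [sub_zero, max_eq_left hd] at h5

end Asymptotics

/-! ### The value of the limit integral -/

section LimitIntegral

/-- Nonemptiness of the index type is needed at `r ≤ 0`, where the right side is `0 ^ n`. -/
theorem volume_ellipsoid {n : ℕ} [Nonempty (Fin n)] {a : Fin n → ℝ} (ha : ∀ j, 0 < a j) (r : ℝ) :
    volume {η : Fin n → ℝ | ∑ j, a j * η j ^ 2 < r}
      = ENNReal.ofReal ((∏ j, √(a j))⁻¹ * √Real.pi ^ n / Real.Gamma (n / 2 + 1) * √r ^ n) := by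
  have hG : 0 < Real.Gamma ((n : ℝ) / 2 + 1) := Real.Gamma_pos_of_pos (by positivity)
  have hn : n ≠ 0 := (Fin.pos_iff_nonempty.2 ‹_›).ne'
  rcases le_or_gt r 0 with hr | hr
  · have : {η : Fin n → ℝ | ∑ j, a j * η j ^ 2 < r} = ∅ := by
      ext η
      simp only [mem_ofPred_eq, mem_empty_iff_false, iff_false, not_lt]
      exact hr.trans (Finset.sum_nonneg fun j _ => mul_nonneg (ha j).le (sq_nonneg _))
    rw [this, Real.sqrt_eq_zero_of_nonpos hr, zero_pow hn]
    simp
  set D : (Fin n → ℝ) →ₗ[ℝ] (Fin n → ℝ) := Matrix.toLin' (Matrix.diagonal fun j => √(a j)) with hD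
  have hdet : LinearMap.det D = ∏ j, √(a j) := by
    rw [hD, LinearMap.det_toLin', Matrix.det_diagonal]
  have hprod : 0 < ∏ j, √(a j) := Finset.prod_pos fun j _ => Real.sqrt_pos.2 (ha j)
  have hset : {η : Fin n → ℝ | ∑ j, a j * η j ^ 2 < r}
      = D ⁻¹' ((WithLp.toLp 2 : (Fin n → ℝ) → EuclideanSpace ℝ (Fin n)) ⁻¹' Metric.ball 0 √r) := by
    ext η
    simp only [mem_ofPred_eq, mem_preimage, mem_ball_zero_iff]
    rw [← sq_lt_sq₀ (norm_nonneg _) (Real.sqrt_nonneg _), EuclideanSpace.real_norm_sq_eq,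
      Real.sq_sqrt hr.le]
    simp [hD, Matrix.mulVec_diagonal, mul_pow, Real.sq_sqrt (ha _).le]
  rw [hset, Measure.addHaar_preimage_linearMap _ (by rw [hdet]; exact hprod.ne'), hdet,
    (PiLp.volume_preserving_toLp (Fin n)).measure_preimage
      Metric.isOpen_ball.measurableSet.nullMeasurableSet, EuclideanSpace.volume_ball,
    Fintype.card_fin, ← ENNReal.ofReal_pow (Real.sqrt_nonneg _),
    ← ENNReal.ofReal_mul (by positivity), ← ENNReal.ofReal_mul (by positivity),
    abs_of_pos (by positivity)]
  congr 1
  ring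

theorem measurable_limitIntegrand {n : ℕ} (l R q : ℝ) (κ : Fin n → ℝ) :
    Measurable (limitIntegrand l R q κ) := by
  unfold limitIntegrand
  refine Measurable.indicator ?_ ?_
  · exact (continuous_Erfc.comp (by fun_prop)).measurable.pow_const q
  · exact measurableSet_lt (by fun_prop) (by fun_prop)

theorem limitIntegrand_nonneg {n : ℕ} (l R q : ℝ) (κ : Fin n → ℝ) (p : ℝ × (Fin n → ℝ)) :
    0 ≤ limitIntegrand l R q κ p :=
  indicator_nonneg (fun _ _ => Real.rpow_nonneg (Erfc_pos _).le _) _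

/-- Shearing `s` by `½ ∑ κ_j η_j²` turns the region of integration into the family of ellipsoids
`∑ (1/R - κ_j) η_j² < 2s`, and Tonelli's theorem integrates over these first. -/
theorem integral_limitIntegrand {n : ℕ} [Nonempty (Fin n)] {l R q : ℝ} {κ : Fin n → ℝ} (hl : 0 < l)
    (hR : 0 < R) (hκR : ∀ j, κ j < 1 / R) :
    ∫ p, limitIntegrand l R q κ p
      = (∏ j, √(1 / R - κ j))⁻¹ * √Real.pi ^ n / Real.Gamma (n / 2 + 1) * (2 * √l)
        * √(4 * √l) ^ n * ∫ σ in Ioi (0 : ℝ), Erfc σ ^ q * σ ^ ((n : ℝ) / 2) := by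
  have hn : n ≠ 0 := (Fin.pos_iff_nonempty.2 ‹_›).ne'
  have hl' : 0 < √l := Real.sqrt_pos.2 hl
  have hG : 0 < Real.Gamma ((n : ℝ) / 2 + 1) := Real.Gamma_pos_of_pos (by positivity)
  set K := (∏ j, √(1 / R - κ j))⁻¹ * √Real.pi ^ n / Real.Gamma (n / 2 + 1) with hK
  have hK0 : 0 ≤ K := by
    have : 0 ≤ ∏ j, √(1 / R - κ j) := Finset.prod_nonneg fun j _ => Real.sqrt_nonneg _
    positivity
  have hmeas := measurable_limitIntegrand l R q κ
  have hE : Measurable fun s : ℝ => ENNReal.ofReal (Erfc (s / (2 * √l)) ^ q) :=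
    ((continuous_Erfc.comp (by fun_prop)).measurable.pow_const q).ennreal_ofReal
  have hA : MeasurableSet {p : ℝ × (Fin n → ℝ) | ∑ j, (1 / R - κ j) * p.2 j ^ 2 < 2 * p.1} :=
    measurableSet_lt (by fun_prop) (by fun_prop)
  have hshear : ∀ η : Fin n → ℝ, ∫⁻ s, ENNReal.ofReal (limitIntegrand l R q κ (s, η))
      = ∫⁻ s, {p : ℝ × (Fin n → ℝ) | ∑ j, (1 / R - κ j) * p.2 j ^ 2 < 2 * p.1}.indicator
          (fun p => ENNReal.ofReal (Erfc (p.1 / (2 * √l)) ^ q)) (s, η) := by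
    intro η
    rw [← lintegral_add_right_eq_self _ (1 / 2 * ∑ j, κ j * η j ^ 2)]
    refine lintegral_congr fun s => ?_
    have hiff : ∑ j, η j ^ 2 < 2 * R * (s + 1 / 2 * ∑ j, κ j * η j ^ 2)
        ↔ ∑ j, (1 / R - κ j) * η j ^ 2 < 2 * s := by
      simp only [sub_mul, Finset.sum_sub_distrib, ← Finset.mul_sum]
      rw [← mul_lt_mul_iff_right₀ hR (c := 2 * s)]
      have : R * (1 / R * ∑ j, η j ^ 2 - ∑ j, κ j * η j ^ 2)
          = ∑ j, η j ^ 2 - R * ∑ j, κ j * η j ^ 2 := by field_simp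
      rw [this]
      constructor <;> intro h <;> linarith
    unfold limitIntegrand
    by_cases h : ∑ j, (1 / R - κ j) * η j ^ 2 < 2 * s
    · rw [indicator_of_mem (by simpa using hiff.2 h), indicator_of_mem (by simpa using h)]
      simp
    · rw [indicator_of_notMem (by simpa only [mem_ofPred_eq] using fun h' => h (hiff.1 h')),
        indicator_of_notMem (by simpa only [mem_ofPred_eq] using h), ENNReal.ofReal_zero]
  have hinner : ∀ s : ℝ, ∫⁻ η : Fin n → ℝ,
      {p : ℝ × (Fin n → ℝ) | ∑ j, (1 / R - κ j) * p.2 j ^ 2 < 2 * p.1}.indicator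
          (fun p => ENNReal.ofReal (Erfc (p.1 / (2 * √l)) ^ q)) (s, η)
      = ENNReal.ofReal (Erfc (s / (2 * √l)) ^ q * (K * √(2 * s) ^ n)) := by
    intro s
    have : ∀ η : Fin n → ℝ,
        {p : ℝ × (Fin n → ℝ) | ∑ j, (1 / R - κ j) * p.2 j ^ 2 < 2 * p.1}.indicator
          (fun p => ENNReal.ofReal (Erfc (p.1 / (2 * √l)) ^ q)) (s, η)
        = {η : Fin n → ℝ | ∑ j, (1 / R - κ j) * η j ^ 2 < 2 * s}.indicator
          (fun _ => ENNReal.ofReal (Erfc (s / (2 * √l)) ^ q)) η := fun η => rfl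
    simp_rw [this]
    rw [lintegral_indicator_const (measurableSet_lt (by fun_prop) (by fun_prop)),
      volume_ellipsoid (fun j => sub_pos.2 (hκR j)),
      ← ENNReal.ofReal_mul (Real.rpow_nonneg (Erfc_pos _).le _)]
  have hJ : ∫ p, limitIntegrand l R q κ p
      = ∫ s, Erfc (s / (2 * √l)) ^ q * (K * √(2 * s) ^ n) := by
    rw [integral_eq_lintegral_of_nonneg_ae (ae_of_all _ (limitIntegrand_nonneg l R q κ))
      hmeas.aestronglyMeasurable, integral_eq_lintegral_of_nonneg_ae
      (ae_of_all _ fun s => mul_nonneg (Real.rpow_nonneg (Erfc_pos _).le _) (by positivity))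
      (((continuous_Erfc.comp (by fun_prop)).measurable.pow_const q).mul
        (by fun_prop)).aestronglyMeasurable]
    congr 1
    rw [Measure.volume_eq_prod, lintegral_prod_symm _ hmeas.ennreal_ofReal.aemeasurable]
    simp_rw [hshear]
    rw [lintegral_lintegral_swap]
    · simp_rw [hinner]
    · have := (hE.comp measurable_fst).indicator hA
      exact (this.comp measurable_swap).aemeasurable
  rw [hJ]
  have hsub := Measure.integral_comp_mul_left
    (fun s => Erfc (s / (2 * √l)) ^ q * (K * √(2 * s) ^ n)) (2 * √l)
  rw [abs_of_pos (by positivity), smul_eq_mul, eq_inv_mul_iff_mul_eq₀ (by positivity)] at hsub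
  rw [← hsub, ← integral_const_mul, ← integral_const_mul]
  -- For `σ ≤ 0` the ellipsoids are empty, so that the integrand vanishes.
  rw [← setIntegral_eq_integral_of_forall_compl_eq_zero (s := Ioi (0 : ℝ))]
  · refine setIntegral_congr_fun measurableSet_Ioi fun σ hσ => ?_
    have h1 : 2 * √l * σ / (2 * √l) = σ := by field_simp
    have h2 : √(2 * (2 * √l * σ)) ^ n = √(4 * √l) ^ n * σ ^ ((n : ℝ) / 2) := by
      rw [show 2 * (2 * √l * σ) = 4 * √l * σ by ring, Real.sqrt_mul (by positivity), mul_pow,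
        Real.sqrt_eq_rpow σ, ← Real.rpow_mul_natCast (mem_Ioi.1 hσ).le]
      congr 2
      ring
    simp only [h1, h2]
    ring
  · intro σ hσ
    rw [mem_Ioi, not_lt] at hσ
    rw [Real.sqrt_eq_zero_of_nonpos (show 2 * (2 * √l * σ) ≤ 0 by nlinarith), zero_pow hn]
    ring

end LimitIntegral

/-! ### Existence and characterization of means -/

section SignedPower

/-- The odd extension `sign(x) |x|^q` of the power function; the derivative of `|x|^e` is
`e * signedPow (e - 1) x`. -/
noncomputable def signedPow (q x : ℝ) : ℝ := max x 0 ^ q - max (-x) 0 ^ q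

theorem continuous_signedPow {q : ℝ} (hq : 0 < q) : Continuous (signedPow q) := by
  unfold signedPow
  refine Continuous.sub ?_ ?_
  · exact (by fun_prop : Continuous fun x : ℝ => max x 0).rpow_const fun _ => Or.inr hq.le
  · exact (by fun_prop : Continuous fun x : ℝ => max (-x) 0).rpow_const fun _ => Or.inr hq.le

theorem signedPow_of_nonneg {q x : ℝ} (hq : 0 < q) (hx : 0 ≤ x) : signedPow q x = x ^ q := by
  rw [signedPow, max_eq_left hx, max_eq_right (by linarith), Real.zero_rpow hq.ne', sub_zero]

theorem signedPow_of_nonpos {q x : ℝ} (hq : 0 < q) (hx : x ≤ 0) :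
    signedPow q x = -(-x) ^ q := by
  rw [signedPow, max_eq_right hx, max_eq_left (by linarith), Real.zero_rpow hq.ne', zero_sub]

theorem strictMono_signedPow {q : ℝ} (hq : 0 < q) : StrictMono (signedPow q) := by
  intro x y hxy
  rcases le_or_gt 0 x with hx | hx
  · rw [signedPow_of_nonneg hq hx, signedPow_of_nonneg hq (hx.trans hxy.le)]
    exact Real.rpow_lt_rpow hx hxy hq
  rcases le_or_gt y 0 with hy | hy
  · rw [signedPow_of_nonpos hq hx.le, signedPow_of_nonpos hq hy, neg_lt_neg_iff]
    exact Real.rpow_lt_rpow (by linarith) (by linarith) hq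
  · rw [signedPow_of_nonpos hq hx.le, signedPow_of_nonneg hq hy.le]
    have h1 := Real.rpow_pos_of_pos (neg_pos.2 hx) q
    have h2 := Real.rpow_pos_of_pos hy q
    linarith

theorem abs_signedPow {q : ℝ} (hq : 0 < q) (x : ℝ) : |signedPow q x| = |x| ^ q := by
  rcases le_total 0 x with hx | hx
  · rw [signedPow_of_nonneg hq hx, abs_of_nonneg hx, abs_of_nonneg (Real.rpow_nonneg hx q)]
  · rw [signedPow_of_nonpos hq hx, abs_of_nonpos hx, abs_neg,
      abs_of_nonneg (Real.rpow_nonneg (by linarith) q)]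

theorem hasDerivAt_abs_rpow_signedPow {e : ℝ} (he : 1 < e) (x : ℝ) :
    HasDerivAt (fun x : ℝ => |x| ^ e) (e * signedPow (e - 1) x) x := by
  convert hasDerivAt_abs_rpow x he using 1
  rw [mul_assoc]
  congr 1
  rcases lt_trichotomy x 0 with hx | rfl | hx
  · rw [signedPow_of_nonpos (by linarith) hx.le, abs_of_neg hx,
      show e - 1 = e - 2 + 1 by ring, Real.rpow_add_one (by linarith)]
    ring
  · simp [signedPow]
  · rw [signedPow_of_nonneg (by linarith) hx.le, abs_of_pos hx,
      show e - 1 = e - 2 + 1 by ring, Real.rpow_add_one hx.ne']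

/-- Strict convexity of `|·|^e`, as a tangent inequality. -/
theorem abs_rpow_add_lt_abs_rpow {e x y : ℝ} (he : 1 < e) (hxy : x ≠ y) :
    |x| ^ e + e * signedPow (e - 1) x * (y - x) < |y| ^ e := by
  have hmono := strictMono_signedPow (sub_pos.2 he)
  have hcont : Continuous fun x : ℝ => |x| ^ e :=
    continuous_iff_continuousAt.2 fun x => (hasDerivAt_abs_rpow_signedPow he x).continuousAt
  have he0 : 0 < e := by linarith
  rcases hxy.lt_or_gt with h | h
  · obtain ⟨c, hc, hc'⟩ := exists_hasDerivAt_eq_slope _ _ h hcont.continuousOn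
      fun x _ => hasDerivAt_abs_rpow_signedPow he x
    rw [eq_div_iff (by linarith)] at hc'
    have := mul_lt_mul_of_pos_right (mul_lt_mul_of_pos_left (hmono hc.1) he0) (sub_pos.2 h)
    linarith
  · obtain ⟨c, hc, hc'⟩ := exists_hasDerivAt_eq_slope _ _ h hcont.continuousOn
      fun x _ => hasDerivAt_abs_rpow_signedPow he x
    rw [eq_div_iff (by linarith)] at hc'
    have := mul_lt_mul_of_pos_right (mul_lt_mul_of_pos_left (hmono hc.2) he0) (sub_pos.2 h)
    linarith

end SignedPower

section QMean

variable {α : Type*} [MeasurableSpace α] {μ : Measure α} {u : α → ℝ}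

theorem integrable_signedPow_sub [IsFiniteMeasure μ] {q : ℝ} (hq : 0 < q)
    (hu : AEStronglyMeasurable u μ)
    (h01 : ∀ᵐ y ∂μ, u y ∈ Icc (0 : ℝ) 1) (c : ℝ) :
    Integrable (fun y => signedPow q (u y - c)) μ := by
  refine Integrable.of_bound
    ((continuous_signedPow hq).comp_aestronglyMeasurable (hu.sub aestronglyMeasurable_const))
    ((1 + |c|) ^ q) ?_
  filter_upwards [h01] with y hy
  rw [Real.norm_eq_abs, abs_signedPow hq]
  refine Real.rpow_le_rpow (abs_nonneg _) ((abs_sub _ _).trans ?_) hq.le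
  rw [abs_of_nonneg hy.1]
  linarith [hy.2]

theorem integral_pos_of_ae_pos [NeZero μ] {f : α → ℝ} (hf : Integrable f μ)
    (hpos : ∀ᵐ y ∂μ, 0 < f y) : 0 < ∫ y, f y ∂μ := by
  rw [integral_pos_iff_support_of_nonneg_ae (hpos.mono fun y hy => hy.le) hf,
    measure_congr (s := Function.support f) (t := univ)
      (eventuallyEq_univ.2 (hpos.mono fun y hy => hy.ne'))]
  exact Measure.measure_univ_pos.2 (NeZero.ne μ)

/-- The `e`-mean is the zero of the decreasing function `c ↦ ∫ sign(u - c) |u - c|^(e-1)`, hence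
the sign of that function at `c` tells on which side of `c` the mean lies. -/
theorem exists_eLpNorm_sub_lt [IsFiniteMeasure μ] [NeZero μ] {e : ℝ} (he : 1 < e)
    (hu : AEStronglyMeasurable u μ)
    (h01 : ∀ᵐ y ∂μ, u y ∈ Icc (0 : ℝ) 1) :
    ∃ m : ℝ, (∀ c, c ≠ m → eLpNorm (fun y => u y - m) (ENNReal.ofReal e) μ
        < eLpNorm (fun y => u y - c) (ENNReal.ofReal e) μ) ∧
      (∀ c, 0 < ∫ y, signedPow (e - 1) (u y - c) ∂μ → c < m) ∧
      ∀ c, ∫ y, signedPow (e - 1) (u y - c) ∂μ < 0 → m < c := by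
  have hq : 0 < e - 1 := sub_pos.2 he
  have he0 : 0 < e := by linarith
  have hint := integrable_signedPow_sub hq hu h01
  have hanti : Antitone fun c => ∫ y, signedPow (e - 1) (u y - c) ∂μ := fun c d hcd =>
    integral_mono (hint d) (hint c) fun y =>
      (strictMono_signedPow hq).monotone (by linarith : u y - d ≤ u y - c)
  obtain ⟨m, -, hm⟩ : ∃ m ∈ Icc (0 : ℝ) 1, ∫ y, signedPow (e - 1) (u y - m) ∂μ = 0 := by
    refine intermediate_value_Icc' zero_le_one (f := fun c => ∫ y, signedPow (e - 1) (u y - c) ∂μ)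
      ?_ ⟨?_, ?_⟩
    · refine continuousOn_of_dominated (bound := fun _ => 1)
        (fun c _ => (hint c).aestronglyMeasurable) (fun c hc => ?_) (integrable_const _)
        (ae_of_all _ fun y =>
          ((continuous_signedPow hq).comp (continuous_const.sub continuous_id)).continuousOn)
      filter_upwards [h01] with y hy
      rw [Real.norm_eq_abs, abs_signedPow hq]
      refine Real.rpow_le_one (abs_nonneg _) (abs_le.2 ⟨?_, ?_⟩) hq.le <;>
        linarith [hy.1, hy.2, hc.1, hc.2]
    · refine integral_nonpos_of_ae ?_
      filter_upwards [h01] with y hy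
      rw [signedPow_of_nonpos hq (by linarith [hy.2])]
      exact neg_nonpos.2 (Real.rpow_nonneg (by linarith [hy.2]) _)
    · refine integral_nonneg_of_ae ?_
      filter_upwards [h01] with y hy
      rw [signedPow_of_nonneg hq (by linarith [hy.1])]
      exact Real.rpow_nonneg (by linarith [hy.1]) _
  refine ⟨m, fun c hc => ?_, fun c hc => ?_, fun c hc => ?_⟩
  · have hmem : ∀ c : ℝ, MemLp (fun y => u y - c) (ENNReal.ofReal e) μ := fun c => by
      refine MemLp.of_bound (hu.sub aestronglyMeasurable_const) (1 + |c|) ?_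
      filter_upwards [h01] with y hy
      rw [Real.norm_eq_abs]
      refine (abs_sub _ _).trans ?_
      rw [abs_of_nonneg hy.1]
      linarith [hy.2]
    have hp0 : ENNReal.ofReal e ≠ 0 := (ENNReal.ofReal_pos.2 he0).ne'
    have hI : ∀ c : ℝ, Integrable (fun y => |u y - c| ^ e) μ := fun c => by
      simpa [ENNReal.toReal_ofReal he0.le] using (hmem c).integrable_norm_rpow hp0
        ENNReal.ofReal_ne_top
    have hlt : ∫ y, |u y - m| ^ e ∂μ < ∫ y, |u y - c| ^ e ∂μ := by
      have hIψ := ((hint m).const_mul e).mul_const (m - c)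
      have h := integral_pos_of_ae_pos (((hI c).sub (hI m)).sub hIψ) <| ae_of_all _ fun y => by
        have := abs_rpow_add_lt_abs_rpow (x := u y - m) (y := u y - c) he
          fun h => hc (by linarith)
        simp only [Pi.sub_apply]
        rw [show u y - c - (u y - m) = m - c by ring] at this
        linarith
      have h2 : ∫ y, (((fun y => |u y - c| ^ e) - fun y => |u y - m| ^ e)
          - fun y => e * signedPow (e - 1) (u y - m) * (m - c)) y ∂μ
          = ∫ y, |u y - c| ^ e ∂μ - ∫ y, |u y - m| ^ e ∂μ
            - e * (∫ y, signedPow (e - 1) (u y - m) ∂μ) * (m - c) := by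
        rw [integral_sub' ((hI c).sub (hI m)) hIψ, integral_sub' (hI c) (hI m), integral_mul_const,
          integral_const_mul]
      rw [h2, hm] at h
      linarith
    rw [(hmem m).eLpNorm_eq_integral_rpow_norm hp0 ENNReal.ofReal_ne_top,
      (hmem c).eLpNorm_eq_integral_rpow_norm hp0 ENNReal.ofReal_ne_top]
    simp only [Real.norm_eq_abs, ENNReal.toReal_ofReal he0.le]
    have h0 : 0 ≤ ∫ y, |u y - m| ^ e ∂μ :=
      integral_nonneg fun y => Real.rpow_nonneg (abs_nonneg _) _
    exact (ENNReal.ofReal_lt_ofReal_iff (Real.rpow_pos_of_pos (h0.trans_lt hlt) _)).2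
      (Real.rpow_lt_rpow h0 hlt (by positivity))
  · by_contra! h
    have := hanti h
    simp only [hm] at this
    exact this.not_gt hc
  · by_contra! h
    have := hanti h
    simp only [hm] at this
    exact this.not_gt hc

end QMean

section SupMean

variable {N : ℕ} {B : Set (RN N)} {g : RN N → ℝ}

theorem enorm_le_eLpNorm_top_of_continuousOn (hB : IsOpen B) (hg : ContinuousOn g B) {y : RN N}
    (hy : y ∈ B) : ‖g y‖ₑ ≤ eLpNorm g ⊤ (volume.restrict B) := by
  by_contra! h
  have h1 : ∀ᵐ x ∂volume.restrict B, ‖g x‖ₑ ≤ eLpNorm g ⊤ (volume.restrict B) := by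
    rw [eLpNorm_exponent_top]
    exact ae_le_eLpNormEssSup
  have h2 : {x | eLpNorm g ⊤ (volume.restrict B) < ‖g x‖ₑ} ∩ B ∈ 𝓝 y :=
    inter_mem ((hg.continuousAt (hB.mem_nhds hy)).enorm.eventually (lt_mem_nhds h))
      (hB.mem_nhds hy)
  have h3 := (ae_restrict_iff' hB.measurableSet).1 h1
  refine (Measure.measure_pos_of_mem_nhds volume h2).ne'
    (measure_mono_null (fun x hx => ?_) (ae_iff.1 h3))
  exact fun h => (h hx.2).not_gt hx.1

/-- The mean for the sup norm is the midpoint between the infimum `I` and the supremum `S`. -/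
theorem isQMean_top {u : RN N → ℝ} {I S : ℝ} (hB : IsOpen B) (hu : ContinuousOn u B)
    (hIS : ∀ y ∈ B, u y ∈ Icc I S) (hI : ∀ a, I < a → ∃ y ∈ B, u y < a)
    (hS : ∀ a, a < S → ∃ y ∈ B, a < u y) : IsQMean ⊤ B u ((I + S) / 2) := by
  intro c hc
  have h1 : eLpNorm (fun y => u y - (I + S) / 2) ⊤ (volume.restrict B)
      ≤ ENNReal.ofReal ((S - I) / 2) := by
    rw [eLpNorm_exponent_top]
    refine eLpNormEssSup_le_of_ae_bound ((ae_restrict_iff' hB.measurableSet).2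
      (ae_of_all _ fun y hy => ?_))
    have := hIS y hy
    rw [Real.norm_eq_abs, abs_le]
    constructor <;> linarith [this.1, this.2]
  refine h1.trans_lt ?_
  suffices h : ∃ y ∈ B, (S - I) / 2 < |u y - c| by
    obtain ⟨y, hy, hlt⟩ := h
    refine lt_of_lt_of_le ?_ (enorm_le_eLpNorm_top_of_continuousOn
      (g := fun y => u y - c) hB (hu.sub continuousOn_const) hy)
    have hIS' := hIS y hy
    rw [Real.enorm_eq_ofReal_abs]
    exact (ENNReal.ofReal_lt_ofReal_iff (lt_of_le_of_lt (by linarith [hIS'.1, hIS'.2]) hlt)).2 hlt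
  rcases hc.lt_or_gt with h | h
  · obtain ⟨y, hy, hlt⟩ := hS (c + (S - I) / 2) (by linarith)
    exact ⟨y, hy, lt_of_lt_of_le (by linarith) (le_abs_self _)⟩
  · obtain ⟨y, hy, hlt⟩ := hI (c - (S - I) / 2) (by linarith)
    exact ⟨y, hy, lt_of_lt_of_le (by linarith) (neg_le_abs _)⟩

end SupMean

/-! ### Asymptotics of the means -/

section Constants

/-- Legendre's duplication formula at `n / 2 + 1`. -/
theorem factorial_succ_eq_Gamma_mul (n : ℕ) :
    ((n + 1).factorial : ℝ) * √Real.pi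
      = 2 ^ (n + 1) * Real.Gamma (n / 2 + 1) * Real.Gamma ((n + 1 : ℕ) / 2 + 1) := by
  have h := Real.Gamma_mul_Gamma_add_half ((n : ℝ) / 2 + 1)
  rw [show (n : ℝ) / 2 + 1 + 1 / 2 = ((n + 1 : ℕ) : ℝ) / 2 + 1 by push_cast; ring,
    show 2 * ((n : ℝ) / 2 + 1) = ((n + 1 : ℕ) : ℝ) + 1 by push_cast; ring,
    Real.Gamma_nat_eq_factorial,
    show (1 : ℝ) - (((n + 1 : ℕ) : ℝ) + 1) = -((n + 1 : ℕ) : ℝ) by ring, Real.rpow_neg two_pos.le,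
    Real.rpow_natCast] at h
  rw [mul_assoc, h]
  field_simp

/-- The ratio of the limit integral to the volume of the ball is the constant in the asymptotic
formula. -/
theorem rpow_mul_ratio_eq_qMeanConst {n : ℕ} {e l R : ℝ} {κ : Fin n → ℝ} (he : 1 < e) (hl : 0 < l)
    (hR : 0 < R) (hκR : ∀ j, κ j < 1 / R) [Nonempty (Fin n)] (x : RN (n + 1)) :
    (R ^ 2) ^ ((((n + 1 : ℕ) : ℝ) + 1) / (4 * (e - 1))) *
        ((∫ p, limitIntegrand l R (e - 1) κ p) / (volume (Metric.ball x R)).toReal) ^ (1 / (e - 1))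
      = qMeanConst (n + 1) e * ((∏ j, (1 - R * κ j)) / l ^ ((((n + 1 : ℕ) : ℝ) + 1) / 2))
          ^ (-(1 / (2 * (e - 1)))) := by
  have hq : 0 < e - 1 := sub_pos.2 he
  set q := e - 1 with hqdef
  have hfac := factorial_succ_eq_Gamma_mul n
  have hG1 : 0 < Real.Gamma ((n : ℝ) / 2 + 1) := Real.Gamma_pos_of_pos (by positivity)
  have hG2 : 0 < Real.Gamma (((n + 1 : ℕ) : ℝ) / 2 + 1) := Real.Gamma_pos_of_pos (by positivity)
  have hρ : 0 < √R := Real.sqrt_pos.2 hR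
  have hπ : 0 < √Real.pi := Real.sqrt_pos.2 Real.pi_pos
  have hΛ : 0 < √√l := Real.sqrt_pos.2 (Real.sqrt_pos.2 hl)
  have hP : 0 < ∏ j, (1 - R * κ j) := Finset.prod_pos fun j _ => by
    have := (lt_div_iff₀ hR).1 (hκR j)
    linarith
  have hsP : 0 < √(∏ j, (1 - R * κ j)) := Real.sqrt_pos.2 hP
  have hprod : ∏ j, √(1 / R - κ j) = √(∏ j, (1 - R * κ j)) / √R ^ n := by
    rw [Real.sqrt_eq_rpow, ← Real.finsetProd_rpow _ _ fun j _ => by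
      have := (lt_div_iff₀ hR).1 (hκR j)
      linarith]
    simp_rw [← Real.sqrt_eq_rpow]
    rw [eq_div_iff (by positivity), ← Fin.prod_const, ← Finset.prod_mul_distrib]
    refine Finset.prod_congr rfl fun j _ => ?_
    rw [← Real.sqrt_mul (sub_nonneg.2 (hκR j).le)]
    congr 1
    field_simp
  have hvol : (volume (Metric.ball x R)).toReal
      = (√R ^ 2) ^ (n + 1) * (√Real.pi ^ (n + 1) / Real.Gamma (((n + 1 : ℕ) : ℝ) / 2 + 1)) := by
    rw [EuclideanSpace.volume_ball, Fintype.card_fin, ENNReal.toReal_mul, ENNReal.toReal_pow,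
      ENNReal.toReal_ofReal hR.le, ENNReal.toReal_ofReal (by positivity), Real.sq_sqrt hR.le]
  have h1 : (R ^ 2) ^ ((((n + 1 : ℕ) : ℝ) + 1) / (4 * q)) = (√R ^ (n + 2)) ^ (1 / q) := by
    rw [Real.sqrt_eq_rpow, ← Real.rpow_natCast, ← Real.rpow_natCast, ← Real.rpow_mul hR.le,
      ← Real.rpow_mul hR.le, ← Real.rpow_mul hR.le]
    congr 1
    push_cast
    field_simp
    ring
  have h2 : ((∏ j, (1 - R * κ j)) / l ^ ((((n + 1 : ℕ) : ℝ) + 1) / 2)) ^ (-(1 / (2 * q)))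
      = (√√l ^ (n + 2) / √(∏ j, (1 - R * κ j))) ^ (1 / q) := by
    have h3 : √(l ^ ((((n + 1 : ℕ) : ℝ) + 1) / 2)) = √√l ^ (n + 2) := by
      simp only [Real.sqrt_eq_rpow]
      rw [← Real.rpow_natCast, ← Real.rpow_mul hl.le, ← Real.rpow_mul hl.le, ← Real.rpow_mul hl.le]
      congr 1
      push_cast
      ring
    rw [Real.rpow_neg (by positivity), ← Real.inv_rpow (by positivity), inv_div,
      show 1 / (2 * q) = 1 / 2 * (1 / q) by ring_nf, Real.rpow_mul (by positivity),
      ← Real.sqrt_eq_rpow, Real.sqrt_div (by positivity), h3]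
  have hI : 0 ≤ ∫ σ in Ioi (0 : ℝ), Erfc σ ^ q * σ ^ ((n : ℝ) / 2) :=
    setIntegral_nonneg measurableSet_Ioi fun σ hσ =>
      mul_nonneg (Real.rpow_nonneg (Erfc_pos σ).le _) (Real.rpow_nonneg (mem_Ioi.1 hσ).le _)
  have hs4 : √(4 * √l) = 2 * √√l := by
    rw [Real.sqrt_mul (by norm_num), show (4 : ℝ) = 2 ^ 2 by norm_num, Real.sqrt_sq two_pos.le]
  have hsl : √l = √√l ^ 2 := (Real.sq_sqrt (Real.sqrt_nonneg l)).symm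
  rw [qMeanConst, h1, h2, ← hqdef, integral_limitIntegrand hl hR hκR,
    show (((n + 1 : ℕ) : ℝ) - 1) / 2 = (n : ℝ) / 2 by push_cast; ring,
    show (((n + 1 : ℕ) : ℝ) + 1) / 2 = (n : ℝ) / 2 + 1 by push_cast; ring, hprod, hvol, hs4]
  set I := ∫ σ in Ioi (0 : ℝ), Erfc σ ^ q * σ ^ ((n : ℝ) / 2)
  rw [← Real.mul_rpow (by positivity) (by positivity), ← Real.mul_rpow (by positivity)
    (by positivity)]
  congr 1
  rw [show ((n + 1).factorial : ℝ) = 2 ^ (n + 1) * Real.Gamma (n / 2 + 1)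
    * Real.Gamma ((n + 1 : ℕ) / 2 + 1) / √Real.pi from (eq_div_iff hπ.ne').2 hfac]
  -- In terms of `√R` and `l^(1/4)` all exponents are natural numbers.
  generalize Real.Gamma ((n + 1 : ℕ) / 2 + 1) = G2 at *
  generalize Real.Gamma ((n : ℝ) / 2 + 1) = G1 at *
  generalize √Real.pi = p at *
  generalize √(∏ j, (1 - R * κ j)) = P at *
  rw [hsl]
  generalize √√l = L at *
  generalize √R = ρ at *
  rw [Real.sqrt_sq hΛ.le]
  field_simp
  ring

end Constants

section Conclusion

variable {n : ℕ} {Ω : Set (RN (n + 1))} {z ν : RN (n + 1)} {φ : (Submodule.span ℝ {ν})ᗮ → ℝ}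
  {b : OrthonormalBasis (Fin n) ℝ (Submodule.span ℝ {ν})ᗮ} {κ : Fin n → ℝ}
  {v : RN (n + 1) × ℝ → ℝ} {l m R : ℝ}

theorem IsBoundedSolution.ae_mem_Icc (hv : IsBoundedSolution (pucciMinus l m) Ω v) (hl : 0 < l)
    (hm : 0 < m) (hΩ : IsC2Domain Ω) {x : RN (n + 1)} (hball : Metric.ball x R ⊆ Ω) {t : ℝ}
    (ht : 0 < t) :
    ∀ᵐ y ∂volume.restrict (Metric.ball x R), v (y, t) ∈ Icc (0 : ℝ) 1 := by
  filter_upwards [ae_restrict_mem Metric.isOpen_ball.measurableSet] with y hy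
  exact ⟨hv.nonneg hl hm hΩ (y, t) ⟨hball hy, ht⟩, hv.le_one hl hm hΩ (y, t) ⟨hball hy, ht⟩⟩

theorem IsBoundedSolution.aestronglyMeasurable_slice (hv : IsBoundedSolution (pucciMinus l m) Ω v)
    {x : RN (n + 1)} (hball : Metric.ball x R ⊆ Ω) {t : ℝ} (ht : 0 < t) :
    AEStronglyMeasurable (fun y => v (y, t)) (volume.restrict (Metric.ball x R)) :=
  ((hv.continuousOn_slice ht).mono (hball.trans subset_closure)).aestronglyMeasurable
    Metric.isOpen_ball.measurableSet

theorem integrable_max_rpow {α : Type*} [MeasurableSpace α] {μ : Measure α} [IsFiniteMeasure μ]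
    {w : α → ℝ} {q C : ℝ} (hq : 0 < q) (hw : AEStronglyMeasurable w μ) (hC : ∀ᵐ y ∂μ, |w y| ≤ C) :
    Integrable (fun y => max (w y) 0 ^ q) μ := by
  refine Integrable.of_bound ((((continuous_id.max continuous_const).rpow_const
    fun _ => Or.inr hq.le)).comp_aestronglyMeasurable hw) (C ^ q) ?_
  filter_upwards [hC] with y hy
  rw [Real.norm_of_nonneg (Real.rpow_nonneg (le_max_right _ _) _)]
  exact Real.rpow_le_rpow (le_max_right _ _)
    (max_le ((le_abs_self _).trans hy) ((abs_nonneg _).trans hy)) hq.le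

/-- The exponent `a = (N + 1) / (4 q)` is the one for which both parts of the integral have the
same order `t^(a q) = t^((N + 1) / 4)`. -/
theorem IsBoundedSolution.tendsto_integral_signedPow
    (hv : IsBoundedSolution (pucciMinus l m) Ω v) (hl : 0 < l)
    (hm : 0 < m) (hΩ : IsC2Domain Ω) (h : IsC2GraphAt Ω z ν φ) (hφ : fderiv ℝ φ 0 = 0)
    (hκ : ∀ i j, fderiv ℝ (fderiv ℝ φ) 0 (b i) (b j) = if i = j then κ i else 0)
    (hz : z ∈ frontier Ω) (hR : 0 < R)
    (htouch : Metric.closedBall (z + R • ν) R ∩ Ωᶜ = {z}) (hκR : ∀ j, κ j < 1 / R) {q d : ℝ}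
    (hq : 0 < q) (hd : 0 ≤ d) :
    Tendsto (fun t : ℝ => (√√t ^ (n + 2))⁻¹ * ∫ y in Metric.ball (z + R • ν) R,
        signedPow q (v (y, t) - t ^ ((((n + 1 : ℕ) : ℝ) + 1) / (4 * q)) * d)) (𝓝[>] 0)
      (𝓝 ((∫ p, limitIntegrand l R q κ p)
        - d ^ q * (volume (Metric.ball (z + R • ν) R)).toReal)) := by
  have hball := ball_subset_of_touch hR htouch h.norm_eq
  have hfin : IsFiniteMeasure (volume.restrict (Metric.ball (z + R • ν) R)) :=
    ⟨by rw [Measure.restrict_apply_univ]; exact measure_ball_lt_top⟩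
  set a := (((n + 1 : ℕ) : ℝ) + 1) / (4 * q) with ha
  have ha0 : 0 < a := by positivity
  have hμ : Tendsto (fun t : ℝ => t ^ a * d) (𝓝[>] 0) (𝓝 0) := by
    have h1 : Tendsto (fun t : ℝ => t ^ a * d) (𝓝 0) (𝓝 ((0 : ℝ) ^ a * d)) :=
      ((Real.continuousAt_rpow_const 0 a (Or.inr ha0.le)).tendsto).mul_const d
    rw [Real.zero_rpow ha0.ne', zero_mul] at h1
    exact h1.mono_left nhdsWithin_le_nhds
  have hpos := hv.tendsto_integral_pos_part hl hm hΩ h hφ hκ hz hR htouch hκR hq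
    (μ := fun t => t ^ a * d)
    (fun t ht => mul_nonneg (Real.rpow_nonneg (le_of_lt ht) _) hd) hμ
  have hneg := hv.tendsto_integral_neg_part hl hm hΩ hball (a := a) hq hd
  refine (hpos.sub hneg).congr' ?_
  filter_upwards [self_mem_nhdsWithin] with t ht
  have ht' : (0 : ℝ) < t := ht
  have hae := hv.ae_mem_Icc hl hm hΩ hball ht'
  have hmeas := hv.aestronglyMeasurable_slice hball ht'
  have htd : 0 ≤ t ^ a * d := mul_nonneg (Real.rpow_nonneg ht'.le _) hd
  have hI1 : Integrable (fun y => max (v (y, t) - t ^ a * d) 0 ^ q)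
      (volume.restrict (Metric.ball (z + R • ν) R)) := by
    refine integrable_max_rpow (C := 1 + t ^ a * d) hq (hmeas.sub aestronglyMeasurable_const) ?_
    filter_upwards [hae] with y hy
    rw [abs_le]
    constructor <;> linarith [hy.1, hy.2]
  have hI2 : Integrable (fun y => max (-(v (y, t) - t ^ a * d)) 0 ^ q)
      (volume.restrict (Metric.ball (z + R • ν) R)) := by
    refine integrable_max_rpow (C := 1 + t ^ a * d) hq
      (hmeas.sub aestronglyMeasurable_const).neg ?_
    filter_upwards [hae] with y hy
    rw [abs_le]
    constructor <;> linarith [hy.1, hy.2]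
  have hscale : √√t ^ (n + 2) = (t ^ a) ^ q := by
    simp only [Real.sqrt_eq_rpow]
    rw [← Real.rpow_natCast, ← Real.rpow_mul ht'.le, ← Real.rpow_mul ht'.le,
      ← Real.rpow_mul ht'.le]
    congr 1
    rw [ha]
    push_cast
    field_simp
    ring
  have hta : 0 < t ^ a := Real.rpow_pos_of_pos ht' a
  have hcongr : ∀ y, max (-(v (y, t) - t ^ a * d)) 0 ^ q
      = √√t ^ (n + 2) * max (d - t ^ (-a) * v (y, t)) 0 ^ q := by
    intro y
    rw [hscale, ← Real.mul_rpow hta.le (le_max_right _ _), mul_max_of_nonneg _ _ hta.le, mul_zero,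
      Real.rpow_neg ht'.le]
    congr 2
    field_simp
    ring
  simp only [signedPow]
  rw [integral_sub hI1 hI2]
  simp_rw [hcongr]
  rw [integral_const_mul, mul_sub, inv_mul_cancel_left₀ (by positivity)]

/-- The sign of the limit `J - d^(e-1) V` decides, for small `t`, on which side of `t^a d` the mean
lies. -/
theorem IsBoundedSolution.exists_isQMean_tendsto
    (hv : IsBoundedSolution (pucciMinus l m) Ω v) (hl : 0 < l)
    (hm : 0 < m) (hΩ : IsC2Domain Ω) (h : IsC2GraphAt Ω z ν φ) (hφ : fderiv ℝ φ 0 = 0)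
    (hκ : ∀ i j, fderiv ℝ (fderiv ℝ φ) 0 (b i) (b j) = if i = j then κ i else 0)
    (hz : z ∈ frontier Ω) (hR : 0 < R)
    (htouch : Metric.closedBall (z + R • ν) R ∩ Ωᶜ = {z}) (hκR : ∀ j, κ j < 1 / R) {e : ℝ}
    (he : 1 < e) :
    ∃ μ : ℝ → ℝ, (∀ t, 0 < t →
      IsQMean (ENNReal.ofReal e) (Metric.ball (z + R • ν) R) (fun y => v (y, t)) (μ t)) ∧
      Tendsto (fun t : ℝ => t ^ (-((((n + 1 : ℕ) : ℝ) + 1) / (4 * (e - 1)))) * μ t) (𝓝[>] 0)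
        (𝓝 (((∫ p, limitIntegrand l R (e - 1) κ p)
          / (volume (Metric.ball (z + R • ν) R)).toReal) ^ (1 / (e - 1)))) := by
  have hq : 0 < e - 1 := sub_pos.2 he
  have hball := ball_subset_of_touch hR htouch h.norm_eq
  set B := Metric.ball (z + R • ν) R with hB
  have hfin : IsFiniteMeasure (volume.restrict B) :=
    ⟨by rw [Measure.restrict_apply_univ]; exact measure_ball_lt_top⟩
  have hne : NeZero (volume.restrict B) :=
    ⟨by rw [Ne, Measure.restrict_eq_zero]; exact (Metric.measure_ball_pos volume _ hR).ne'⟩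
  have hlim := fun {d : ℝ} => hv.tendsto_integral_signedPow hl hm hΩ h hφ hκ hz hR htouch hκR
    (d := d) hq
  have hex : ∀ t : ℝ, ∃ m : ℝ, 0 < t → IsQMean (ENNReal.ofReal e) B (fun y => v (y, t)) m ∧
      (∀ c, 0 < ∫ y in B, signedPow (e - 1) (v (y, t) - c) → c < m) ∧
      ∀ c, ∫ y in B, signedPow (e - 1) (v (y, t) - c) < 0 → m < c := by
    intro t
    by_cases ht : 0 < t
    · obtain ⟨m, hm'⟩ := exists_eLpNorm_sub_lt he (hv.aestronglyMeasurable_slice hball ht)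
        (hv.ae_mem_Icc hl hm hΩ hball ht)
      exact ⟨m, fun _ => hm'⟩
    · exact ⟨0, fun h => (ht h).elim⟩
  choose μ hμ using hex
  refine ⟨μ, fun t ht => (hμ t ht).1, ?_⟩
  set a := (((n + 1 : ℕ) : ℝ) + 1) / (4 * (e - 1)) with ha
  set J := ∫ p, limitIntegrand l R (e - 1) κ p with hJ
  set V := (volume B).toReal with hV
  have hV0 : 0 < V := ENNReal.toReal_pos (Metric.measure_ball_pos volume _ hR).ne'
    measure_ball_lt_top.ne
  have hJ0 : 0 ≤ J := integral_nonneg (limitIntegrand_nonneg l R (e - 1) κ)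
  have hL0 : 0 ≤ (J / V) ^ (1 / (e - 1)) := by positivity
  have hLq : ((J / V) ^ (1 / (e - 1))) ^ (e - 1) * V = J := by
    rw [one_div, Real.rpow_inv_rpow (by positivity) hq.ne', div_mul_cancel₀ _ hV0.ne']
  have hcancel : ∀ t : ℝ, 0 < t → t ^ (-a) * t ^ a = 1 := fun t ht => by
    rw [← Real.rpow_add ht, neg_add_cancel, Real.rpow_zero]
  refine tendsto_order.2 ⟨fun c hc => ?_, fun c hc => ?_⟩
  -- Negative levels lie below the mean because `v ≥ 0`.
  · rcases lt_or_ge c 0 with hc0 | hc0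
    · filter_upwards [self_mem_nhdsWithin] with t ht
      have ht' : (0 : ℝ) < t := ht
      have hpos : 0 < ∫ y in B, signedPow (e - 1) (v (y, t) - t ^ a * c) := by
        refine integral_pos_of_ae_pos (integrable_signedPow_sub hq
          (hv.aestronglyMeasurable_slice hball ht') (hv.ae_mem_Icc hl hm hΩ hball ht') _) ?_
        filter_upwards [hv.ae_mem_Icc hl hm hΩ hball ht'] with y hy
        have h1 : t ^ a * c < 0 := mul_neg_of_pos_of_neg (Real.rpow_pos_of_pos ht' a) hc0
        rw [signedPow_of_nonneg hq (by linarith [hy.1])]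
        exact Real.rpow_pos_of_pos (by linarith [hy.1]) _
      have := mul_lt_mul_of_pos_left ((hμ t ht').2.1 _ hpos) (Real.rpow_pos_of_pos ht' (-a))
      rwa [← mul_assoc, hcancel t ht', one_mul] at this
    · have hlt : 0 < J - c ^ (e - 1) * V := by
        rw [sub_pos, ← hLq]
        exact mul_lt_mul_of_pos_right (Real.rpow_lt_rpow hc0 hc hq) hV0
      filter_upwards [(hlim hc0).eventually (lt_mem_nhds hlt), self_mem_nhdsWithin] with t h1 ht
      have ht' : (0 : ℝ) < t := ht
      have hpos := (mul_pos_iff_of_pos_left (by positivity)).1 h1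
      have := mul_lt_mul_of_pos_left ((hμ t ht').2.1 _ hpos) (Real.rpow_pos_of_pos ht' (-a))
      rwa [← mul_assoc, hcancel t ht', one_mul] at this
  · have hlt : J - c ^ (e - 1) * V < 0 := by
      rw [sub_neg, ← hLq]
      exact mul_lt_mul_of_pos_right (Real.rpow_lt_rpow hL0 hc hq) hV0
    filter_upwards [(hlim (hL0.trans hc.le)).eventually (gt_mem_nhds hlt),
      self_mem_nhdsWithin] with t h1 ht
    have ht' : (0 : ℝ) < t := ht
    have hneg := (pos_iff_neg_of_mul_neg h1).1 (by positivity)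
    have := mul_lt_mul_of_pos_left ((hμ t ht').2.2 _ hneg) (Real.rpow_pos_of_pos ht' (-a))
    rwa [← mul_assoc, hcancel t ht', one_mul] at this

theorem IsBoundedSolution.exists_isQMean_top_tendsto
    (hv : IsBoundedSolution (pucciMinus l m) Ω v) (hl : 0 < l) (hm : 0 < m) (hΩ : IsC2Domain Ω)
    {x : RN (n + 1)} (hx : x ∈ Ω) (hball : Metric.ball x R ⊆ Ω) (hR : 0 < R)
    (hz : z ∈ frontier Ω) (hzB : z ∈ closure (Metric.ball x R)) :
    ∃ μ : ℝ → ℝ, (∀ t, 0 < t → IsQMean ⊤ (Metric.ball x R) (fun y => v (y, t)) (μ t)) ∧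
      Tendsto μ (𝓝[>] 0) (𝓝 (1 / 2)) := by
  set B := Metric.ball x R with hB
  have hxB : x ∈ B := Metric.mem_ball_self hR
  have h0 : ∀ t, 0 < t → ∀ y ∈ B, 0 ≤ v (y, t) := fun t ht y hy =>
    hv.nonneg hl hm hΩ (y, t) ⟨hball hy, ht⟩
  have hbdd : ∀ t, 0 < t → BddBelow ((fun y => v (y, t)) '' B) := fun t ht =>
    ⟨0, by rintro _ ⟨y, hy, rfl⟩; exact h0 t ht y hy⟩
  have hne : ∀ t, ((fun y => v (y, t)) '' B).Nonempty := fun t => ⟨_, x, hxB, rfl⟩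
  refine ⟨fun t => (sInf ((fun y => v (y, t)) '' B) + 1) / 2, fun t ht => ?_, ?_⟩
  · have hcont := hv.continuousOn_slice ht
    refine isQMean_top Metric.isOpen_ball (hcont.mono (hball.trans subset_closure))
      (fun y hy => ⟨csInf_le (hbdd t ht) ⟨y, hy, rfl⟩,
        hv.le_one hl hm hΩ (y, t) ⟨hball hy, ht⟩⟩) (fun a ha => ?_) fun a ha => ?_
    · obtain ⟨_, ⟨y, hy, rfl⟩, hlt⟩ := exists_lt_of_csInf_lt (hne t) ha
      exact ⟨y, hy, hlt⟩
    · have h1 : Tendsto (fun y => v (y, t)) (𝓝[B] z) (𝓝 1) := by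
        have := hcont z (frontier_subset_closure hz)
        rw [ContinuousWithinAt, hv.boundary z hz t ht] at this
        exact this.mono_left (nhdsWithin_mono z (hball.trans subset_closure))
      have hbot : (𝓝[B] z).NeBot := mem_closure_iff_nhdsWithin_neBot.1 hzB
      obtain ⟨y, hy1, hy2⟩ := ((h1.eventually (lt_mem_nhds ha)).and self_mem_nhdsWithin).exists
      exact ⟨y, hy2, hy1⟩
  · have hxt : Tendsto (fun t => v (x, t)) (𝓝[>] 0) (𝓝 0) := by
      have hmem : ((x, 0) : RN (n + 1) × ℝ) ∈ (closure Ω ×ˢ Ici (0 : ℝ)) \ (frontier Ω ×ˢ {0}) :=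
        ⟨⟨subset_closure hx, self_mem_Ici⟩, fun h => (hΩ.1.frontier_eq ▸ h.1).2 hx⟩
      have h1 := hv.continuousOn _ hmem
      rw [ContinuousWithinAt, hv.initial x hx] at h1
      refine h1.comp (tendsto_nhdsWithin_iff.2 ⟨?_, ?_⟩)
      · exact ((continuous_const.prodMk continuous_id).tendsto' 0 (x, 0) rfl).mono_left
          nhdsWithin_le_nhds
      · filter_upwards [self_mem_nhdsWithin] with t ht
        exact ⟨⟨subset_closure hx, mem_Ici.2 (le_of_lt ht)⟩, fun h => (ne_of_gt ht) h.2⟩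
    have hinf : Tendsto (fun t => sInf ((fun y => v (y, t)) '' B)) (𝓝[>] 0) (𝓝 0) := by
      refine tendsto_of_tendsto_of_tendsto_of_le_of_le' tendsto_const_nhds hxt ?_ ?_
      · filter_upwards [self_mem_nhdsWithin] with t ht
        refine le_csInf (hne t) ?_
        rintro _ ⟨y, hy, rfl⟩
        exact h0 t ht y hy
      · filter_upwards [self_mem_nhdsWithin] with t ht
        exact csInf_le (hbdd t ht) ⟨x, hxB, rfl⟩
    simpa using (hinf.add_const 1).div_const 2

theorem IsBoundedSolution.qMeanAsymptotics [Nonempty (Fin n)]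
    (hv : IsBoundedSolution (pucciMinus l m) Ω v) (hl : 0 < l)
    (hm : 0 < m) (hΩ : IsC2Domain Ω) (h : IsC2GraphAt Ω z ν φ) (hφ : fderiv ℝ φ 0 = 0)
    (hκ : ∀ i j, fderiv ℝ (fderiv ℝ φ) 0 (b i) (b j) = if i = j then κ i else 0)
    (hz : z ∈ frontier Ω) (hR : 0 < R) (hx : z + R • ν ∈ Ω)
    (htouch : Metric.closedBall (z + R • ν) R ∩ Ωᶜ = {z}) (hκR : ∀ j, κ j < 1 / R) :
    QMeanAsymptotics v (z + R • ν) R (∏ j, (1 - R * κ j)) l := by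
  have hball := ball_subset_of_touch hR htouch h.norm_eq
  refine ⟨fun e he => ?_, hv.exists_isQMean_top_tendsto hl hm hΩ hx hball hR hz ?_⟩
  · obtain ⟨μ, hμ, hlim⟩ := hv.exists_isQMean_tendsto hl hm hΩ h hφ hκ hz hR htouch hκR he
    refine ⟨μ, hμ, ?_⟩
    rw [← rpow_mul_ratio_eq_qMeanConst he hl hR hκR (z + R • ν)]
    refine (hlim.const_mul _).congr' ?_
    filter_upwards [self_mem_nhdsWithin] with t ht
    have ht' : (0 : ℝ) < t := ht
    rw [← mul_assoc, Real.rpow_neg ht'.le, ← div_eq_mul_inv,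
      ← Real.div_rpow (by positivity) ht'.le]
  · rw [closure_ball _ hR.ne']
    exact (htouch.symm ▸ mem_singleton z : z ∈ Metric.closedBall (z + R • ν) R ∩ Ωᶜ).1

end Conclusion

theorem mainTheorem4 (N : ℕ) (hN : 2 ≤ N) (lam Lam : ℝ) (hlam : 0 < lam) (hLam : lam ≤ Lam)
    (Ω : Set (RN N)) (hΩ : IsC2Domain Ω)
    (x z : RN N) (R : ℝ) (hx : x ∈ Ω) (hR : 0 < R) (hz : z ∈ frontier Ω)
    (htouch : Metric.closedBall x R ∩ Ωᶜ = {z})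
    (κ : Fin (N - 1) → ℝ) (hκ : ArePrincipalCurvatures Ω z κ) (hκR : ∀ j, κ j < 1 / R) :
    (∀ v : RN N × ℝ → ℝ, IsBoundedSolution (pucciMinus lam Lam) Ω v →
      QMeanAsymptotics v x R (∏ j, (1 - R * κ j)) lam) ∧
    (∀ v : RN N × ℝ → ℝ, IsBoundedSolution (pucciPlus lam Lam) Ω v →
      QMeanAsymptotics v x R (∏ j, (1 - R * κ j)) Lam) := by
  obtain ⟨n, rfl⟩ : ∃ n, N = n + 1 := ⟨N - 1, by omega⟩
  have hn : Nonempty (Fin n) := Fin.pos_iff_nonempty.1 (by omega)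
  have hLam0 : 0 < Lam := hlam.trans_le hLam
  obtain ⟨ν, φ, b, h, hφ, hess⟩ := hκ
  obtain rfl := h.eq_add_smul hφ hx htouch
  -- `M⁺` is `M⁻` with the ellipticity constants exchanged.
  exact ⟨fun v hv => hv.qMeanAsymptotics hlam hLam0 hΩ h hφ hess hz hR hx htouch hκR,
    fun v hv => IsBoundedSolution.qMeanAsymptotics (l := Lam) (m := lam) hv hLam0 hlam hΩ h hφ hess
      hz hR hx htouch hκR⟩
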